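/- A two-step rule is a map $\mathcal R:\{e,n,w,s\}^2\to\{0,1\}$ (east, north, west, south); a walk on $\mathbb Z^2$ starting at the origin obeys $\mathcal R$ if each step $i$ is followed by a step $j$ only when $\mathcal R(i,j)=1$ (the first step is arbitrary, and walks have at least one step). With $\mathbf T=(\mathcal R(i,j))_{i,j}$, the rule is aperiodic if some power $\mathbf T^k$, $k\ge1$, has only positive entries; it is vertically unbounded if it is neither the case that walks always have a north step between any two south steps, nor that they always have a south step between any two north steps. A walk of length $m$ ending at $(a,b)$ has weight $t^mx^ay^b$. For a step direction $\theta$ consider the walks that contain exactly one $\theta$ step, as their last step: $B_\theta(t;x,y)$ is the generating function of those whose first step may follow a $\theta$ step, $C_\theta$ of those not starting with a south step, and $D_\theta$ of those starting with a south step. Let $\Theta^+_m(x,y)$ be the sum of $x^ay^b$ over the walks of length $m$ that end with a $\theta$ step and stay in the half plane $\{\mathbf y\ge0\}$, and $H_\theta(t;x,y)=\sum_m\Theta_m^+(x,y)t^m$. For $x,y>0$ let $\rho(x,y)$ be the smallest positive root $t$ of $B_\theta(t;x,y)=1$, and $\mu(x,y)=1/\rho(x,y)$. The vertical drift is $\delta_{\mathbf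 y}(x,y)=\dfrac{\partial_yB_\theta(\rho;x,y)}{\rho\,\partial_tB_\theta(\rho;x,y)}=\partial_y\log\mu(x,y)$, with $\rho=\rho(x,y)$. Superscripts $(i,j,k)$ denote partial derivatives with respect to $(t,x,y)$, and $\mu^{(0,2)}=\partial_y^2\mu$. **Statement.** Let $\mathcal R$ be aperiodic and vertically unbounded, and let $x\in(0,\infty)$. Then $\rho(x,y)$ does not depend on $\theta$, and there are unique numbers $\kappa=\kappa(x)>0$ and $\tau=\tau(x)>0$ for which there are two positive, continuously differentiable functions $\upsilon^\pm(t)$ on $0<t<\kappa$ with $B_\theta(t;x,\upsilon^\pm(t))=1$ for every $\theta$, such that $\upsilon^-$ is increasing, with $\upsilon^-\to0$ as $t\to0$ and $\upsilon^-\to\tau$ as $t\to\kappa$, and $\upsilon^+$ is decreasing, with $\upsilon^+\to\infty$ as $t\to0$ and $\upsilon^+\to\tau$ as $t\to\kappa$. Take $y=\tau(x)$. Then $\rho(x,\tau)=\kappa$, $B_\theta(\kappa;x,\tau)=1$ and the vertical drift is zero: $\delta_{\mathbf y}(x,\tau)=0$. For each $\theta$, the radius of convergence of $H_\theta(\,\cdot\,;x,\tau)$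 is $\rho(x,\tau)$, and as $t\to\rho(x,\tau)$ within the disc of convergence, $$H_\theta(t;x,\tau)\sim c^0\,(1-t/\rho(x,\tau))^{-1/2},$$ where $$c^0=\sqrt{\frac{2}{\kappa\,\mu^{(0,2)}(x,\tau)}}\cdot\frac{1}{\kappa B_\theta^{(1,0,0)}(\kappa;x,\tau)}\left(C_\theta^{(0,0,1)}(\kappa;x,\tau)-D_\theta^{(0,0,1)}(\kappa;x,\tau)\frac{C_\theta(\kappa;x,\tau)}{D_\theta(\kappa;x,\tau)}\right);$$ here all the derivatives exist, $\mu^{(0,2)}(x,\tau)$, $B_\theta^{(1,0,0)}(\kappa;x,\tau)$, $C_\theta(\kappa;x,\tau)$ and $D_\theta(\kappa;x,\tau)$ are positive, and $c^0>0$. Moreover $$\Theta^+_m(x,\tau)\sim\frac{c^0}{\sqrt{\pi m}}\,\mu(x)^m\qquad(m\to\infty),\qquad \mu(x)=1/\kappa(x)=1/\rho(x,\tau(x)).$$ -/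

import Mathlib

open Set Filter Topology Asymptotics

namespace TwoStep

/-- The four step types of the square lattice: east, north, west, south. -/
inductive Step where
  | e
  | n
  | w
  | s
  deriving DecidableEq

instance : Fintype Step where
  elems := {.e, .n, .w, .s}
  complete := by intro a; cases a <;> decide

/-- Horizontal displacement of a step. -/
def Step.dx : Step → ℤ
  | .e => 1
  | .n => 0
  | .w => -1
  | .s => 0

/-- Vertical displacement of a step. -/
def Step.dy : Step → ℤ
  | .e => 0
  | .n => 1
  | .w => 0
  | .s => -1

/-- A two-step rule: `R i j = true` iff a step of type `i` may be followed by one of type `j`. -/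
abbrev Rule := Step → Step → Bool

/-- The transfer matrix of a rule. -/
def transferMatrix (R : Rule) : Matrix Step Step ℕ :=
  Matrix.of fun i j => if R i j = true then 1 else 0

/-- A rule is aperiodic if some positive power of its transfer matrix is entrywise positive. -/
def Aperiodic (R : Rule) : Prop :=
  ∃ k : ℕ, 1 ≤ k ∧ ∀ i j : Step, 0 < (transferMatrix R ^ k) i j

/-- A (nonempty) walk obeying the rule `R`, starting at the origin, as its list of steps.
The first step is arbitrary. -/
def IsWalk (R : Rule) (l : List Step) : Prop :=
  l ≠ [] ∧ l.IsChain (fun i j => R i j = true)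

/-- Between any two south steps of a walk there is a north step. -/
def NorthBound (R : Rule) : Prop :=
  ∀ l : List Step, IsWalk R (Step.s :: (l ++ [Step.s])) → Step.n ∈ l

/-- Between any two north steps of a walk there is a south step. -/
def SouthBound (R : Rule) : Prop :=
  ∀ l : List Step, IsWalk R (Step.n :: (l ++ [Step.n])) → Step.s ∈ l

/-- Neither north-bound nor south-bound. -/
def VerticallyUnbounded (R : Rule) : Prop :=
  ¬ NorthBound R ∧ ¬ SouthBound R

/-- The `x`-coordinate of the endpoint of a walk started at the origin. -/
def xEnd (l : List Step) : ℤ := (l.map Step.dx).sum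

/-- The `y`-coordinate of the endpoint of a walk started at the origin. -/
def yEnd (l : List Step) : ℤ := (l.map Step.dy).sum

open Classical in
/-- The partition function of the walks of length `m` in the class `P`: the sum of
`x ^ a * y ^ b` over these walks, where `(a, b)` is the endpoint. -/
noncomputable def partitionFn (P : List Step → Prop) (m : ℕ) (x y : ℝ) : ℝ :=
  ∑ v : List.Vector Step m,
    if P v.toList then x ^ xEnd v.toList * y ^ yEnd v.toList else 0

/-- The generating function of a class `P` of walks, by length and endpoint, at real `t`. -/
noncomputable def genFun (P : List Step → Prop) (t x y : ℝ) : ℝ :=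
  ∑' m : ℕ, partitionFn P m x y * t ^ m

/-- Walks containing exactly one `θ` step, which is their last step. -/
def SingleLast (R : Rule) (θ : Step) (l : List Step) : Prop :=
  IsWalk R l ∧ l.count θ = 1 ∧ l.getLast? = some θ

/-- `B_θ`: walks whose first step may follow a `θ` step, and which contain exactly one `θ` step,
their last. -/
noncomputable def B (R : Rule) (θ : Step) : ℝ → ℝ → ℝ → ℝ :=
  genFun fun l => SingleLast R θ l ∧ ∃ φ, l.head? = some φ ∧ R θ φ = true

/-- `C_θ`: walks which do not start with a south step, and which contain exactly one `θ` step,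
their last. -/
noncomputable def C (R : Rule) (θ : Step) : ℝ → ℝ → ℝ → ℝ :=
  genFun fun l => SingleLast R θ l ∧ l.head? ≠ some Step.s

/-- `D_θ`: walks which start with a south step, and which contain exactly one `θ` step,
their last. -/
noncomputable def D (R : Rule) (θ : Step) : ℝ → ℝ → ℝ → ℝ :=
  genFun fun l => SingleLast R θ l ∧ l.head? = some Step.s

/-- Walks ending with a `θ` step all of whose vertices lie in the upper half plane. -/
def HalfPlaneWalk (R : Rule) (θ : Step) (l : List Step) : Prop :=
  IsWalk R l ∧ l.getLast? = some θ ∧ ∀ p : List Step, p <+: l → 0 ≤ yEnd p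

/-- `Θ⁺_m(x,y)`: the half-plane partition function of walks of length `m` ending with `θ`. -/
noncomputable def halfPartition (R : Rule) (θ : Step) (m : ℕ) (x y : ℝ) : ℝ :=
  partitionFn (HalfPlaneWalk R θ) m x y

/-- `H_θ(t;x,y)`, as a function of complex `t`. -/
noncomputable def H (R : Rule) (θ : Step) (t : ℂ) (x y : ℝ) : ℂ :=
  ∑' m : ℕ, (halfPartition R θ m x y : ℂ) * t ^ m

/-- `ρ_θ(x,y)`: the smallest positive root `t` of `B_θ(t;x,y) = 1`. -/
noncomputable def rho (R : Rule) (θ : Step) (x y : ℝ) : ℝ :=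
  sInf {t : ℝ | 0 < t ∧ B R θ t x y = 1}

/-- `μ_θ(x,y) = 1 / ρ_θ(x,y)`. -/
noncomputable def mu (R : Rule) (θ : Step) (x y : ℝ) : ℝ := 1 / rho R θ x y

/-- The vertical drift `δ_y(x,y) = ∂_y B_θ / (ρ ∂_t B_θ)`, evaluated at `(ρ(x,y);x,y)`. -/
noncomputable def verticalDrift (R : Rule) (θ : Step) (x y : ℝ) : ℝ :=
  deriv (fun v => B R θ (rho R θ x y) x v) y /
    (rho R θ x y * deriv (fun t => B R θ t x y) (rho R θ x y))

/-- `κ = κ(x)` and `τ = τ(x)`: for `0 < t < κ` there are two positive, continuously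
differentiable solutions `υ⁻(t)` and `υ⁺(t)` of `B_θ(t;x,υ) = 1` (for every `θ`); `υ⁻` increases
from `0` to `τ` and `υ⁺` decreases from `∞` to `τ`. -/
def IsKappaTau (R : Rule) (x κ τ : ℝ) : Prop :=
  0 < κ ∧ 0 < τ ∧ ∃ υm υp : ℝ → ℝ,
    (∀ t ∈ Ioo 0 κ, 0 < υm t ∧ 0 < υp t) ∧
    ContDiffOn ℝ 1 υm (Ioo 0 κ) ∧ ContDiffOn ℝ 1 υp (Ioo 0 κ) ∧
    (∀ θ : Step, ∀ t ∈ Ioo 0 κ, B R θ t x (υm t) = 1 ∧ B R θ t x (υp t) = 1) ∧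
    StrictMonoOn υm (Ioo 0 κ) ∧ StrictAntiOn υp (Ioo 0 κ) ∧
    Tendsto υm (𝓝[>] 0) (𝓝 0) ∧ Tendsto υm (𝓝[<] κ) (𝓝 τ) ∧
    Tendsto υp (𝓝[>] 0) atTop ∧ Tendsto υp (𝓝[<] κ) (𝓝 τ)

/-- The constant `c⁰`, as a function of `x`, `κ = κ(x)` and `τ = τ(x)`. -/
noncomputable def c0 (R : Rule) (θ : Step) (x κ τ : ℝ) : ℝ :=
  √(2 / (κ * iteratedDeriv 2 (fun v => mu R θ x v) τ)) *
    (1 / (κ * deriv (fun t => B R θ t x τ) κ)) *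
    (deriv (fun v => C R θ κ x v) τ -
      deriv (fun v => D R θ κ x v) τ * (C R θ κ x τ / D R θ κ x τ))

end TwoStep

/-! The weighted transfer matrix W(x,y) is primitive, and everything is read off its Perron data.
The first-passage series F_j (walks from a `j` step to the first `θ` step) satisfy F = tWF except
for a defect proportional to 1 - B_θ in the row of `θ` (`firstPassageGF_eigen`). So B_θ = 1 exactly
when F is the Perron vector: ρ is the inverse Perron eigenvalue, whatever `θ` is. Deleting a row of
a primitive matrix lowers its spectral radius, so the first-passage series are smooth in a
neighbourhood of (y, ρ(x,y)), and the implicit function theorem makes ρ smooth.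

Shape of ρ: B_s is convex in y, and strictly so because vertical unboundedness supplies a walk of
height -1 counted by B_s. Hence a critical point of ρ(x,·) is a strict global maximum
(`rho_lt_of_deriv_eq_zero`), while walks of heights -1 and +1 force ρ → 0 as y → 0 and as y → ∞. So
ρ(x,·) is strictly unimodal with a nondegenerate maximum κ at τ, and υ⁻, υ⁺ are the inverses of its
two monotone pieces.

Kernel method: let a_m be the row vector of half-plane walks of length m that may be followed by a
given step, and b_m the walks that end on the boundary and may be followed by a south step. Then
a_{m+1} = (a_m - b_m e_s)W, and b_m does not depend on y. Pairing with the Perron vector r gives a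
mass p_m = t^m a_m·r that decreases by t^m b_m r_s at each step. On the lower branch (υ⁻(t), t) the
mass tends to 0, so the boundary series there equals 1 + C/D (`hasSum_boundaryFn`). Inserted in the
recursion at (τ, κ), this expresses Σ p_m s^m through the difference of C/D at (τ, κ) and at
(υ⁻(κs), κs). Since τ - υ⁻(κs) is asymptotic to a multiple of √(1-s), the sum has an inverse
square-root singularity as s → 1 along the reals (`tendsto_sqrt_mul_tsum_weightedMass`); its
amplitude is positive by a minimum principle for ∂_y F.

Complex singularity analysis is avoided because p_m is monotone. Karamata's theorem
(`tendsto_sqrt_mul_of_tendsto_tsum`) turns real asymptotics into √m p_m → c/√π, and summation by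
parts gives the generating function back in the whole complex disc, with unrestricted approach
(`tendsto_sqrt_norm_mul_tsum_sub`).

Finally κ^m a_m - p_m l, with l the normalised left Perron vector, lies in the hyperplane orthogonal
to r, where powers of κW contract, and is driven by the summable sequence κ^m b_m. It is therefore
summable and o(m^{-1/2}), so the counts of walks ending in `θ` are p_m times the constant 1/(κ ∂_t
B_θ) up to a negligible error (`summable_and_tendsto_halfPartition_sub`). -/

namespace TwoStep

/-! ### The coefficients of `(1 - z) ^ (-1/2)` -/

/-- The `m`-th coefficient of `(1 - z) ^ (-1/2)`. -/
noncomputable def invSqrtCoeff (m : ℕ) : ℝ :=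
  ∏ i ∈ Finset.range m, ((2 * i + 1 : ℝ) / (2 * i + 2))

lemma invSqrtCoeff_succ (m : ℕ) :
    invSqrtCoeff (m + 1) = invSqrtCoeff m * ((2 * m + 1 : ℝ) / (2 * m + 2)) :=
  Finset.prod_range_succ _ _

lemma invSqrtCoeff_pos (m : ℕ) : 0 < invSqrtCoeff m :=
  Finset.prod_pos fun i _ => by positivity

lemma invSqrtCoeff_antitone : Antitone invSqrtCoeff := by
  refine antitone_nat_of_succ_le fun m => ?_
  rw [invSqrtCoeff_succ]
  refine mul_le_of_le_one_right (invSqrtCoeff_pos m).le ?_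
  rw [div_le_one (by positivity)]
  linarith

/-- An exact relation with Wallis' product: the known two-sided bounds on `Real.Wallis.W` become the
two explicit bounds on the coefficients below. -/
lemma sq_invSqrtCoeff_mul (m : ℕ) :
    invSqrtCoeff m ^ 2 * (2 * m + 1) * Real.Wallis.W m = 1 := by
  induction m with
  | zero => simp [invSqrtCoeff, Real.Wallis.W]
  | succ k ih =>
    rw [invSqrtCoeff_succ, Real.Wallis.W_succ]
    calc _ = invSqrtCoeff k ^ 2 * (2 * k + 1) * Real.Wallis.W k := by
          push_cast; field_simp; ring
      _ = 1 := ih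

lemma sqrt_mul_invSqrtCoeff_le (m : ℕ) : √(Real.pi * m) * invSqrtCoeff m ≤ 1 := by
  have hW := Real.Wallis.le_W m
  have h1 := sq_invSqrtCoeff_mul m
  have hq := invSqrtCoeff_pos m
  have hpi := Real.pi_pos
  rw [← abs_of_nonneg (mul_nonneg (Real.sqrt_nonneg _) hq.le), ← sq_le_one_iff_abs_le_one, mul_pow,
    Real.sq_sqrt (by positivity)]
  have h2 : invSqrtCoeff m ^ 2 * (2 * m + 1) * ((2 * m + 1) / (2 * m + 2) * (Real.pi / 2)) ≤ 1 := by
    exact le_trans (by gcongr) h1.le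
  have h3 : (m : ℝ) ≤ (2 * m + 1) * ((2 * m + 1) / (2 * m + 2) * (1 / 2)) := by
    rw [div_mul_eq_mul_div, mul_div_assoc', le_div_iff₀ (by positivity)]; nlinarith
  calc Real.pi * m * invSqrtCoeff m ^ 2
      ≤ Real.pi * ((2 * m + 1) * ((2 * m + 1) / (2 * m + 2) * (1 / 2))) * invSqrtCoeff m ^ 2 := by
        gcongr
    _ = _ := by ring
    _ ≤ 1 := h2

lemma one_le_sqrt_mul_invSqrtCoeff (m : ℕ) : 1 ≤ √(Real.pi * (m + 1)) * invSqrtCoeff m := by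
  have hW := Real.Wallis.W_le m
  have h1 := sq_invSqrtCoeff_mul m
  have hq := invSqrtCoeff_pos m
  have hpi := Real.pi_pos
  rw [← abs_of_nonneg (mul_nonneg (Real.sqrt_nonneg _) hq.le), ← one_le_sq_iff_one_le_abs, mul_pow,
    Real.sq_sqrt (by positivity)]
  calc (1 : ℝ) = invSqrtCoeff m ^ 2 * (2 * m + 1) * Real.Wallis.W m := h1.symm
    _ ≤ invSqrtCoeff m ^ 2 * (2 * m + 2) * (Real.pi / 2) := by
        gcongr
        · exact (Real.Wallis.W_pos m).le
        · norm_num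
    _ = _ := by ring

lemma hasSum_invSqrtCoeff {z : ℂ} (hz : ‖z‖ < 1) :
    HasSum (fun m => (invSqrtCoeff m : ℂ) * z ^ m) ((1 - z) ^ (-(1 / 2) : ℂ)) := by
  have hc : ∀ m : ℕ, (invSqrtCoeff m : ℂ) = Ring.choose ((1 / 2 : ℂ) + m - 1) m := by
    intro m
    -- The rising factorial of 1/2 identifies the product with the generalised binomial coefficient
    -- of the binomial series.
    have h1 : (ascPochhammer ℂ m).eval (1 / 2 : ℂ) = m.factorial * (invSqrtCoeff m : ℂ) := by
      induction m with
      | zero => simp [invSqrtCoeff]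
      | succ k ih =>
        rw [ascPochhammer_succ_eval, ih, invSqrtCoeff_succ, Nat.factorial_succ]
        have : (2 * (k : ℂ) + 2) ≠ 0 := by exact_mod_cast (by omega : 2 * k + 2 ≠ 0)
        push_cast
        field_simp
        ring
    have h2 := Ring.factorial_nsmul_multichoose_eq_ascPochhammer (1 / 2 : ℂ) m
    rw [Polynomial.ascPochhammer_smeval_eq_eval, h1, nsmul_eq_mul] at h2
    have h3 : (m.factorial : ℂ) ≠ 0 := by exact_mod_cast m.factorial_ne_zero
    rw [← mul_left_cancel₀ h3 h2, Ring.choose]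
    congr 1
    ring
  have h := (Complex.one_div_one_sub_cpow_hasFPowerSeriesOnBall_zero (1 / 2)).hasSum
    (y := z) (by simpa [enorm_eq_nnnorm, ← NNReal.coe_lt_one] using hz)
  simp only [zero_add, FormalMultilinearSeries.ofScalars_apply_eq, smul_eq_mul] at h
  rw [Complex.cpow_neg, ← one_div]
  simpa only [hc] using h

lemma hasSum_invSqrtCoeff_real {s : ℝ} (h0 : 0 ≤ s) (h1 : s < 1) :
    HasSum (fun m => invSqrtCoeff m * s ^ m) (1 / √(1 - s)) := by
  have h := hasSum_invSqrtCoeff (z := (s : ℂ)) (by simpa [abs_of_nonneg h0] using h1)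
  have h2 : ((1 : ℂ) - s) ^ (-(1 / 2) : ℂ) = ((1 / √(1 - s) : ℝ) : ℂ) := by
    have : ((1 : ℂ) - s) ^ (-(1 / 2) : ℂ) = (((1 - s) ^ (-(1 / 2) : ℝ) : ℝ) : ℂ) := by
      rw [Complex.ofReal_cpow (by linarith)]; push_cast; rfl
    rw [this, Real.rpow_neg (by linarith), Real.sqrt_eq_rpow, one_div]
    norm_num
  rw [h2] at h
  exact_mod_cast h

lemma tendsto_sqrt_mul_invSqrtCoeff :
    Tendsto (fun m : ℕ => √m * invSqrtCoeff m) atTop (𝓝 (1 / √Real.pi)) := by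
  have hpi := Real.sqrt_pos.2 Real.pi_pos
  have h1 : Tendsto (fun m : ℕ => √((m : ℝ) / (m + 1)) * (1 / √Real.pi)) atTop
      (𝓝 (1 / √Real.pi)) := by
    have := (tendsto_natCast_div_add_atTop (1 : ℝ)).sqrt.mul_const (1 / √Real.pi)
    simpa using this
  refine tendsto_of_tendsto_of_tendsto_of_le_of_le h1 tendsto_const_nhds (fun m => ?_) fun m => ?_
  · have h := one_le_sqrt_mul_invSqrtCoeff m
    rw [Real.sqrt_mul Real.pi_pos.le] at h
    have h3 : 0 < √((m : ℝ) + 1) := Real.sqrt_pos.2 (by positivity)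
    simp only [Real.sqrt_div (Nat.cast_nonneg m)]
    rw [div_mul_div_comm, mul_one, div_le_iff₀ (by positivity)]
    calc √(m : ℝ) = √m * 1 := (mul_one _).symm
      _ ≤ √m * (√Real.pi * √(m + 1) * invSqrtCoeff m) := by gcongr
      _ = _ := by ring
  · have h := sqrt_mul_invSqrtCoeff_le m
    rw [Real.sqrt_mul Real.pi_pos.le] at h
    rw [le_div_iff₀ hpi]
    linarith [h]

/-! ### A Tauberian theorem for monotone coefficients -/

/-- Convergence of a bounded family of functionals on the monomials implies convergence on
continuous functions. -/
lemma tendsto_tsum_of_tendsto_monomials {ω : ℝ → ℕ → ℝ} {θ K : ℝ}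
    (hsum : ∀ s ∈ Ioo (0 : ℝ) 1, Summable fun m => |ω s m|)
    (hK : ∀ᶠ s in 𝓝[<] (1 : ℝ), ∑' m, |ω s m| ≤ K)
    (hmon : ∀ k : ℕ, Tendsto (fun s => ∑' m, ω s m * (s ^ m) ^ k) (𝓝[<] 1)
      (𝓝 (θ * ∫ v in (0 : ℝ)..1, v ^ k)))
    {g : ℝ → ℝ} (hg : Continuous g) :
    Tendsto (fun s => ∑' m, ω s m * g (s ^ m)) (𝓝[<] 1) (𝓝 (θ * ∫ v in (0 : ℝ)..1, g v)) := by
  have hI : ∀ᶠ s in 𝓝[<] (1 : ℝ), s ∈ Ioo (0 : ℝ) 1 := Ioo_mem_nhdsLT one_pos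
  have hmem : ∀ s ∈ Ioo (0 : ℝ) 1, ∀ m : ℕ, s ^ m ∈ Icc (0 : ℝ) 1 := fun s hs m =>
    ⟨pow_nonneg hs.1.le _, pow_le_one₀ hs.1.le hs.2.le⟩
  have hsm : ∀ f : ℝ → ℝ, Continuous f → ∀ s ∈ Ioo (0 : ℝ) 1,
      Summable fun m => ω s m * f (s ^ m) := by
    intro f hf s hs
    obtain ⟨A, hA⟩ := isCompact_Icc.exists_bound_of_continuousOn (s := Icc (0 : ℝ) 1) hf.continuousOn
    refine Summable.of_norm_bounded ((hsum s hs).mul_right A) fun m => ?_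
    rw [norm_mul, Real.norm_eq_abs]
    exact mul_le_mul_of_nonneg_left (hA _ (hmem s hs m)) (abs_nonneg _)
  have hpoly : ∀ Q : Polynomial ℝ, Tendsto (fun s => ∑' m, ω s m * Q.eval (s ^ m)) (𝓝[<] 1)
      (𝓝 (θ * ∫ v in (0 : ℝ)..1, Q.eval v)) := by
    intro Q
    have e1 : (fun s => ∑ k ∈ Finset.range (Q.natDegree + 1),
        Q.coeff k * ∑' m, ω s m * (s ^ m) ^ k) =ᶠ[𝓝[<] 1]
        fun s => ∑' m, ω s m * Q.eval (s ^ m) := by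
      filter_upwards [hI] with s hs
      simp_rw [Polynomial.eval_eq_sum_range, Finset.mul_sum]
      rw [Summable.tsum_finsetSum]
      · refine Finset.sum_congr rfl fun k _ => ?_
        rw [← tsum_mul_left]
        exact tsum_congr fun m => by ring
      · intro k _
        exact (hsm (fun v => Q.coeff k * v ^ k) (by fun_prop) s hs)
    refine Tendsto.congr' e1 ?_
    simp_rw [Polynomial.eval_eq_sum_range]
    rw [intervalIntegral.integral_finsetSum
      fun k _ => (Continuous.intervalIntegrable (by fun_prop) _ _), Finset.mul_sum]
    refine tendsto_finsetSum _ fun k _ => ?_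
    rw [intervalIntegral.integral_const_mul]
    convert (hmon k).const_mul (Q.coeff k) using 2
    ring
  rw [Metric.tendsto_nhds]
  intro ε hε
  have hC : 0 < |K| + |θ| + 1 := by positivity
  -- A uniform error δ of the Weierstrass approximation costs at most δ|K| in the sum and δ|θ| in
  -- the integral.
  set δ := ε / 2 / (|K| + |θ| + 1) with hδ
  have hδ0 : 0 < δ := by positivity
  obtain ⟨Q, hQ⟩ := exists_polynomial_near_of_continuousOn 0 1 g hg.continuousOn δ hδ0
  have hint : |(∫ v in (0 : ℝ)..1, Q.eval v) - ∫ v in (0 : ℝ)..1, g v| ≤ δ := by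
    rw [← intervalIntegral.integral_sub (Q.continuous.intervalIntegrable _ _)
      (hg.intervalIntegrable _ _)]
    have := intervalIntegral.norm_integral_le_of_norm_le_const (a := (0 : ℝ)) (b := 1) (C := δ)
      (f := fun v => Q.eval v - g v) (fun v hv => by
        rw [uIoc_of_le zero_le_one] at hv
        exact (hQ v ⟨hv.1.le, hv.2⟩).le)
    simpa using this
  filter_upwards [hI, hK, Metric.tendsto_nhds.1 (hpoly Q) (ε / 2) (by positivity)] with s hs hKs hQs
  rw [Real.dist_eq] at hQs ⊢
  have h1 : |(∑' m, ω s m * g (s ^ m)) - ∑' m, ω s m * Q.eval (s ^ m)| ≤ δ * |K| := by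
    rw [← Summable.tsum_sub (hsm g hg s hs) (hsm _ Q.continuous s hs)]
    have hb : ∀ m, ‖ω s m * g (s ^ m) - ω s m * Q.eval (s ^ m)‖ ≤ |ω s m| * δ := by
      intro m
      rw [← mul_sub, norm_mul, Real.norm_eq_abs, Real.norm_eq_abs, abs_sub_comm]
      exact mul_le_mul_of_nonneg_left (hQ _ (hmem s hs m)).le (abs_nonneg _)
    have := tsum_of_norm_bounded ((hsum s hs).mul_right δ).hasSum hb
    rw [tsum_mul_right] at this
    rw [mul_comm δ]
    exact this.trans (mul_le_mul_of_nonneg_right (hKs.trans (le_abs_self K)) hδ0.le)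
  have h2 : |θ * (∫ v in (0 : ℝ)..1, Q.eval v) - θ * ∫ v in (0 : ℝ)..1, g v| ≤ δ * |θ| := by
    rw [← mul_sub, abs_mul, mul_comm]
    exact mul_le_mul_of_nonneg_right hint (abs_nonneg _)
  have h3 : δ * |K| + δ * |θ| < ε / 2 := by
    have : δ * (|K| + |θ| + 1) = ε / 2 := by rw [hδ]; field_simp
    nlinarith
  have := abs_sub_le (∑' m, ω s m * g (s ^ m)) (∑' m, ω s m * Q.eval (s ^ m))
    (θ * ∫ v in (0 : ℝ)..1, g v)
  have := abs_sub_le (∑' m, ω s m * Q.eval (s ^ m)) (θ * (∫ v in (0 : ℝ)..1, Q.eval v))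
    (θ * ∫ v in (0 : ℝ)..1, g v)
  linarith

end TwoStep

namespace TwoStep

lemma summable_mul_pow_of_antitone {p : ℕ → ℝ} (hp0 : ∀ m, 0 ≤ p m) (hp : Antitone p)
    {s : ℝ} (h0 : 0 ≤ s) (h1 : s < 1) : Summable fun m => p m * s ^ m := by
  refine Summable.of_nonneg_of_le (fun m => mul_nonneg (hp0 m) (pow_nonneg h0 m)) (fun m => ?_)
    ((summable_geometric_of_lt_one h0 h1).mul_left (p 0))
  exact mul_le_mul_of_nonneg_right (hp (Nat.zero_le m)) (pow_nonneg h0 m)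

/-- **Hardy–Littlewood–Karamata Tauberian theorem**, of exponent `1/2`, for monotone
coefficients. -/
theorem tendsto_sqrt_mul_of_tendsto_tsum {p : ℕ → ℝ} (hp0 : ∀ m, 0 ≤ p m) (hp : Antitone p) {c : ℝ}
    (h : Tendsto (fun s : ℝ => √(1 - s) * ∑' m, p m * s ^ m) (𝓝[<] 1) (𝓝 c)) :
    Tendsto (fun m : ℕ => √m * p m) atTop (𝓝 (c / √Real.pi)) := by
  have hI : ∀ᶠ s in 𝓝[<] (1 : ℝ), s ∈ Ioo (0 : ℝ) 1 := Ioo_mem_nhdsLT one_pos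
  have hc : 0 ≤ c := by
    refine ge_of_tendsto h ?_
    filter_upwards [hI] with s hs
    exact mul_nonneg (Real.sqrt_nonneg _)
      (tsum_nonneg fun m => mul_nonneg (hp0 m) (pow_nonneg hs.1.le m))
  have hq : ∀ s ∈ Ioo (0 : ℝ) 1, √(1 - s) * ∑' m, invSqrtCoeff m * s ^ m = 1 := by
    intro s hs
    rw [(hasSum_invSqrtCoeff_real hs.1.le hs.2).tsum_eq]
    exact mul_one_div_cancel (Real.sqrt_pos.2 (by linarith [hs.2])).ne'
  have hsp : ∀ s ∈ Ioo (0 : ℝ) 1, Summable fun m => p m * s ^ m := fun s hs =>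
    summable_mul_pow_of_antitone hp0 hp hs.1.le hs.2
  have hsq : ∀ s ∈ Ioo (0 : ℝ) 1, Summable fun m => invSqrtCoeff m * s ^ m := fun s hs =>
    (hasSum_invSqrtCoeff_real hs.1.le hs.2).summable
  -- Subtracting the exact coefficients of c(1-z)^(-1/2) makes the limiting functional zero, so no
  -- Gamma integral has to be evaluated.
  set e : ℕ → ℝ := fun m => p m - c * invSqrtCoeff m with he
  have hse : ∀ s ∈ Ioo (0 : ℝ) 1, Summable fun m => e m * s ^ m := fun s hs => by
    simpa only [he, sub_mul, mul_assoc] using (hsp s hs).sub ((hsq s hs).mul_left c)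
  have hs1 : ∀ s ∈ Ioo (0 : ℝ) 1, √(1 - s) * ∑' m, e m * s ^ m =
      √(1 - s) * (∑' m, p m * s ^ m) - c := by
    intro s hs
    have : ∑' m, e m * s ^ m = ∑' m, p m * s ^ m - c * ∑' m, invSqrtCoeff m * s ^ m := by
      rw [← tsum_mul_left, ← (hsp s hs).tsum_sub ((hsq s hs).mul_left c)]
      exact tsum_congr fun m => by simp only [he]; ring
    rw [this, mul_sub, mul_left_comm, hq s hs, mul_one]
  have habs : ∀ s ∈ Ioo (0 : ℝ) 1, ∀ m, |√(1 - s) * (e m * s ^ m)| ≤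
      √(1 - s) * (p m * s ^ m) + c * (√(1 - s) * (invSqrtCoeff m * s ^ m)) := by
    intro s hs m
    have h1 : |e m| ≤ p m + c * invSqrtCoeff m := by
      have := mul_nonneg hc (invSqrtCoeff_pos m).le
      rw [abs_le]; constructor <;> simp only [he] <;> linarith [hp0 m]
    rw [abs_mul, abs_mul, abs_of_nonneg (Real.sqrt_nonneg _), abs_of_nonneg (pow_nonneg hs.1.le m)]
    calc √(1 - s) * (|e m| * s ^ m) ≤ √(1 - s) * ((p m + c * invSqrtCoeff m) * s ^ m) := by
          have := pow_nonneg hs.1.le m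
          gcongr
      _ = _ := by ring
  have hsabs : ∀ s ∈ Ioo (0 : ℝ) 1, Summable fun m =>
      √(1 - s) * (p m * s ^ m) + c * (√(1 - s) * (invSqrtCoeff m * s ^ m)) := fun s hs =>
    ((hsp s hs).mul_left _).add (((hsq s hs).mul_left _).mul_left c)
  have hE : ∀ {g : ℝ → ℝ}, Continuous g →
      Tendsto (fun s => ∑' m, √(1 - s) * (e m * s ^ m) * g (s ^ m)) (𝓝[<] 1) (𝓝 0) := by
    intro g hg
    have := tendsto_tsum_of_tendsto_monomials (ω := fun s m => √(1 - s) * (e m * s ^ m))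
      (θ := 0) (K := 2 * c + 1)
      (fun s hs => Summable.of_nonneg_of_le (fun _ => abs_nonneg _) (habs s hs) (hsabs s hs)) ?_ ?_ hg
    · simpa using this
    · filter_upwards [hI, h.eventually (gt_mem_nhds (lt_add_one c))] with s hs hs'
      have h1 := Summable.tsum_le_tsum (habs s hs)
        (Summable.of_nonneg_of_le (fun _ => abs_nonneg _) (habs s hs) (hsabs s hs)) (hsabs s hs)
      rw [((hsp s hs).mul_left _).tsum_add (((hsq s hs).mul_left _).mul_left c), tsum_mul_left,
        tsum_mul_left, tsum_mul_left, hq s hs] at h1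
      linarith
    · intro k
      rw [zero_mul]
      -- Since s^m (s^m)^k = (s^(k+1))^m, the k-th moment at s is the hypothesis at s^(k+1); the
      -- prefactor √(1-s) is at most √(1-s^(k+1)).
      have hpow : Tendsto (fun s : ℝ => s ^ (k + 1)) (𝓝[<] 1) (𝓝[<] 1) := by
        refine tendsto_nhdsWithin_iff.2 ⟨?_, ?_⟩
        · have : Tendsto (fun s : ℝ => s ^ (k + 1)) (𝓝 1) (𝓝 (1 ^ (k + 1))) :=
            (continuous_pow _).tendsto 1
          rw [one_pow] at this
          exact this.mono_left nhdsWithin_le_nhds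
        · filter_upwards [hI] with s hs
          exact pow_lt_one₀ hs.1.le hs.2 (Nat.succ_ne_zero k)
      have hδ : Tendsto (fun s : ℝ => |√(1 - s ^ (k + 1)) * (∑' m, p m * (s ^ (k + 1)) ^ m) - c|)
          (𝓝[<] 1) (𝓝 0) := by
        have := ((h.comp hpow).sub_const c).abs
        simpa using this
      refine squeeze_zero_norm' ?_ hδ
      filter_upwards [hI] with s hs
      have hs' : s ^ (k + 1) ∈ Ioo (0 : ℝ) 1 :=
        ⟨pow_pos hs.1 _, pow_lt_one₀ hs.1.le hs.2 (Nat.succ_ne_zero k)⟩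
      rw [← hs1 _ hs', Real.norm_eq_abs]
      have h2 : ∀ m, √(1 - s) * (e m * s ^ m) * (s ^ m) ^ k =
          √(1 - s) * (e m * (s ^ (k + 1)) ^ m) := fun m => by ring
      simp_rw [h2]
      rw [tsum_mul_left, abs_mul, abs_mul, abs_of_nonneg (Real.sqrt_nonneg _),
        abs_of_nonneg (Real.sqrt_nonneg _)]
      refine mul_le_mul_of_nonneg_right (Real.sqrt_le_sqrt ?_) (abs_nonneg _)
      have : s ^ (k + 1) ≤ s := pow_le_of_le_one hs.1.le hs.2.le (Nat.succ_ne_zero k)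
      linarith
  have hM : ∀ {g : ℝ → ℝ}, Continuous g →
      Tendsto (fun s => ∑' m, (1 - s) * s ^ m * g (s ^ m)) (𝓝[<] 1) (𝓝 (∫ v in (0 : ℝ)..1, g v)) := by
    intro g hg
    have hgeo : ∀ s ∈ Ioo (0 : ℝ) 1, HasSum (fun m => (1 - s) * s ^ m) 1 := fun s hs => by
      have := (hasSum_geometric_of_lt_one hs.1.le hs.2).mul_left (1 - s)
      rwa [mul_inv_cancel₀ (by linarith [hs.2])] at this
    have hab : ∀ s ∈ Ioo (0 : ℝ) 1, ∀ m : ℕ, |(1 - s) * s ^ m| = (1 - s) * s ^ m := fun s hs m =>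
      abs_of_nonneg (mul_nonneg (by linarith [hs.2]) (pow_nonneg hs.1.le m))
    have := tendsto_tsum_of_tendsto_monomials (ω := fun s m => (1 - s) * s ^ m)
      (θ := 1) (K := 1) (fun s hs => by simpa only [hab s hs] using (hgeo s hs).summable) ?_ ?_ hg
    · simpa using this
    · filter_upwards [hI] with s hs
      simp only [hab s hs, (hgeo s hs).tsum_eq, le_refl]
    · intro k
      simp only [integral_pow, one_mul, one_pow]
      have h1 : Tendsto (fun s : ℝ => (∑ i ∈ Finset.range (k + 1), s ^ i)⁻¹) (𝓝[<] 1)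
          (𝓝 (∑ i ∈ Finset.range (k + 1), (1 : ℝ) ^ i)⁻¹) := by
        refine Tendsto.mono_left (Tendsto.inv₀ ?_ (by simp; positivity)) nhdsWithin_le_nhds
        exact (continuous_finsetSum _ fun i _ => continuous_pow i).tendsto _
      have h2 : (∑ i ∈ Finset.range (k + 1), (1 : ℝ) ^ i)⁻¹ = (1 - 0 ^ (k + 1)) / ((k : ℝ) + 1) := by
        simp
      rw [h2] at h1
      refine h1.congr' ?_
      filter_upwards [hI] with s hs
      have hs' : s ^ (k + 1) < 1 := pow_lt_one₀ hs.1.le hs.2 (Nat.succ_ne_zero k)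
      have h3 : ∀ m : ℕ, (1 - s) * s ^ m * (s ^ m) ^ k = (1 - s) * (s ^ (k + 1)) ^ m :=
        fun m => by ring
      simp_rw [h3]
      rw [tsum_mul_left, tsum_geometric_of_lt_one (pow_nonneg hs.1.le _) hs']
      have h4 := geom_sum_mul s (k + 1)
      have h5 : 1 - s ≠ 0 := by linarith [hs.2]
      have h6 : 1 - s ^ (k + 1) = (∑ i ∈ Finset.range (k + 1), s ^ i) * (1 - s) := by linarith
      rw [h6, mul_inv]
      field_simp
  -- bump functions localise the sums
  have key : ∀ a b d : ℝ, 0 < a → a < b → 0 < d → ∃ g : ℝ → ℝ, Continuous g ∧ (∀ v, 0 ≤ g v) ∧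
      (∀ v, g v ≠ 0 → Real.exp (-b) < v ∧ v < Real.exp (-a)) ∧
      Tendsto (fun N : ℕ => √N * ((∑' m, e m * Real.exp (-(d / N)) ^ m * g (Real.exp (-(d / N)) ^ m)) /
        ∑' m, Real.exp (-(d / N)) ^ m * g (Real.exp (-(d / N)) ^ m))) atTop (𝓝 0) ∧
      ∀ᶠ N : ℕ in atTop, 0 < ∑' m, Real.exp (-(d / N)) ^ m * g (Real.exp (-(d / N)) ^ m) := by
    intro a b d ha hab hd
    -- Evaluated at v = s^m with s = exp(-d/N), this bump retains exactly the m with aN < md < bN.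
    set g : ℝ → ℝ := fun v => max 0 ((v - Real.exp (-b)) * (Real.exp (-a) - v)) with hgdef
    have hg : Continuous g := by fun_prop
    have hg0 : ∀ v, 0 ≤ g v := fun v => le_max_left _ _
    have hlt : Real.exp (-b) < Real.exp (-a) := Real.exp_lt_exp.2 (by linarith)
    have hint : 0 < ∫ v in (0 : ℝ)..1, g v := by
      refine intervalIntegral.integral_pos one_pos hg.continuousOn (fun v _ => hg0 v)
        ⟨(Real.exp (-b) + Real.exp (-a)) / 2, ⟨by positivity, ?_⟩, ?_⟩
      · have : Real.exp (-a) ≤ 1 := Real.exp_le_one_iff.2 (by linarith)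
        linarith
      · refine lt_max_of_lt_right (mul_pos ?_ ?_) <;> linarith
    have hsN : Tendsto (fun N : ℕ => Real.exp (-(d / N))) atTop (𝓝[<] 1) := by
      refine tendsto_nhdsWithin_iff.2 ⟨?_, ?_⟩
      · have : Tendsto (fun N : ℕ => Real.exp (-(d / N))) atTop (𝓝 (Real.exp (-0))) :=
          (Real.continuous_exp.tendsto _).comp (tendsto_const_div_atTop_nhds_zero_nat d).neg
        simpa using this
      · filter_upwards [eventually_gt_atTop 0] with N hN
        have hN' : (0 : ℝ) < N := by exact_mod_cast hN
        exact Real.exp_lt_one_iff.2 (by have := div_pos hd hN'; linarith)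
    refine ⟨g, hg, hg0, fun v hv => ?_, ?_, ?_⟩
    · by_contra hcon
      refine hv (max_eq_left ?_)
      by_cases h1 : Real.exp (-b) < v
      · have h2 : Real.exp (-a) ≤ v := not_lt.1 fun h2 => hcon ⟨h1, h2⟩
        exact mul_nonpos_of_nonneg_of_nonpos (by linarith) (by linarith)
      · exact mul_nonpos_of_nonpos_of_nonneg (by linarith) (by linarith)
    · have h1 := ((hE hg).comp hsN).div ((hM hg).comp hsN) hint.ne'
      rw [zero_div] at h1
      have h2 : Tendsto (fun N : ℕ => √d * |(∑' m, √(1 - Real.exp (-(d / N))) *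
          (e m * Real.exp (-(d / N)) ^ m) * g (Real.exp (-(d / N)) ^ m)) /
          ∑' m, (1 - Real.exp (-(d / N))) * Real.exp (-(d / N)) ^ m *
            g (Real.exp (-(d / N)) ^ m)|) atTop (𝓝 0) := by
        have := h1.abs.const_mul (√d)
        simpa using this
      refine squeeze_zero_norm' ?_ h2
      filter_upwards [eventually_gt_atTop 0] with N hN
      have hN' : (0 : ℝ) < N := by exact_mod_cast hN
      set s := Real.exp (-(d / N)) with hs
      have hs1 : s < 1 := Real.exp_lt_one_iff.2 (by have := div_pos hd hN'; linarith)
      have hsd : 1 - s ≤ d / N := by have := Real.add_one_le_exp (-(d / N)); linarith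
      have h3 : 0 < √(1 - s) := Real.sqrt_pos.2 (by linarith)
      simp_rw [mul_assoc]
      rw [tsum_mul_left, tsum_mul_left, norm_mul, Real.norm_eq_abs, Real.norm_eq_abs,
        abs_of_nonneg (Real.sqrt_nonneg _), abs_div, abs_div, abs_mul, abs_mul,
        abs_of_pos h3, abs_of_pos (by linarith : 0 < 1 - s), ← mul_div_mul_comm _ _ _ _ |>.symm,
        ← mul_assoc]
      refine mul_le_mul_of_nonneg_right ?_ (by positivity)
      have h4 : √N * √(1 - s) ≤ √d := by
        rw [← Real.sqrt_mul hN'.le]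
        refine Real.sqrt_le_sqrt ?_
        calc (N : ℝ) * (1 - s) ≤ N * (d / N) := by gcongr
          _ = d := by field_simp
      have h5 : √(1 - s) * √(1 - s) = 1 - s := Real.mul_self_sqrt (by linarith)
      rw [mul_div_assoc', le_div_iff₀ (by linarith)]
      nth_rewrite 1 [← h5]
      rw [← mul_assoc]
      exact mul_le_mul_of_nonneg_right h4 h3.le
    · have h1 := ((hM hg).comp hsN).eventually (lt_mem_nhds hint)
      filter_upwards [h1, eventually_gt_atTop 0] with N hN hN0
      have hN' : (0 : ℝ) < N := by exact_mod_cast hN0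
      simp only [Function.comp, mul_assoc] at hN
      rw [tsum_mul_left] at hN
      refine pos_of_mul_pos_right hN ?_
      have : Real.exp (-(d / N)) < 1 := Real.exp_lt_one_iff.2 (by have := div_pos hd hN'; linarith)
      linarith
  have hsumg : ∀ {g : ℝ → ℝ} {w : ℕ → ℝ}, Continuous g → ∀ s ∈ Ioo (0 : ℝ) 1,
      Summable (fun m => w m * s ^ m) → Summable fun m => w m * s ^ m * g (s ^ m) := by
    intro g w hg s hs hw
    obtain ⟨A, hA⟩ := isCompact_Icc.exists_bound_of_continuousOn (s := Icc (0 : ℝ) 1) hg.continuousOn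
    refine Summable.of_norm_bounded (hw.norm.mul_right A) fun m => ?_
    rw [norm_mul]
    exact mul_le_mul_of_nonneg_left
      (hA _ ⟨pow_nonneg hs.1.le _, pow_le_one₀ hs.1.le hs.2.le⟩) (norm_nonneg _)
  have hexp : ∀ {d : ℝ} {N : ℕ}, 0 < d → 0 < N → Real.exp (-(d / N)) ∈ Ioo (0 : ℝ) 1 := by
    intro d N hd hN
    have hN' : (0 : ℝ) < N := by exact_mod_cast hN
    exact ⟨Real.exp_pos _, Real.exp_lt_one_iff.2 (by have := div_pos hd hN'; linarith)⟩
  have hsupp : ∀ {a b d : ℝ} {N m : ℕ}, 0 < N → Real.exp (-b) < Real.exp (-(d / N)) ^ m ∧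
      Real.exp (-(d / N)) ^ m < Real.exp (-a) → a * N < m * d ∧ m * d < b * N := by
    intro a b d N m hN hv
    have hN' : (0 : ℝ) < N := by exact_mod_cast hN
    rw [← Real.exp_nat_mul, Real.exp_lt_exp, Real.exp_lt_exp] at hv
    have h1 : (m : ℝ) * -(d / N) = -(m * d / N) := by ring
    rw [h1, neg_lt_neg_iff, neg_lt_neg_iff, div_lt_iff₀ hN', lt_div_iff₀ hN'] at hv
    exact ⟨hv.2, hv.1⟩
  -- With d = r the window is N/r < m < N. There p N ≤ p m by monotonicity, and the comparison
  -- coefficients are at most U; averaging over the window removes the oscillation of e.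
  have upper : ∀ r : ℝ, 1 < r → ∀ ε > 0, ∀ᶠ N : ℕ in atTop,
      √N * p N ≤ ε + c * (√r / √Real.pi) := by
    intro r hr ε hε
    have hr0 : 0 < r := by linarith
    obtain ⟨g, hg, hg0, hgs, hlim, hpos⟩ := key 1 r r one_pos hr hr0
    filter_upwards [hlim.eventually (gt_mem_nhds hε), hpos, eventually_gt_atTop 0] with N h1 h2 hN
    have hN' : (0 : ℝ) < N := by exact_mod_cast hN
    have hs := hexp hr0 hN
    set s := Real.exp (-(r / N)) with hsdef
    set U := √r / (√Real.pi * √N) with hU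
    have h3 : p N * ∑' m, s ^ m * g (s ^ m) ≤
        (∑' m, e m * s ^ m * g (s ^ m)) + c * U * ∑' m, s ^ m * g (s ^ m) := by
      have hone : Summable fun m => s ^ m * g (s ^ m) := by
        simpa using hsumg (w := fun _ => 1) hg s hs
          (by simpa using summable_geometric_of_lt_one hs.1.le hs.2)
      rw [← tsum_mul_left, ← tsum_mul_left, ← (hsumg hg s hs (hse s hs)).tsum_add (hone.mul_left _)]
      refine Summable.tsum_le_tsum (fun m => ?_) (hone.mul_left _)
        ((hsumg hg s hs (hse s hs)).add (hone.mul_left _))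
      by_cases hz : g (s ^ m) = 0
      · simp [hz]
      have ⟨ha, hb⟩ := hsupp hN (hgs _ hz)
      have hmN : m < N := by
        have : (m : ℝ) < N := by nlinarith
        exact_mod_cast this
      have hm0 : (0 : ℝ) < m := by
        by_contra hcon
        nlinarith
      have hqm : invSqrtCoeff m ≤ U := by
        have hb1 := sqrt_mul_invSqrtCoeff_le m
        have hb2 : √Real.pi * √N ≤ √r * √(Real.pi * m) := by
          rw [← Real.sqrt_mul Real.pi_pos.le, ← Real.sqrt_mul hr0.le]
          refine Real.sqrt_le_sqrt ?_
          have := Real.pi_pos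
          nlinarith
        have hpi := Real.sqrt_pos.2 Real.pi_pos
        have hNs := Real.sqrt_pos.2 hN'
        rw [hU, le_div_iff₀ (by positivity)]
        calc invSqrtCoeff m * (√Real.pi * √N) ≤ invSqrtCoeff m * (√r * √(Real.pi * m)) := by
              have := (invSqrtCoeff_pos m).le
              gcongr
          _ = √r * (√(Real.pi * m) * invSqrtCoeff m) := by ring
          _ ≤ √r * 1 := by gcongr
          _ = √r := mul_one _
      have h4 : p N ≤ e m + c * U := by
        have := hp hmN.le
        have := mul_le_mul_of_nonneg_left hqm hc
        simp only [he]
        linarith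
      have h5 : 0 ≤ s ^ m * g (s ^ m) := mul_nonneg (pow_nonneg hs.1.le m) (hg0 _)
      nlinarith [mul_le_mul_of_nonneg_right h4 h5]
    have hNs := Real.sqrt_pos.2 hN'
    have h6 : p N ≤ (∑' m, e m * s ^ m * g (s ^ m)) / (∑' m, s ^ m * g (s ^ m)) + c * U := by
      rw [div_add' _ _ _ h2.ne', le_div_iff₀ h2]; exact h3
    calc √N * p N ≤ √N * ((∑' m, e m * s ^ m * g (s ^ m)) / (∑' m, s ^ m * g (s ^ m)) + c * U) := by
          gcongr
      _ = √N * ((∑' m, e m * s ^ m * g (s ^ m)) / (∑' m, s ^ m * g (s ^ m))) +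
          c * (√r / √Real.pi) := by
          rw [hU]; field_simp
      _ ≤ _ := by linarith
  -- The mirror argument with d = 1: the window is N < m < rN, where p m ≤ p N. Letting r → 1 closes
  -- the gap between the two bounds.
  have lower : ∀ r : ℝ, 1 < r → ∀ ε > 0, ∀ᶠ N : ℕ in atTop,
      -ε + c * (√N / √(Real.pi * (r * N + 1))) ≤ √N * p N := by
    intro r hr ε hε
    have hr0 : 0 < r := by linarith
    obtain ⟨g, hg, hg0, hgs, hlim, hpos⟩ := key 1 r 1 one_pos hr one_pos
    filter_upwards [hlim.eventually (lt_mem_nhds (neg_lt_zero.2 hε)), hpos, eventually_gt_atTop 0]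
      with N h1 h2 hN
    have hN' : (0 : ℝ) < N := by exact_mod_cast hN
    have hs := hexp one_pos hN
    set s := Real.exp (-(1 / N)) with hsdef
    have hpi := Real.pi_pos
    set U := 1 / √(Real.pi * (r * N + 1)) with hU
    have h3 : (∑' m, e m * s ^ m * g (s ^ m)) + c * U * ∑' m, s ^ m * g (s ^ m) ≤
        p N * ∑' m, s ^ m * g (s ^ m) := by
      have hone : Summable fun m => s ^ m * g (s ^ m) := by
        simpa using hsumg (w := fun _ => 1) hg s hs
          (by simpa using summable_geometric_of_lt_one hs.1.le hs.2)
      rw [← tsum_mul_left, ← tsum_mul_left, ← (hsumg hg s hs (hse s hs)).tsum_add (hone.mul_left _)]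
      refine Summable.tsum_le_tsum (fun m => ?_)
        ((hsumg hg s hs (hse s hs)).add (hone.mul_left _)) (hone.mul_left _)
      by_cases hz : g (s ^ m) = 0
      · simp [hz]
      have ⟨ha, hb⟩ := hsupp hN (hgs _ hz)
      have hmN : N < m := by
        have : (N : ℝ) < m := by linarith
        exact_mod_cast this
      have hqm : U ≤ invSqrtCoeff m := by
        have hb1 := one_le_sqrt_mul_invSqrtCoeff m
        have hb2 : √(Real.pi * (m + 1)) ≤ √(Real.pi * (r * N + 1)) := by
          refine Real.sqrt_le_sqrt ?_
          have : (m : ℝ) ≤ r * N := by linarith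
          gcongr
        rw [hU, div_le_iff₀ (Real.sqrt_pos.2 (by positivity)), mul_comm]
        exact hb1.trans (mul_le_mul_of_nonneg_right hb2 (invSqrtCoeff_pos m).le)
      have h4 : e m + c * U ≤ p N := by
        have := hp hmN.le
        have := mul_le_mul_of_nonneg_left hqm hc
        simp only [he]
        linarith
      have h5 : 0 ≤ s ^ m * g (s ^ m) := mul_nonneg (pow_nonneg hs.1.le m) (hg0 _)
      nlinarith [mul_le_mul_of_nonneg_right h4 h5]
    have h6 : (∑' m, e m * s ^ m * g (s ^ m)) / (∑' m, s ^ m * g (s ^ m)) + c * U ≤ p N := by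
      rw [div_add' _ _ _ h2.ne', div_le_iff₀ h2]; exact h3
    calc _ ≤ √N * ((∑' m, e m * s ^ m * g (s ^ m)) / (∑' m, s ^ m * g (s ^ m))) +
          c * (√N / √(Real.pi * (r * N + 1))) := by linarith
      _ = √N * ((∑' m, e m * s ^ m * g (s ^ m)) / (∑' m, s ^ m * g (s ^ m)) + c * U) := by
          rw [hU]; ring
      _ ≤ _ := by gcongr
  have hpi := Real.sqrt_pos.2 Real.pi_pos
  rw [tendsto_order]
  constructor
  · intro l hl
    have hcont : Tendsto (fun r : ℝ => c / √(Real.pi * r)) (𝓝[>] 1) (𝓝 (c / √(Real.pi * 1))) := by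
      refine Tendsto.mono_left ?_ nhdsWithin_le_nhds
      refine Tendsto.div tendsto_const_nhds ?_ (by rw [mul_one]; exact hpi.ne')
      exact Continuous.tendsto (by fun_prop) 1
    rw [mul_one] at hcont
    obtain ⟨r, hr, hr1⟩ := ((hcont.eventually (lt_mem_nhds hl)).and self_mem_nhdsWithin).exists
    have hr0 : (0 : ℝ) < r := lt_trans one_pos hr1
    have h1 : Tendsto (fun N : ℕ => c * (√N / √(Real.pi * (r * N + 1)))) atTop
        (𝓝 (c / √(Real.pi * r))) := by
      have h2 : Tendsto (fun N : ℕ => (1 : ℝ) / (Real.pi * (r + 1 / N))) atTop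
          (𝓝 (1 / (Real.pi * (r + 0)))) :=
        tendsto_const_nhds.div (((tendsto_const_nhds.add
          (tendsto_const_div_atTop_nhds_zero_nat 1))).const_mul _)
          (by have := Real.pi_pos; positivity)
      have h3 := (h2.sqrt).const_mul c
      rw [add_zero, Real.sqrt_div zero_le_one, Real.sqrt_one, mul_one_div] at h3
      refine h3.congr' ?_
      filter_upwards [eventually_gt_atTop 0] with N hN
      have hN' : (0 : ℝ) < N := by exact_mod_cast hN
      rw [← Real.sqrt_div hN'.le]
      congr 2
      field_simp
    have h4 := h1.eventually (lt_mem_nhds hr)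
    obtain ⟨l', hl', hl'2⟩ := exists_between hr
    filter_upwards [lower r hr1 (l' - l) (by linarith), h1.eventually (lt_mem_nhds hl'2)] with N h5 h6
    linarith
  · intro u hu
    have hcont : Tendsto (fun r : ℝ => c * (√r / √Real.pi)) (𝓝[>] 1)
        (𝓝 (c * (√1 / √Real.pi))) := by
      refine Tendsto.mono_left ?_ nhdsWithin_le_nhds
      exact Continuous.tendsto (by fun_prop) 1
    rw [Real.sqrt_one, mul_one_div] at hcont
    obtain ⟨r, hr, hr1⟩ := ((hcont.eventually (gt_mem_nhds hu)).and self_mem_nhdsWithin).exists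
    filter_upwards [upper r hr1 ((u - c * (√r / √Real.pi)) / 2) (by linarith)] with N h5
    linarith

end TwoStep

namespace TwoStep

/-! ### The Abelian direction, in the complex disc -/

lemma summable_cast_mul_pow_of_antitone {p : ℕ → ℝ} (hp0 : ∀ m, 0 ≤ p m) (hp : Antitone p)
    {z : ℂ} (hz : ‖z‖ < 1) : Summable fun m => (p m : ℂ) * z ^ m := by
  refine Summable.of_norm ?_
  simpa [abs_of_nonneg (hp0 _)] using summable_mul_pow_of_antitone hp0 hp (norm_nonneg z) hz

/-- Summation by parts: the product is p 0 minus a power series in the differences p m - p (m+1),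
which are nonnegative with sum at most p 0. The bound is uniform in the disc, which is why no Stolz
angle is needed later. -/
lemma norm_one_sub_mul_tsum_le {p : ℕ → ℝ} (hp0 : ∀ m, 0 ≤ p m) (hp : Antitone p)
    {z : ℂ} (hz : ‖z‖ < 1) : ‖(1 - z) * ∑' m, (p m : ℂ) * z ^ m‖ ≤ 2 * p 0 := by
  have hs := summable_cast_mul_pow_of_antitone hp0 hp hz
  have hs' := summable_cast_mul_pow_of_antitone (fun m => hp0 (m + 1))
    (fun m n h => hp (Nat.succ_le_succ h)) hz
  have hd0 : ∀ m, 0 ≤ p m - p (m + 1) := fun m => sub_nonneg.2 (hp (Nat.le_succ m))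
  have hpart : ∀ N, ∑ m ∈ Finset.range N, (p m - p (m + 1)) ≤ p 0 := fun N => by
    rw [Finset.sum_range_sub']; linarith [hp0 N]
  have hdsum : Summable fun m => p m - p (m + 1) := summable_of_sum_range_le hd0 hpart
  have h1 : (1 - z) * ∑' m, (p m : ℂ) * z ^ m =
      p 0 - ∑' m, ((p m - p (m + 1) : ℝ) : ℂ) * z ^ (m + 1) := by
    have h2 : ∑' m, ((p m - p (m + 1) : ℝ) : ℂ) * z ^ (m + 1) =
        z * ∑' m, (p m : ℂ) * z ^ m - ∑' m, (p (m + 1) : ℂ) * z ^ (m + 1) := by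
      rw [← tsum_mul_left, ← Summable.tsum_sub (hs.mul_left z) ((summable_nat_add_iff 1).2 hs)]
      exact tsum_congr fun m => by push_cast; ring
    have h3 := hs.tsum_eq_zero_add
    simp only [pow_zero, mul_one] at h3
    rw [h2, sub_mul, one_mul]
    nth_rewrite 1 [h3]
    ring
  have h4 : ‖∑' m, ((p m - p (m + 1) : ℝ) : ℂ) * z ^ (m + 1)‖ ≤ p 0 := by
    refine (tsum_of_norm_bounded hdsum.hasSum fun m => ?_).trans (hdsum.tsum_le_of_sum_range_le hpart)
    rw [norm_mul, Complex.norm_real, Real.norm_eq_abs, abs_of_nonneg (hd0 m), norm_pow]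
    exact mul_le_of_le_one_right (hd0 m) (pow_le_one₀ (norm_nonneg _) hz.le)
  rw [h1]
  refine (norm_sub_le _ _).trans ?_
  rw [Complex.norm_real, Real.norm_eq_abs, abs_of_nonneg (hp0 0)]
  linarith

lemma sum_one_div_sqrt_le (M : ℕ) : ∑ m ∈ Finset.range M, 1 / √(m + 1 : ℝ) ≤ 2 * √M := by
  induction M with
  | zero => simp
  | succ k ih =>
    rw [Finset.sum_range_succ]
    have h1 : 0 < √((k : ℝ) + 1) := Real.sqrt_pos.2 (by positivity)
    have h2 : √(k : ℝ) ≤ √((k : ℝ) + 1) := Real.sqrt_le_sqrt (by linarith)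
    have h3 := Real.sq_sqrt (by positivity : (0 : ℝ) ≤ (k : ℝ) + 1)
    have h4 := Real.sq_sqrt (by positivity : (0 : ℝ) ≤ (k : ℝ))
    have h5 : 1 / √((k : ℝ) + 1) ≤ 2 * (√((k : ℝ) + 1) - √k) := by
      rw [div_le_iff₀ h1]
      nlinarith [sq_nonneg (√((k : ℝ) + 1) - √k)]
    push_cast
    linarith

/-- Little-o passes to partial sums when compared with a divergent positive series, here Σ 1/√(m+1),
whose partial sums are at most 2√M. -/
lemma tendsto_sum_range_div_sqrt {e : ℕ → ℝ} (he0 : ∀ m, 0 ≤ e m)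
    (he : Tendsto (fun m : ℕ => √m * e m) atTop (𝓝 0)) :
    Tendsto (fun M : ℕ => (∑ m ∈ Finset.range M, e m) / √M) atTop (𝓝 0) := by
  have hpos : ∀ m : ℕ, (0 : ℝ) < 1 / √(m + 1 : ℝ) := fun m =>
    one_div_pos.2 (Real.sqrt_pos.2 (by positivity))
  have h1 : e =o[atTop] fun m : ℕ => 1 / √(m + 1 : ℝ) := by
    rw [isLittleO_iff_tendsto (fun m hm => absurd hm (hpos m).ne')]
    have h2 : Tendsto (fun m : ℕ => √2 * (√m * e m)) atTop (𝓝 0) := by simpa using he.const_mul √2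
    refine squeeze_zero' (Eventually.of_forall fun m => div_nonneg (he0 m) (hpos m).le) ?_ h2
    filter_upwards [eventually_ge_atTop 1] with m hm
    have hm' : (1 : ℝ) ≤ m := by exact_mod_cast hm
    rw [div_div_eq_mul_div, div_one, ← mul_assoc, ← Real.sqrt_mul (by norm_num), mul_comm]
    exact mul_le_mul_of_nonneg_right (Real.sqrt_le_sqrt (by linarith)) (he0 m)
  have hdiv : Tendsto (fun n => ∑ i ∈ Finset.range n, 1 / √(i + 1 : ℝ)) atTop atTop := by
    have h3 : Tendsto (fun n : ℕ => √(n : ℝ)) atTop atTop :=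
      Real.tendsto_sqrt_atTop.comp tendsto_natCast_atTop_atTop
    refine tendsto_atTop_mono (fun n => ?_) h3
    rcases Nat.eq_zero_or_pos n with rfl | hn
    · simp
    have hn' : (0 : ℝ) < n := by exact_mod_cast hn
    have : ∑ i ∈ Finset.range n, 1 / √(n : ℝ) ≤ ∑ i ∈ Finset.range n, 1 / √(i + 1 : ℝ) := by
      refine Finset.sum_le_sum fun i hi => ?_
      have : (i + 1 : ℝ) ≤ n := by exact_mod_cast Finset.mem_range.1 hi
      exact one_div_le_one_div_of_le (Real.sqrt_pos.2 (by positivity)) (Real.sqrt_le_sqrt this)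
    refine le_trans (le_of_eq ?_) this
    rw [Finset.sum_const, Finset.card_range, nsmul_eq_mul, mul_one_div, eq_div_iff
      (Real.sqrt_pos.2 hn').ne', Real.mul_self_sqrt hn'.le]
  have h2 := h1.sum_range (fun m => (hpos m).le) hdiv
  have h3 : (fun n : ℕ => ∑ i ∈ Finset.range n, 1 / √(i + 1 : ℝ)) =O[atTop] fun n : ℕ => √(n : ℝ) := by
    refine IsBigO.of_bound 2 (Eventually.of_forall fun n => ?_)
    rw [Real.norm_eq_abs, Real.norm_eq_abs, abs_of_nonneg (Real.sqrt_nonneg _),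
      abs_of_nonneg (Finset.sum_nonneg fun i _ => (hpos i).le)]
    exact sum_one_div_sqrt_le n
  exact (h2.trans_isBigO h3).tendsto_div_nhds_zero

/-- Monotone coefficients asymptotic to `c` times those of `(1 - z) ^ (-1/2)` have a generating
function asymptotic to `c (1 - z) ^ (-1/2)`, unrestrictedly in the unit disc. -/
theorem tendsto_sqrt_norm_mul_tsum_sub {p : ℕ → ℝ} (hp0 : ∀ m, 0 ≤ p m) (hp : Antitone p) {c : ℝ}
    (hc : 0 ≤ c) (h : Tendsto (fun m : ℕ => √m * p m) atTop (𝓝 (c / √Real.pi))) :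
    Tendsto (fun z : ℂ => √‖1 - z‖ *
      ‖∑' m, (p m : ℂ) * z ^ m - c * ∑' m, (invSqrtCoeff m : ℂ) * z ^ m‖)
      (𝓝[Metric.ball 0 1] 1) (𝓝 0) := by
  set e : ℕ → ℝ := fun m => |p m - c * invSqrtCoeff m| with he
  have he0 : ∀ m, 0 ≤ e m := fun m => abs_nonneg _
  have hetend : Tendsto (fun m : ℕ => √m * e m) atTop (𝓝 0) := by
    have h1 := (h.sub (tendsto_sqrt_mul_invSqrtCoeff.const_mul c)).abs
    rw [mul_one_div, sub_self, abs_zero] at h1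
    refine h1.congr fun m => ?_
    rw [he]
    simp only
    rw [← abs_of_nonneg (Real.sqrt_nonneg (m : ℝ)), ← abs_mul, abs_of_nonneg (Real.sqrt_nonneg _)]
    congr 1
    ring
  obtain ⟨A, hA⟩ := h.isBoundedUnder_le.bddAbove_range
  obtain ⟨A', hA'⟩ := tendsto_sqrt_mul_invSqrtCoeff.isBoundedUnder_le.bddAbove_range
  have hAm : ∀ m : ℕ, √m * p m ≤ A := fun m => hA ⟨m, rfl⟩
  have hAm' : ∀ m : ℕ, √m * invSqrtCoeff m ≤ A' := fun m => hA' ⟨m, rfl⟩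
  set D := 2 * A + c * (2 * A') with hD
  have hD0 : 0 ≤ D := by
    have h1 := hAm 0
    have h2 := hAm' 0
    simp only [Nat.cast_zero, Real.sqrt_zero, zero_mul] at h1 h2
    positivity
  rw [Metric.tendsto_nhds]
  intro ε hε
  -- The series is cut at M ≈ K/|1-z|. After multiplication by √|1-z| the tail is at most D/√K,
  -- which fixes K; the head is then at most δ√(2K), which fixes δ.
  set K := (2 * D / ε) ^ 2 + 1 with hK
  have hK0 : 0 < K := by positivity
  have hKD : D / √K < ε / 2 := by
    have h1 : 2 * D / ε < √K := by
      refine Real.lt_sqrt_of_sq_lt ?_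
      linarith
    rw [div_lt_iff₀ (Real.sqrt_pos.2 hK0)]
    rw [div_lt_iff₀ hε] at h1
    linarith
  set δ := ε / 2 / √(2 * K) with hδ
  have hδ0 : 0 < δ := by positivity
  obtain ⟨M₀, hM₀⟩ := eventually_atTop.1
    ((tendsto_sum_range_div_sqrt he0 hetend).eventually (gt_mem_nhds hδ0))
  have hz1 : Tendsto (fun z : ℂ => ‖1 - z‖) (𝓝[Metric.ball 0 1] 1) (𝓝 0) := by
    have : Tendsto (fun z : ℂ => ‖1 - z‖) (𝓝 1) (𝓝 ‖(1 : ℂ) - 1‖) :=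
      Continuous.tendsto (by fun_prop) 1
    rw [sub_self, norm_zero] at this
    exact this.mono_left nhdsWithin_le_nhds
  have hr1 : (0 : ℝ) < min (K / (M₀ + 1)) K := lt_min (by positivity) hK0
  filter_upwards [hz1.eventually (gt_mem_nhds hr1), self_mem_nhdsWithin] with z hzK hz
  rw [mem_ball_zero_iff] at hz
  have hne : 0 < ‖1 - z‖ := by
    rw [norm_pos_iff, sub_ne_zero]
    rintro rfl
    simp at hz
  set r := ‖1 - z‖ with hr
  have hrK : r < K := hzK.trans_le (min_le_right _ _)
  have hrM : r < K / (M₀ + 1) := hzK.trans_le (min_le_left _ _)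
  set M := ⌈K / r⌉₊ with hM
  have hM1 : K / r ≤ M := Nat.le_ceil _
  have hM2 : (M : ℝ) ≤ 2 * K / r := by
    have h1 : (M : ℝ) < K / r + 1 := Nat.ceil_lt_add_one (by positivity)
    have h2 : 1 ≤ K / r := (one_le_div hne).2 hrK.le
    rw [mul_div_assoc]
    linarith
  have hM3 : M₀ ≤ M := by
    have : (M₀ : ℝ) + 1 < K / r := by
      rw [lt_div_iff₀ (by positivity)] at hrM
      rw [lt_div_iff₀ hne]
      linarith
    have : (M₀ : ℝ) ≤ M := by linarith
    exact_mod_cast this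
  have hMpos : (0 : ℝ) < M := lt_of_lt_of_le (by positivity) hM1
  have hq0 : ∀ m, 0 ≤ invSqrtCoeff m := fun m => (invSqrtCoeff_pos m).le
  have hsp := summable_cast_mul_pow_of_antitone hp0 hp hz
  have hsq := summable_cast_mul_pow_of_antitone hq0 invSqrtCoeff_antitone hz
  -- the tails
  have tail : ∀ q : ℕ → ℝ, (∀ m, 0 ≤ q m) → Antitone q →
      r * ‖∑' m, (q (m + M) : ℂ) * z ^ (m + M)‖ ≤ 2 * q M := by
    intro q hq0 hq
    have h1 := norm_one_sub_mul_tsum_le (p := fun m => q (m + M)) (fun m => hq0 _)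
      (fun m n h => hq (Nat.add_le_add_right h M)) hz
    have h2 : ∑' m, (q (m + M) : ℂ) * z ^ (m + M) = z ^ M * ∑' m, (q (m + M) : ℂ) * z ^ m := by
      rw [← tsum_mul_left]
      exact tsum_congr fun m => by ring
    rw [norm_mul, zero_add] at h1
    rw [h2, norm_mul, norm_pow]
    refine le_trans ?_ h1
    refine mul_le_mul_of_nonneg_left ?_ hne.le
    exact mul_le_of_le_one_left (norm_nonneg _) (pow_le_one₀ (norm_nonneg _) hz.le)
  have hsplit : ∑' m, (p m : ℂ) * z ^ m - c * ∑' m, (invSqrtCoeff m : ℂ) * z ^ m =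
      ∑ m ∈ Finset.range M, ((p m - c * invSqrtCoeff m : ℝ) : ℂ) * z ^ m +
      (∑' m, (p (m + M) : ℂ) * z ^ (m + M) -
        c * ∑' m, (invSqrtCoeff (m + M) : ℂ) * z ^ (m + M)) := by
    rw [← hsp.sum_add_tsum_nat_add M, ← hsq.sum_add_tsum_nat_add M]
    push_cast
    simp_rw [sub_mul, Finset.sum_sub_distrib, mul_assoc, ← Finset.mul_sum]
    ring
  have hhead : ‖∑ m ∈ Finset.range M, ((p m - c * invSqrtCoeff m : ℝ) : ℂ) * z ^ m‖ ≤ δ * √M := by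
    have h1 := hM₀ M hM3
    rw [div_lt_iff₀ (Real.sqrt_pos.2 hMpos)] at h1
    refine le_trans (norm_sum_le_of_le _ fun m _ => ?_) h1.le
    rw [norm_mul, Complex.norm_real, Real.norm_eq_abs, norm_pow]
    exact mul_le_of_le_one_right (abs_nonneg _) (pow_le_one₀ (norm_nonneg _) hz.le)
  have htail : r * ‖∑' m, (p (m + M) : ℂ) * z ^ (m + M) -
        c * ∑' m, (invSqrtCoeff (m + M) : ℂ) * z ^ (m + M)‖ ≤ D / √M := by
    have h1 := tail p hp0 hp
    have h2 := tail _ hq0 invSqrtCoeff_antitone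
    have hsM := Real.sqrt_pos.2 hMpos
    have h3 : p M ≤ A / √M := by rw [le_div_iff₀ hsM, mul_comm]; exact hAm M
    have h4 : invSqrtCoeff M ≤ A' / √M := by rw [le_div_iff₀ hsM, mul_comm]; exact hAm' M
    calc _ ≤ r * (‖∑' m, (p (m + M) : ℂ) * z ^ (m + M)‖ +
          c * ‖∑' m, (invSqrtCoeff (m + M) : ℂ) * z ^ (m + M)‖) := by
          refine mul_le_mul_of_nonneg_left ((norm_sub_le _ _).trans (le_of_eq ?_)) hne.le
          rw [norm_mul, Complex.norm_real, Real.norm_eq_abs, abs_of_nonneg hc]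
      _ = r * ‖∑' m, (p (m + M) : ℂ) * z ^ (m + M)‖ +
          c * (r * ‖∑' m, (invSqrtCoeff (m + M) : ℂ) * z ^ (m + M)‖) := by ring
      _ ≤ 2 * (A / √M) + c * (2 * (A' / √M)) := by
          have := mul_le_mul_of_nonneg_left (h2.trans (mul_le_mul_of_nonneg_left h4 zero_le_two)) hc
          linarith
      _ = D / √M := by rw [hD]; ring
  rw [Real.dist_eq, sub_zero, abs_of_nonneg (by positivity), hsplit]
  have hsr := Real.sqrt_pos.2 hne
  have hrr : √r * √r = r := Real.mul_self_sqrt hne.le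
  have hb1 : √r * (δ * √M) ≤ ε / 2 := by
    have h1 : √M ≤ √(2 * K) / √r := by
      rw [← Real.sqrt_div (by positivity)]
      exact Real.sqrt_le_sqrt hM2
    calc √r * (δ * √M) ≤ √r * (δ * (√(2 * K) / √r)) := by gcongr
      _ = ε / 2 := by
        have : 0 < √(2 * K) := Real.sqrt_pos.2 (by positivity)
        rw [hδ]; field_simp
  have hb2 : √r * ‖∑' m, (p (m + M) : ℂ) * z ^ (m + M) -
        c * ∑' m, (invSqrtCoeff (m + M) : ℂ) * z ^ (m + M)‖ < ε / 2 := by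
    refine lt_of_le_of_lt ?_ hKD
    have h1 : √K / √r ≤ √M := by
      rw [← Real.sqrt_div hK0.le]
      exact Real.sqrt_le_sqrt hM1
    have hsK := Real.sqrt_pos.2 hK0
    have h2 : D / √M ≤ D / (√K / √r) := by gcongr
    have h3 := htail.trans h2
    nth_rewrite 1 [← hrr] at h3
    rw [mul_assoc] at h3
    refine le_of_mul_le_mul_left (h3.trans (le_of_eq ?_)) hsr
    field_simp
  calc _ ≤ √r * (δ * √M + ‖∑' m, (p (m + M) : ℂ) * z ^ (m + M) -
        c * ∑' m, (invSqrtCoeff (m + M) : ℂ) * z ^ (m + M)‖) := by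
        refine mul_le_mul_of_nonneg_left ((norm_add_le _ _).trans ?_) hsr.le
        linarith
    _ < ε := by rw [mul_add]; linarith

/-! ### Contracting recursions -/

lemma summable_of_le_mul_add {e b : ℕ → ℝ} {γ : ℝ} {k : ℕ} (he : ∀ m, 0 ≤ e m) (hb0 : ∀ m, 0 ≤ b m)
    (hγ : γ < 1) (hb : Summable b) (h : ∀ m, e (m + k) ≤ γ * e m + b m) :
    Summable e := by
  refine summable_of_sum_range_le (c := (∑ m ∈ Finset.range k, e m + ∑' m, b m) / (1 - γ)) he
    fun N => ?_
  rw [le_div_iff₀ (by linarith)]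
  have h1 : ∑ m ∈ Finset.range N, e m ≤ ∑ m ∈ Finset.range (k + N), e m :=
    Finset.sum_le_sum_of_subset_of_nonneg (Finset.range_mono (by omega)) fun m _ _ => he m
  have h2 : ∑ m ∈ Finset.range (k + N), e m =
      ∑ m ∈ Finset.range k, e m + ∑ m ∈ Finset.range N, e (m + k) := by
    rw [Finset.sum_range_add]
    simp_rw [add_comm k]
  have h3 : ∑ m ∈ Finset.range N, e (m + k) ≤ γ * ∑ m ∈ Finset.range N, e m + ∑' m, b m := by
    have := hb.sum_le_tsum (Finset.range N) fun m _ => hb0 m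
    calc _ ≤ ∑ m ∈ Finset.range N, (γ * e m + b m) := Finset.sum_le_sum fun m _ => h m
      _ = γ * ∑ m ∈ Finset.range N, e m + ∑ m ∈ Finset.range N, b m := by
        rw [Finset.sum_add_distrib, Finset.mul_sum]
      _ ≤ _ := by linarith
  have h4 : 0 ≤ ∑ m ∈ Finset.range N, e m := Finset.sum_nonneg fun m _ => he m
  nlinarith

/-- The ratio √(m+k)/√m tends to 1, so it is absorbed by enlarging γ to some γ' < 1. -/
lemma tendsto_sqrt_mul_of_le_mul_add {e b : ℕ → ℝ} {γ : ℝ} {k : ℕ} (he : ∀ m, 0 ≤ e m)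
    (hγ0 : 0 ≤ γ) (hγ : γ < 1) (hb : Tendsto (fun m : ℕ => √m * b m) atTop (𝓝 0))
    (h : ∀ m, e (m + k) ≤ γ * e m + b m) :
    Tendsto (fun m : ℕ => √m * e m) atTop (𝓝 0) := by
  obtain ⟨γ', hγ1, hγ2⟩ := exists_between hγ
  have hγ'0 : 0 ≤ γ' := hγ0.trans hγ1.le
  have hratio : Tendsto (fun m : ℕ => √((m + k : ℝ) / m)) atTop (𝓝 1) := by
    have h1 : Tendsto (fun m : ℕ => √(1 + (k : ℝ) / m)) atTop (𝓝 √(1 + 0)) :=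
      (tendsto_const_nhds.add (tendsto_const_div_atTop_nhds_zero_nat (k : ℝ))).sqrt
    rw [add_zero, Real.sqrt_one] at h1
    refine h1.congr' ?_
    filter_upwards [eventually_gt_atTop 0] with m hm
    have : (0 : ℝ) < m := by exact_mod_cast hm
    congr 1
    field_simp
  have hE : ∀ δ > 0, ∀ᶠ m : ℕ in atTop, √m * e m < 2 * δ := by
    intro δ hδ
    have h1 : ∀ᶠ m : ℕ in atTop, √((m + k : ℕ) : ℝ) * e (m + k) ≤ γ' * (√m * e m) + δ * (1 - γ') := by
      have hr1 : ∀ᶠ m : ℕ in atTop, √((m + k : ℝ) / m) * γ < γ' := by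
        have := hratio.mul_const γ
        rw [one_mul] at this
        exact this.eventually (gt_mem_nhds hγ1)
      have hr2 : ∀ᶠ m : ℕ in atTop, √((m + k : ℝ) / m) * (√m * b m) < δ * (1 - γ') := by
        have := hratio.mul hb
        rw [one_mul] at this
        exact this.eventually (gt_mem_nhds (mul_pos hδ (by linarith)))
      filter_upwards [hr1, hr2, eventually_gt_atTop 0] with m h1 h2 hm
      have hm' : (0 : ℝ) < m := by exact_mod_cast hm
      have h3 : √((m + k : ℕ) : ℝ) = √((m + k : ℝ) / m) * √m := by
        rw [← Real.sqrt_mul (by positivity), div_mul_cancel₀ _ hm'.ne']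
        push_cast; rfl
      rw [h3]
      have h4 : 0 ≤ √(m : ℝ) * e m := mul_nonneg (Real.sqrt_nonneg _) (he m)
      calc √((m + k : ℝ) / m) * √m * e (m + k)
          ≤ √((m + k : ℝ) / m) * √m * (γ * e m + b m) := by gcongr; exact h m
        _ = √((m + k : ℝ) / m) * γ * (√m * e m) + √((m + k : ℝ) / m) * (√m * b m) := by ring
        _ ≤ _ := add_le_add (mul_le_mul_of_nonneg_right h1.le h4) h2.le
    obtain ⟨M, hM⟩ := eventually_atTop.1 h1
    -- The level δ is the fixed point of u ↦ γ'u + δ(1-γ'), so the excess over it obeys a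
    -- contraction without source term and is summable.
    have hX : Summable fun m => max (√((M + m : ℕ) : ℝ) * e (M + m) - δ) 0 := by
      refine summable_of_le_mul_add (b := fun _ => 0) (γ := γ') (k := k) (fun m => le_max_right _ _)
        (fun _ => le_rfl) hγ2 summable_zero fun m => ?_
      rw [add_zero]
      refine max_le ?_ (mul_nonneg hγ'0 (le_max_right _ _))
      have h2 := hM (M + m) (Nat.le_add_right _ _)
      have h3 := mul_le_mul_of_nonneg_left
        (le_max_left (√((M + m : ℕ) : ℝ) * e (M + m) - δ) 0) hγ'0
      rw [← add_assoc]
      linarith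
    have h2 := hX.tendsto_atTop_zero.eventually (gt_mem_nhds hδ)
    obtain ⟨M', hM'⟩ := eventually_atTop.1 h2
    filter_upwards [eventually_ge_atTop (M + M')] with m hm
    have h3 := hM' (m - M) (by omega)
    rw [show M + (m - M) = m by omega] at h3
    have := le_max_left (√(m : ℝ) * e m - δ) 0
    linarith
  rw [Metric.tendsto_nhds]
  intro ε hε
  filter_upwards [hE (ε / 2) (by positivity)] with m hm
  rw [Real.dist_eq, sub_zero, abs_of_nonneg (mul_nonneg (Real.sqrt_nonneg _) (he m))]
  linarith

end TwoStep

namespace TwoStep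

section Matrices

open scoped Matrix

/-! ### Nonnegative matrices -/

variable {ι : Type*} [Fintype ι]

lemma mulVec_nonneg {W : Matrix ι ι ℝ} (hW : ∀ i j, 0 ≤ W i j) {v : ι → ℝ} (hv : ∀ i, 0 ≤ v i)
    (i : ι) : 0 ≤ (W *ᵥ v) i :=
  Finset.sum_nonneg fun j _ => mul_nonneg (hW i j) (hv j)

lemma mulVec_pos_of_pos {P : Matrix ι ι ℝ} (hP : ∀ i j, 0 < P i j) {v : ι → ℝ}
    (hv : ∀ i, 0 ≤ v i) {j : ι} (hj : v j ≠ 0) (i : ι) : 0 < (P *ᵥ v) i :=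
  Finset.sum_pos' (fun l _ => mul_nonneg (hP i l).le (hv l))
    ⟨j, Finset.mem_univ _, mul_pos (hP i j) (lt_of_le_of_ne (hv j) hj.symm)⟩

/-- The natural norm on row vectors is Σ|d i| r i, weighted by the right eigenvector: in it, the
operator norm of a nonnegative matrix is controlled by the eigenvalue. -/
lemma sum_abs_vecMul_mul_le {S : Matrix ι ι ℝ} (hS : ∀ i j, 0 ≤ S i j) {r : ι → ℝ} {γ : ℝ}
    (hr : ∀ i, 0 < r i) (h : S *ᵥ r = γ • r) (d : ι → ℝ) :
    ∑ j, |(d ᵥ* S) j| * r j ≤ γ * ∑ i, |d i| * r i := by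
  calc ∑ j, |(d ᵥ* S) j| * r j ≤ ∑ j, ∑ i, |d i| * S i j * r j := by
        refine Finset.sum_le_sum fun j _ => ?_
        rw [← Finset.sum_mul]
        refine mul_le_mul_of_nonneg_right ((Finset.abs_sum_le_sum_abs _ _).trans ?_) (hr j).le
        refine Finset.sum_le_sum fun i _ => ?_
        rw [abs_mul, abs_of_nonneg (hS i j)]
    _ = ∑ i, |d i| * (S *ᵥ r) i := by
        rw [Finset.sum_comm]
        refine Finset.sum_congr rfl fun i _ => ?_
        simp only [Matrix.mulVec, dotProduct, Finset.mul_sum, mul_assoc]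
    _ = γ * ∑ i, |d i| * r i := by
        rw [h, Finset.mul_sum]
        refine Finset.sum_congr rfl fun i _ => ?_
        simp only [Pi.smul_apply, smul_eq_mul]
        ring

/-- Maximum principle: where |v|/g is largest, a nonzero fixed vector would contradict the strict
inequality for g. -/
lemma eq_zero_of_mulVec_eq_self [Nonempty ι] {Q : Matrix ι ι ℝ} (hQ : ∀ i j, 0 ≤ Q i j) {g : ι → ℝ}
    (hg : ∀ i, 0 < g i) (h : ∀ i, (Q *ᵥ g) i < g i) {v : ι → ℝ} (hv : Q *ᵥ v = v) : v = 0 := by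
  obtain ⟨i, hi⟩ := Finite.exists_max fun i => |v i| / g i
  set m := |v i| / g i with hm
  have hm0 : 0 ≤ m := div_nonneg (abs_nonneg _) (hg i).le
  have hvb : ∀ j, |v j| ≤ m * g j := fun j => (div_le_iff₀ (hg j)).1 (hi j)
  have h1 : m * g i ≤ m * (Q *ᵥ g) i := by
    calc m * g i = |v i| := by rw [hm]; field_simp [(hg i).ne']
      _ = |(Q *ᵥ v) i| := by rw [hv]
      _ ≤ ∑ j, Q i j * |v j| := by
        refine (Finset.abs_sum_le_sum_abs _ _).trans (Finset.sum_le_sum fun j _ => ?_)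
        rw [abs_mul, abs_of_nonneg (hQ i j)]
      _ ≤ ∑ j, Q i j * (m * g j) :=
        Finset.sum_le_sum fun j _ => mul_le_mul_of_nonneg_left (hvb j) (hQ i j)
      _ = m * (Q *ᵥ g) i := by
        simp only [Matrix.mulVec, dotProduct, Finset.mul_sum]
        exact Finset.sum_congr rfl fun j _ => by ring
  have hm' : m = 0 := by
    by_contra hne
    have hpos : 0 < m := lt_of_le_of_ne hm0 (Ne.symm hne)
    nlinarith [h i]
  funext j
  have := hvb j
  rw [hm', zero_mul] at this
  exact abs_nonpos_iff.1 this

variable [DecidableEq ι]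

lemma pow_apply_nonneg {W : Matrix ι ι ℝ} (hW : ∀ i j, 0 ≤ W i j) (n : ℕ) (i j : ι) :
    0 ≤ (W ^ n) i j := by
  induction n generalizing i j with
  | zero => rw [pow_zero, Matrix.one_apply]; split_ifs <;> norm_num
  | succ n ih =>
    rw [pow_succ, Matrix.mul_apply]
    exact Finset.sum_nonneg fun l _ => mul_nonneg (ih i l) (hW l j)

lemma pow_apply_mono {Q W : Matrix ι ι ℝ} (hQ : ∀ i j, 0 ≤ Q i j) (h : ∀ i j, Q i j ≤ W i j)
    (n : ℕ) (i j : ι) : (Q ^ n) i j ≤ (W ^ n) i j := by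
  induction n generalizing i j with
  | zero => simp
  | succ n ih =>
    rw [pow_succ, pow_succ, Matrix.mul_apply, Matrix.mul_apply]
    exact Finset.sum_le_sum fun l _ => mul_le_mul (ih i l) (h l j) (hQ l j)
      ((pow_apply_nonneg hQ n i l).trans (ih i l))

lemma pow_mulVec_eq {W : Matrix ι ι ℝ} {v : ι → ℝ} {a : ℝ} (h : W *ᵥ v = a • v) (n : ℕ) :
    (W ^ n) *ᵥ v = a ^ n • v := by
  induction n with
  | zero => simp
  | succ n ih =>
    rw [pow_succ, ← Matrix.mulVec_mulVec, h, Matrix.mulVec_smul, ih, smul_smul, pow_succ, mul_comm]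

/-- **Perron–Frobenius**: a nonnegative matrix with a positive power has a positive eigenvector. -/
theorem exists_pos_eigenvector [Nonempty ι] {W : Matrix ι ι ℝ} (hW : ∀ i j, 0 ≤ W i j) {k : ℕ}
    (hk : 1 ≤ k) (hWk : ∀ i j, 0 < (W ^ k) i j) :
    ∃ a : ℝ, 0 < a ∧ ∃ r : ι → ℝ, (∀ i, 0 < r i) ∧ W *ᵥ r = a • r := by
  set L := ∑ i, ∑ j, W i j with hL
  have hLbound : ∀ a : ℝ, ∀ v ∈ stdSimplex ℝ ι, (∀ i, a * v i ≤ (W *ᵥ v) i) → a ≤ L := by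
    intro a v hv h
    have h1 := Finset.sum_le_sum fun i (_ : i ∈ Finset.univ) => h i
    rw [← Finset.mul_sum, hv.2, mul_one] at h1
    refine h1.trans (Finset.sum_le_sum fun i _ => Finset.sum_le_sum fun j _ => ?_)
    refine mul_le_of_le_one_right (hW i j) ?_
    rw [← hv.2]
    exact Finset.single_le_sum (fun l _ => hv.1 l) (Finset.mem_univ j)
  -- Collatz–Wielandt: the eigenvalue is the largest a with a v ≤ W v for some v in the simplex, and
  -- it is attained by compactness.
  set K : Set (ℝ × (ι → ℝ)) := (Icc 0 L ×ˢ stdSimplex ℝ ι) ∩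
    {q | ∀ i, q.1 * q.2 i ≤ (W *ᵥ q.2) i} with hK
  have hKc : IsCompact K := by
    refine (isCompact_Icc.prod (isCompact_stdSimplex ℝ ι)).inter_right ?_
    rw [Set.ofPred_forall]
    refine isClosed_iInter fun i => isClosed_le (by fun_prop) ?_
    simp only [Matrix.mulVec, dotProduct]
    fun_prop
  have hL0 : 0 ≤ L := Finset.sum_nonneg fun i _ => Finset.sum_nonneg fun j _ => hW i j
  have hKne : K.Nonempty := by
    obtain ⟨i₀⟩ := ‹Nonempty ι›
    refine ⟨(0, Pi.single i₀ 1), ⟨⟨le_rfl, hL0⟩, single_mem_stdSimplex ℝ i₀⟩, fun i => ?_⟩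
    rw [zero_mul]
    exact mulVec_nonneg hW (single_mem_stdSimplex ℝ i₀).1 i
  obtain ⟨⟨a, v⟩, hmem, hmax⟩ := hKc.exists_isMaxOn hKne continuous_fst.continuousOn
  obtain ⟨⟨⟨ha0, -⟩, hv⟩, hav⟩ := hmem
  simp only [mem_ofPred_eq] at hav ha0 hv
  have hvne : ∃ j, v j ≠ 0 := by
    by_contra hcon
    push Not at hcon
    have := hv.2
    simp [hcon] at this
  obtain ⟨j₀, hj₀⟩ := hvne
  have heig : W *ᵥ v = a • v := by
    by_contra hne
    have hne' : ∃ j, (W *ᵥ v - a • v) j ≠ 0 := by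
      by_contra hcon
      push Not at hcon
      exact hne (sub_eq_zero.1 (funext hcon))
    obtain ⟨j₁, hj₁⟩ := hne'
    have hd : ∀ i, 0 ≤ (W *ᵥ v - a • v) i := fun i => by simpa using hav i
    -- Applying the positive power W^k to a nonzero defect W v - a v makes it strictly positive
    -- everywhere, leaving room to increase a.
    set u := (W ^ k) *ᵥ v with hu
    have hu0 : ∀ i, 0 < u i := mulVec_pos_of_pos hWk hv.1 hj₀
    have hWu : W *ᵥ u - a • u = (W ^ k) *ᵥ (W *ᵥ v - a • v) := by
      rw [hu, Matrix.mulVec_sub, Matrix.mulVec_mulVec, Matrix.mulVec_mulVec, Matrix.mulVec_smul,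
        ← pow_succ, ← pow_succ']
    have hlt : ∀ i, 0 < (W *ᵥ u - a • u) i := fun i => by
      rw [hWu]; exact mulVec_pos_of_pos hWk hd hj₁ i
    obtain ⟨i₁, hi₁⟩ := Finite.exists_min fun i => (W *ᵥ u - a • u) i / u i
    set ε := (W *ᵥ u - a • u) i₁ / u i₁ with hε
    have hε0 : 0 < ε := div_pos (hlt i₁) (hu0 i₁)
    have hsum : 0 < ∑ i, u i := Finset.sum_pos (fun i _ => hu0 i) Finset.univ_nonempty
    set v' := (∑ i, u i)⁻¹ • u with hv'
    have hv'mem : v' ∈ stdSimplex ℝ ι := by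
      refine ⟨fun i => mul_nonneg (inv_nonneg.2 hsum.le) (hu0 i).le, ?_⟩
      simp only [hv', Pi.smul_apply, smul_eq_mul]
      rw [← Finset.mul_sum, inv_mul_cancel₀ hsum.ne']
    have hav' : ∀ i, (a + ε) * v' i ≤ (W *ᵥ v') i := by
      intro i
      have h1 := hi₁ i
      rw [le_div_iff₀ (hu0 i)] at h1
      simp only [Pi.sub_apply, Pi.smul_apply, smul_eq_mul] at h1
      rw [hv', Matrix.mulVec_smul]
      simp only [Pi.smul_apply, smul_eq_mul]
      rw [mul_left_comm]
      refine mul_le_mul_of_nonneg_left ?_ (inv_nonneg.2 hsum.le)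
      linarith
    have h2 := hmax (show (a + ε, v') ∈ K from
      ⟨⟨⟨by positivity, hLbound _ _ hv'mem hav'⟩, hv'mem⟩, hav'⟩)
    simp only [mem_ofPred_eq] at h2
    linarith
  have h3 := pow_mulVec_eq heig k
  have h4 : ∀ i, 0 < a ^ k * v i := fun i => by
    have := mulVec_pos_of_pos hWk hv.1 hj₀ i
    rw [h3] at this
    exact this
  have ha : a ≠ 0 := by
    rintro rfl
    have := h4 j₀
    rw [zero_pow (by omega), zero_mul] at this
    exact lt_irrefl _ this
  exact ⟨a, lt_of_le_of_ne ha0 ha.symm, v, fun i => pos_of_mul_pos_right (h4 i) (pow_nonneg ha0 k),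
    heig⟩

/-- The transpose has a Perron vector too; pairing it with r, which is positive, forces the two
eigenvalues to agree. -/
lemma exists_pos_left_eigenvector [Nonempty ι] {W : Matrix ι ι ℝ} (hW : ∀ i j, 0 ≤ W i j) {k : ℕ}
    (hk : 1 ≤ k) (hWk : ∀ i j, 0 < (W ^ k) i j) {a : ℝ} {r : ι → ℝ} (hr : ∀ i, 0 < r i)
    (h : W *ᵥ r = a • r) : ∃ l : ι → ℝ, (∀ i, 0 < l i) ∧ l ᵥ* W = a • l := by
  obtain ⟨b, -, l, hl, hlb⟩ := exists_pos_eigenvector (W := Wᵀ) (fun i j => hW j i) hk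
    (fun i j => by rw [← Matrix.transpose_pow]; exact hWk j i)
  rw [Matrix.mulVec_transpose] at hlb
  have h1 : l ⬝ᵥ (W *ᵥ r) = (l ᵥ* W) ⬝ᵥ r := Matrix.dotProduct_mulVec _ _ _
  rw [h, hlb, dotProduct_smul, smul_dotProduct] at h1
  have h2 : 0 < l ⬝ᵥ r := Finset.sum_pos (fun i _ => mul_pos (hl i) (hr i)) Finset.univ_nonempty
  have h3 : a = b := mul_right_cancel₀ h2.ne' h1
  exact ⟨l, hl, by rw [hlb, h3]⟩

/-- A Doeblin-type contraction on the hyperplane orthogonal to the Perron eigenvector. -/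
theorem exists_contraction [Nonempty ι] {S : Matrix ι ι ℝ} {k : ℕ}
    (hSk : ∀ i j, 0 < (S ^ k) i j) {r : ι → ℝ} (hr : ∀ i, 0 < r i) (h : S *ᵥ r = r) :
    ∃ γ : ℝ, 0 ≤ γ ∧ γ < 1 ∧ ∀ d : ι → ℝ, d ⬝ᵥ r = 0 →
      ∑ j, |(d ᵥ* (S ^ k)) j| * r j ≤ γ * ∑ i, |d i| * r i := by
  have hsum : 0 < ∑ j, r j := Finset.sum_pos (fun i _ => hr i) Finset.univ_nonempty
  obtain ⟨⟨i₀, j₀⟩, hmin⟩ := Finite.exists_min fun q : ι × ι => (S ^ k) q.1 q.2 / r q.1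
  set ε := (S ^ k) i₀ j₀ / r i₀ with hε
  have hε0 : 0 < ε := div_pos (hSk _ _) (hr _)
  -- The subtracted rank-one matrix annihilates every d orthogonal to r, yet it lowers the
  -- eigenvalue of r from 1 to 1 - ε Σ r. The choice of ε as a minimum keeps Q nonnegative.
  set Q : Matrix ι ι ℝ := Matrix.of fun i j => (S ^ k) i j - ε * r i with hQ
  have hQ0 : ∀ i j, 0 ≤ Q i j := by
    intro i j
    have h1 := hmin (i, j)
    rw [le_div_iff₀ (hr i)] at h1
    simpa [hQ] using h1
  have hSr : (S ^ k) *ᵥ r = r := by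
    have := pow_mulVec_eq (a := 1) (by rw [one_smul]; exact h) k
    simpa using this
  have hQr : Q *ᵥ r = (1 - ε * ∑ j, r j) • r := by
    funext i
    have h1 := congrFun hSr i
    simp only [Matrix.mulVec, dotProduct] at h1
    simp only [Matrix.mulVec, dotProduct, hQ, Matrix.of_apply, sub_mul, Finset.sum_sub_distrib, h1,
      Pi.smul_apply, smul_eq_mul]
    rw [← Finset.mul_sum]
    ring
  refine ⟨1 - ε * ∑ j, r j, ?_, by nlinarith, fun d hd => ?_⟩
  · have h1 := mulVec_nonneg hQ0 (fun i => (hr i).le) i₀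
    rw [hQr] at h1
    exact nonneg_of_mul_nonneg_left h1 (hr i₀)
  · have h2 : d ᵥ* (S ^ k) = d ᵥ* Q := by
      funext j
      have h3 : ∑ i, d i * (ε * r i) = 0 := by
        have : ∑ i, d i * r i = 0 := hd
        rw [← mul_zero ε, ← this, Finset.mul_sum]
        exact Finset.sum_congr rfl fun i _ => by ring
      simp only [Matrix.vecMul, dotProduct, hQ, Matrix.of_apply, mul_sub, Finset.sum_sub_distrib, h3,
        sub_zero]
    rw [h2]
    exact sum_abs_vecMul_mul_le hQ0 hr hQr d

/-- Deleting a row of a primitive matrix makes the spectral radius drop: there is a positive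
strict supersolution. -/
lemma exists_strict_supersolution {S Q : Matrix ι ι ℝ} (hS : ∀ i j, 0 ≤ S i j) {k : ℕ}
    (hk : 1 ≤ k) (hSk : ∀ i j, 0 < (S ^ k) i j) {r : ι → ℝ} (hr : ∀ i, 0 < r i) (h : S *ᵥ r = r)
    {θ : ι} (hQθ : ∀ j, Q θ j = 0) (hQ : ∀ i, i ≠ θ → ∀ j, Q i j = S i j) :
    ∃ g : ι → ℝ, (∀ i, 0 < g i) ∧ ∀ i, (Q *ᵥ g) i < g i := by
  have hQ0 : ∀ i j, 0 ≤ Q i j := fun i j => by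
    by_cases hi : i = θ
    · rw [hi, hQθ]
    · rw [hQ i hi]; exact hS i j
  have hQS : ∀ i j, Q i j ≤ S i j := fun i j => by
    by_cases hi : i = θ
    · rw [hi, hQθ]; exact hS _ _
    · rw [hQ i hi]
  have hrow : ∀ j, (Q ^ k) θ j = 0 := by
    intro j
    obtain ⟨m, rfl⟩ : ∃ m, k = m + 1 := ⟨k - 1, by omega⟩
    rw [pow_succ', Matrix.mul_apply]
    exact Finset.sum_eq_zero fun l _ => by rw [hQθ, zero_mul]
  -- Among the paths of length 2k between any two states, some sit at `θ` at time k; these count for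
  -- S and are killed in Q.
  have hlt : ∀ i j, (Q ^ (k + k)) i j < (S ^ (k + k)) i j := by
    intro i j
    rw [pow_add, pow_add, Matrix.mul_apply, Matrix.mul_apply]
    refine Finset.sum_lt_sum (fun l _ => ?_) ⟨θ, Finset.mem_univ _, ?_⟩
    · exact mul_le_mul (pow_apply_mono hQ0 hQS k i l) (pow_apply_mono hQ0 hQS k l j)
        (pow_apply_nonneg hQ0 k l j) (pow_apply_nonneg hS k i l)
    · rw [hrow, mul_zero]
      exact mul_pos (hSk _ _) (hSk _ _)
  have hSr : (S ^ (k + k)) *ᵥ r = r := by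
    have := pow_mulVec_eq (a := 1) (by rw [one_smul]; exact h) (k + k)
    simpa using this
  -- A truncated Neumann series: Q g = g - r + Q^(2k) r, and the last term is strictly below r.
  set g : ι → ℝ := ∑ n ∈ Finset.range (k + k), (Q ^ n) *ᵥ r with hg
  have hterm : ∀ n i, 0 ≤ ((Q ^ n) *ᵥ r) i := fun n i =>
    mulVec_nonneg (pow_apply_nonneg hQ0 n) (fun j => (hr j).le) i
  refine ⟨g, fun i => ?_, fun i => ?_⟩
  · rw [hg, Finset.sum_apply]
    refine Finset.sum_pos' (fun n _ => hterm n i) ⟨0, Finset.mem_range.2 (by omega), ?_⟩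
    simpa using hr i
  · have h1 : Q *ᵥ g = g + (Q ^ (k + k)) *ᵥ r - r := by
      rw [hg, Matrix.mulVec_sum]
      simp_rw [Matrix.mulVec_mulVec, ← pow_succ']
      rw [← Finset.sum_range_succ (fun n => (Q ^ n) *ᵥ r), Finset.sum_range_succ']
      simp
    have h2 : ((Q ^ (k + k)) *ᵥ r) i < r i := by
      nth_rewrite 2 [← hSr]
      exact Finset.sum_lt_sum_of_nonempty ⟨θ, Finset.mem_univ _⟩
        fun j _ => mul_lt_mul_of_pos_right (hlt i j) (hr j)
    rw [h1]
    simp only [Pi.sub_apply, Pi.add_apply]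
    linarith

lemma det_one_sub_ne_zero [Nonempty ι] {Q : Matrix ι ι ℝ} (hQ : ∀ i j, 0 ≤ Q i j) {g : ι → ℝ}
    (hg : ∀ i, 0 < g i) (h : ∀ i, (Q *ᵥ g) i < g i) : (1 - Q).det ≠ 0 := by
  intro hdet
  obtain ⟨v, hv, hv0⟩ := Matrix.exists_mulVec_eq_zero_iff.2 hdet
  rw [Matrix.sub_mulVec, Matrix.one_mulVec, sub_eq_zero] at hv0
  exact hv (eq_zero_of_mulVec_eq_self hQ hg h hv0.symm)

/-- A minimum principle for the Poisson equation of a primitive matrix, whose source is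
nonnegative outside of the state `s`. -/
lemma poisson_min {S : Matrix ι ι ℝ} (hS : ∀ i j, 0 ≤ S i j) {k : ℕ}
    (hSk : ∀ i j, 0 < (S ^ k) i j) {r : ι → ℝ} (hr : ∀ i, 0 < r i) (h : S *ᵥ r = r)
    {v δ : ι → ℝ} (hv : ∀ i, v i = (S *ᵥ v) i + δ i * r i) {s : ι} (hδ : ∀ i, i ≠ s → 0 ≤ δ i) :
    (∀ j, v s / r s ≤ v j / r j) ∧ ∀ j, 0 < δ j → v s / r s < v j / r j := by
  have : Nonempty ι := ⟨s⟩
  obtain ⟨i₀, hi₀⟩ := Finite.exists_min fun i => v i / r i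
  set m := v i₀ / r i₀ with hm
  have hmv : ∀ j, m * r j ≤ v j := fun j => (le_div_iff₀ (hr j)).1 (hi₀ j)
  have hSum : ∀ i, (S *ᵥ v) i = m * r i + ∑ j, S i j * (v j - m * r j) := by
    intro i
    have h1 := congrFun h i
    simp only [Matrix.mulVec, dotProduct] at h1 ⊢
    simp_rw [mul_sub, Finset.sum_sub_distrib]
    have : ∑ j, S i j * (m * r j) = m * r i := by
      rw [← h1, Finset.mul_sum]; exact Finset.sum_congr rfl fun j _ => by ring
    rw [this]; ring
  have hnn : ∀ i j, 0 ≤ S i j * (v j - m * r j) := fun i j =>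
    mul_nonneg (hS i j) (sub_nonneg.2 (hmv j))
  -- At a minimiser of v/r other than `s` the source is nonnegative, so every successor is again a
  -- minimiser; since S^k is positive, `s` would be reached.
  have hs : v s = m * r s := by
    by_contra hs
    have hclosed : ∀ i j, v i = m * r i → S i j ≠ 0 → v j = m * r j := by
      intro i j hi hij
      have his : i ≠ s := fun e => hs (e ▸ hi)
      have h1 := hv i
      rw [hSum, hi] at h1
      have h2 := mul_nonneg (hδ i his) (hr i).le
      have h3 : ∑ l, S i l * (v l - m * r l) = 0 :=
        le_antisymm (by linarith) (Finset.sum_nonneg fun l _ => hnn i l)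
      have h4 := (Finset.sum_eq_zero_iff_of_nonneg fun l _ => hnn i l).1 h3 j (Finset.mem_univ _)
      rcases mul_eq_zero.1 h4 with h5 | h5
      · exact absurd h5 hij
      · linarith
    have hpow : ∀ n i j, v i = m * r i → (S ^ n) i j ≠ 0 → v j = m * r j := by
      intro n
      induction n with
      | zero =>
        intro i j hi hij
        rw [pow_zero, Matrix.one_apply] at hij
        split_ifs at hij with e
        · exact e ▸ hi
        · exact absurd rfl hij
      | succ n ih =>
        intro i j hi hij
        rw [pow_succ', Matrix.mul_apply] at hij
        obtain ⟨l, -, hl⟩ := Finset.exists_ne_zero_of_sum_ne_zero hij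
        exact ih l j (hclosed i l hi (left_ne_zero_of_mul hl)) (right_ne_zero_of_mul hl)
    refine hs (hpow k i₀ s ?_ (hSk _ _).ne')
    rw [hm]; field_simp [(hr i₀).ne']
  have hsm : v s / r s = m := by rw [hs]; field_simp [(hr s).ne']
  refine ⟨fun j => hsm ▸ hi₀ j, fun j hj => ?_⟩
  rw [hsm, lt_div_iff₀ (hr j), hv j, hSum]
  have h1 := Finset.sum_nonneg fun l (_ : l ∈ Finset.univ) => hnn j l
  have h2 := mul_pos hj (hr j)
  linarith

end Matrices

end TwoStep

namespace TwoStep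

/-! ### Partition functions and transfer matrices -/

/-- The weight of a step. -/
noncomputable def stepWeight (x y : ℝ) (j : Step) : ℝ := x ^ j.dx * y ^ j.dy

/-- The transfer matrix, with real entries. -/
noncomputable def transferReal (R : Rule) (i j : Step) : ℝ := if R i j = true then 1 else 0

lemma stepWeight_pos {x y : ℝ} (hx : 0 < x) (hy : 0 < y) (j : Step) : 0 < stepWeight x y j :=
  mul_pos (zpow_pos hx _) (zpow_pos hy _)

lemma transferReal_nonneg (R : Rule) (i j : Step) : 0 ≤ transferReal R i j := by
  unfold transferReal; split_ifs <;> norm_num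

lemma partitionFn_zero (P : List Step → Prop) [Decidable (P [])] (x y : ℝ) :
    partitionFn P 0 x y = if P [] then 1 else 0 := by
  unfold partitionFn
  rw [Fintype.sum_eq_single (List.Vector.nil : List.Vector Step 0)
    fun v hv => absurd (List.Vector.eq_nil v) hv]
  simp [xEnd, yEnd]

lemma partitionFn_congr {P P' : List Step → Prop} {m : ℕ} (h : ∀ l, l.length = m → (P l ↔ P' l))
    (x y : ℝ) : partitionFn P m x y = partitionFn P' m x y := by
  unfold partitionFn
  refine Finset.sum_congr rfl fun v _ => ?_
  have hv := h v.toList v.toList_length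
  by_cases h1 : P v.toList
  · rw [if_pos h1, if_pos (hv.1 h1)]
  · rw [if_neg h1, if_neg fun h2 => h1 (hv.2 h2)]

lemma partitionFn_eq_zero {P : List Step → Prop} {m : ℕ} (h : ∀ l, l.length = m → ¬P l) (x y : ℝ) :
    partitionFn P m x y = 0 := by
  unfold partitionFn
  exact Finset.sum_eq_zero fun v _ => if_neg (h _ v.toList_length)

lemma partitionFn_and_add_and_not (P q : List Step → Prop) (m : ℕ) (x y : ℝ) :
    partitionFn (fun l => P l ∧ q l) m x y + partitionFn (fun l => P l ∧ ¬q l) m x y =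
      partitionFn P m x y := by
  unfold partitionFn
  rw [← Finset.sum_add_distrib]
  refine Finset.sum_congr rfl fun v _ => ?_
  by_cases h1 : P v.toList <;> by_cases h2 : q v.toList <;> simp [h1, h2]

lemma partitionFn_nonneg (P : List Step → Prop) (m : ℕ) {x y : ℝ} (hx : 0 < x) (hy : 0 < y) :
    0 ≤ partitionFn P m x y := by
  unfold partitionFn
  refine Finset.sum_nonneg fun v _ => ?_
  split_ifs
  · exact mul_nonneg (zpow_pos hx _).le (zpow_pos hy _).le
  · exact le_rfl

lemma partitionFn_const_and (q : Prop) [Decidable q] (P : List Step → Prop) (m : ℕ) (x y : ℝ) :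
    partitionFn (fun l => q ∧ P l) m x y = if q then partitionFn P m x y else 0 := by
  by_cases hq : q
  · rw [if_pos hq]
    exact partitionFn_congr (fun l _ => and_iff_right hq) x y
  · rw [if_neg hq]
    exact partitionFn_eq_zero (fun l _ h => hq h.1) x y

lemma partitionFn_eq_sum (P : List Step → Prop) (f : List Step → Option Step) {m : ℕ}
    (hf : ∀ l, l.length = m → P l → ∃ j, f l = some j) (x y : ℝ) :
    partitionFn P m x y = ∑ j, partitionFn (fun l => P l ∧ f l = some j) m x y := by
  classical
  unfold partitionFn
  rw [Finset.sum_comm]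
  refine Finset.sum_congr rfl fun v _ => ?_
  by_cases hP : P v.toList
  · obtain ⟨j, hj⟩ := hf _ v.toList_length hP
    simp [hP, hj]
  · simp [hP]

lemma xEnd_cons (j : Step) (l : List Step) : xEnd (j :: l) = j.dx + xEnd l := by simp [xEnd]

lemma yEnd_cons (j : Step) (l : List Step) : yEnd (j :: l) = j.dy + yEnd l := by simp [yEnd]

lemma xEnd_concat (l : List Step) (j : Step) : xEnd (l ++ [j]) = j.dx + xEnd l := by
  simp [xEnd, add_comm]

lemma yEnd_concat (l : List Step) (j : Step) : yEnd (l ++ [j]) = j.dy + yEnd l := by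
  simp [yEnd, add_comm]

lemma partitionFn_succ_cons (P : List Step → Prop) (m : ℕ) {x y : ℝ} (hx : x ≠ 0) (hy : y ≠ 0) :
    partitionFn P (m + 1) x y =
      ∑ j, stepWeight x y j * partitionFn (fun l => P (j :: l)) m x y := by
  classical
  unfold partitionFn
  simp_rw [Finset.mul_sum]
  rw [← Fintype.sum_prod_type']
  symm
  refine Fintype.sum_bijective (fun q : Step × List.Vector Step m => List.Vector.cons q.1 q.2)
    ⟨?_, ?_⟩ _ _ ?_
  · rintro ⟨i, u⟩ ⟨j, v⟩ h
    have h1 := congrArg List.Vector.toList h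
    simp only [List.Vector.toList_cons, List.cons.injEq] at h1
    exact Prod.ext h1.1 (List.Vector.toList_injective h1.2)
  · intro v
    exact ⟨(v.head, v.tail), List.Vector.cons_head_tail v⟩
  · rintro ⟨j, v⟩
    simp only [List.Vector.toList_cons]
    split_ifs
    · rw [xEnd_cons, yEnd_cons, zpow_add₀ hx, zpow_add₀ hy, stepWeight]; ring
    · exact mul_zero _

lemma partitionFn_succ_concat (P : List Step → Prop) (m : ℕ) {x y : ℝ} (hx : x ≠ 0) (hy : y ≠ 0) :
    partitionFn P (m + 1) x y =
      ∑ j, stepWeight x y j * partitionFn (fun l => P (l ++ [j])) m x y := by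
  classical
  unfold partitionFn
  simp_rw [Finset.mul_sum]
  rw [← Fintype.sum_prod_type']
  symm
  let f : Step × List.Vector Step m → List.Vector Step (m + 1) :=
    fun q => ⟨q.2.toList ++ [q.1], by simp⟩
  have hf : ∀ q, (f q).toList = q.2.toList ++ [q.1] := fun _ => rfl
  refine Fintype.sum_bijective f ⟨?_, ?_⟩ _ _ ?_
  · rintro ⟨i, u⟩ ⟨j, v⟩ h
    have h1 := congrArg List.Vector.toList h
    have h2 := List.append_inj' h1 rfl
    simp only [List.cons.injEq, and_true] at h2
    exact Prod.ext h2.2 (List.Vector.toList_injective h2.1)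
  · rintro ⟨l, hl⟩
    have hne : l ≠ [] := by rintro rfl; simp at hl
    refine ⟨(l.getLast hne, ⟨l.dropLast, by simp [hl]⟩), Subtype.ext ?_⟩
    exact List.dropLast_append_getLast hne
  · rintro ⟨j, v⟩
    simp only [hf]
    split_ifs
    · rw [xEnd_concat, yEnd_concat, zpow_add₀ hx, zpow_add₀ hy, stepWeight]; ring
    · exact mul_zero _

/-! ### First-passage walks -/

/-- Walks starting with `j` and containing exactly one `θ` step, their last. -/
def FirstPassage (R : Rule) (θ j : Step) (l : List Step) : Prop :=
  SingleLast R θ l ∧ l.head? = some j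

lemma firstPassage_self_cons (R : Rule) (θ : Step) (l : List Step) :
    FirstPassage R θ θ (θ :: l) ↔ l = [] := by
  constructor
  · rintro ⟨⟨-, h2, h3⟩, -⟩
    by_contra hl
    have h4 : θ ∉ l := List.count_eq_zero.1 (by simpa using h2)
    rw [List.getLast?_cons, List.getLast?_eq_some_getLast hl] at h3
    simp only [Option.getD_some, Option.some.injEq] at h3
    exact h4 (h3 ▸ List.getLast_mem hl)
  · rintro rfl
    simp [FirstPassage, SingleLast, IsWalk]

lemma firstPassage_cons (R : Rule) {θ j : Step} (h : j ≠ θ) (l : List Step) :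
    FirstPassage R θ j (j :: l) ↔ ∃ k, R j k = true ∧ FirstPassage R θ k l := by
  cases l with
  | nil => simp [FirstPassage, SingleLast, IsWalk, h]
  | cons k l =>
    simp [FirstPassage, SingleLast, IsWalk, List.isChain_cons_cons, h, and_assoc]

/-- Partition function of first-passage walks. -/
noncomputable def firstPassageFn (R : Rule) (θ j : Step) (m : ℕ) (x y : ℝ) : ℝ :=
  partitionFn (FirstPassage R θ j) m x y

lemma firstPassageFn_nonneg (R : Rule) (θ j : Step) (m : ℕ) {x y : ℝ} (hx : 0 < x) (hy : 0 < y) :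
    0 ≤ firstPassageFn R θ j m x y := partitionFn_nonneg _ _ hx hy

lemma firstPassageFn_zero (R : Rule) (θ j : Step) (x y : ℝ) : firstPassageFn R θ j 0 x y = 0 := by
  classical
  rw [firstPassageFn, partitionFn_zero, if_neg]
  simp [FirstPassage]

lemma partitionFn_exists_head (R : Rule) (θ : Step) (p : Step → Prop) [DecidablePred p] (m : ℕ)
    (x y : ℝ) : partitionFn (fun l => ∃ k, p k ∧ FirstPassage R θ k l) m x y =
      ∑ k, if p k then firstPassageFn R θ k m x y else 0 := by
  rw [partitionFn_eq_sum _ List.head? (by rintro l - ⟨k, -, -, hk⟩; exact ⟨k, hk⟩)]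
  refine Finset.sum_congr rfl fun k _ => ?_
  rw [firstPassageFn, ← partitionFn_const_and]
  refine partitionFn_congr (fun l _ => ⟨?_, ?_⟩) x y
  · rintro ⟨⟨k', h1, h2⟩, h3⟩
    have : k' = k := by have := h2.2; rw [h3] at this; exact (Option.some.inj this).symm
    exact this ▸ ⟨h1, h2⟩
  · rintro ⟨h1, h2⟩
    exact ⟨⟨k, h1, h2⟩, h2.2⟩

lemma firstPassageFn_succ_self (R : Rule) (θ : Step) (m : ℕ) {x y : ℝ} (hx : x ≠ 0) (hy : y ≠ 0) :
    firstPassageFn R θ θ (m + 1) x y = if m = 0 then stepWeight x y θ else 0 := by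
  classical
  rw [firstPassageFn, partitionFn_succ_cons _ _ hx hy, Fintype.sum_eq_single θ]
  · rw [partitionFn_congr (fun l _ => firstPassage_self_cons R θ l)]
    cases m with
    | zero => rw [partitionFn_zero]; simp
    | succ m =>
      have : partitionFn (fun l => l = []) (m + 1) x y = 0 := by
        unfold partitionFn
        refine Finset.sum_eq_zero fun v _ => if_neg fun h => ?_
        have := v.toList_length
        rw [h] at this
        simp at this
      simp [this]
  · intro j hj
    have : partitionFn (fun l => FirstPassage R θ θ (j :: l)) m x y = 0 := by
      unfold partitionFn
      refine Finset.sum_eq_zero fun v _ => if_neg fun h => hj ?_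
      simpa using h.2
    rw [this, mul_zero]

lemma firstPassageFn_succ (R : Rule) {θ j : Step} (h : j ≠ θ) (m : ℕ) {x y : ℝ} (hx : x ≠ 0)
    (hy : y ≠ 0) : firstPassageFn R θ j (m + 1) x y =
      stepWeight x y j * ∑ k, transferReal R j k * firstPassageFn R θ k m x y := by
  classical
  rw [firstPassageFn, partitionFn_succ_cons _ _ hx hy, Fintype.sum_eq_single j]
  · rw [partitionFn_congr (fun l _ => firstPassage_cons R h l), partitionFn_exists_head]
    simp [transferReal]
  · intro i hi
    have : partitionFn (fun l => FirstPassage R θ j (i :: l)) m x y = 0 := by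
      unfold partitionFn
      refine Finset.sum_eq_zero fun v _ => if_neg fun h => hi ?_
      simpa using h.2
    rw [this, mul_zero]

lemma partitionFn_B (R : Rule) (θ : Step) (m : ℕ) (x y : ℝ) :
    partitionFn (fun l => SingleLast R θ l ∧ ∃ φ, l.head? = some φ ∧ R θ φ = true) m x y =
      ∑ k, transferReal R θ k * firstPassageFn R θ k m x y := by
  rw [partitionFn_congr (P' := fun l => ∃ k, R θ k = true ∧ FirstPassage R θ k l),
    partitionFn_exists_head]
  · simp [transferReal]
  · intro l _
    simp only [FirstPassage]
    tauto

lemma partitionFn_C (R : Rule) (θ : Step) (m : ℕ) (x y : ℝ) :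
    partitionFn (fun l => SingleLast R θ l ∧ l.head? ≠ some Step.s) m x y =
      ∑ k, if k ≠ Step.s then firstPassageFn R θ k m x y else 0 := by
  rw [partitionFn_congr (P' := fun l => ∃ k, k ≠ Step.s ∧ FirstPassage R θ k l),
    partitionFn_exists_head]
  intro l _
  cases l with
  | nil => simp [FirstPassage, SingleLast, IsWalk]
  | cons k l => simp [FirstPassage, and_comm]

/-! ### Half-plane walks -/

/-- The empty walk, and the half-plane walks that may be followed by a `j` step. -/
def HalfPlanePrefix (R : Rule) (j : Step) (l : List Step) : Prop :=
  l = [] ∨ ∃ i, HalfPlaneWalk R i l ∧ R i j = true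

/-- Partition function of the half-plane walks that may be followed by a `j` step. -/
noncomputable def halfPrefix (R : Rule) (j : Step) (m : ℕ) (x y : ℝ) : ℝ :=
  partitionFn (HalfPlanePrefix R j) m x y

/-- Partition function of the half-plane walks that end on the boundary and may be followed by a
south step. -/
noncomputable def boundaryFn (R : Rule) (m : ℕ) (x y : ℝ) : ℝ :=
  partitionFn (fun l => HalfPlanePrefix R Step.s l ∧ yEnd l = 0) m x y

lemma HalfPlanePrefix.yEnd_nonneg {R : Rule} {j : Step} {l : List Step}
    (h : HalfPlanePrefix R j l) : 0 ≤ yEnd l := by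
  rcases h with rfl | ⟨i, h, -⟩
  · simp [yEnd]
  · exact h.2.2 l List.prefix_rfl

lemma halfPlaneWalk_concat (R : Rule) (i j : Step) (l : List Step) :
    HalfPlaneWalk R j (l ++ [i]) ↔ i = j ∧ HalfPlanePrefix R j l ∧ 0 ≤ yEnd (l ++ [i]) := by
  have hpre : (∀ p : List Step, p <+: l ++ [i] → 0 ≤ yEnd p) ↔
      (∀ p : List Step, p <+: l → 0 ≤ yEnd p) ∧ 0 ≤ yEnd (l ++ [i]) := by
    constructor
    · exact fun h => ⟨fun p hp => h p (hp.trans (List.prefix_append _ _)), h _ List.prefix_rfl⟩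
    · rintro ⟨h1, h2⟩ p hp
      rcases List.prefix_concat_iff.1 hp with rfl | hp
      · exact h2
      · exact h1 p hp
  rcases List.eq_nil_or_concat l with rfl | ⟨l', k, rfl⟩
  · simp only [HalfPlaneWalk, HalfPlanePrefix, hpre]
    simp [IsWalk, yEnd]
  · simp only [HalfPlaneWalk, HalfPlanePrefix, hpre, IsWalk]
    simp [List.isChain_append]
    aesop

/-- Only a south step can leave the half plane, and it does so exactly when taken from height 0. -/
lemma halfPartition_succ (R : Rule) (j : Step) (m : ℕ) {x y : ℝ} (hx : x ≠ 0) (hy : y ≠ 0) :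
    halfPartition R j (m + 1) x y = stepWeight x y j *
      (halfPrefix R j m x y - if j = Step.s then boundaryFn R m x y else 0) := by
  classical
  rw [halfPartition, partitionFn_succ_concat _ _ hx hy, Fintype.sum_eq_single j]
  · congr 1
    by_cases hj : j = Step.s
    · subst hj
      rw [if_pos rfl, eq_sub_iff_add_eq', halfPrefix, boundaryFn,
        ← partitionFn_and_add_and_not (HalfPlanePrefix R Step.s) (fun l => yEnd l = 0)]
      congr 1
      refine partitionFn_congr (fun l _ => ?_) x y
      rw [halfPlaneWalk_concat, yEnd_concat]
      simp only [Step.dy, true_and]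
      refine and_congr_right fun hl => ?_
      have := hl.yEnd_nonneg
      omega
    · rw [if_neg hj, sub_zero]
      refine partitionFn_congr (fun l _ => ?_) x y
      rw [halfPlaneWalk_concat, yEnd_concat]
      simp only [true_and, and_iff_left_iff_imp]
      intro hl
      have hd : 0 ≤ j.dy := by cases j <;> simp_all [Step.dy]
      exact add_nonneg hd hl.yEnd_nonneg
  · intro i hi
    have : partitionFn (fun l => HalfPlaneWalk R j (l ++ [i])) m x y = 0 := by
      unfold partitionFn
      refine Finset.sum_eq_zero fun v _ => if_neg fun h => hi ?_
      exact ((halfPlaneWalk_concat _ _ _ _).1 h).1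
    rw [this, mul_zero]

lemma halfPrefix_succ (R : Rule) (j : Step) (m : ℕ) (x y : ℝ) :
    halfPrefix R j (m + 1) x y = ∑ i, halfPartition R i (m + 1) x y * transferReal R i j := by
  classical
  rw [halfPrefix, partitionFn_eq_sum _ List.getLast?]
  · refine Finset.sum_congr rfl fun i _ => ?_
    have : halfPartition R i (m + 1) x y * transferReal R i j =
        if R i j = true then halfPartition R i (m + 1) x y else 0 := by simp [transferReal]
    rw [this, halfPartition, ← partitionFn_const_and]
    refine partitionFn_congr (fun l hl => ⟨?_, ?_⟩) x y
    · rintro ⟨h1 | ⟨i', h1, h2⟩, h3⟩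
      · simp [h1] at hl
      · have : i' = i := by have := h1.2.1; rw [h3] at this; exact (Option.some.inj this).symm
        exact this ▸ ⟨h2, h1⟩
    · rintro ⟨h1, h2⟩
      exact ⟨Or.inr ⟨i, h2, h1⟩, h2.2.1⟩
  · rintro l hl -
    have hne : l ≠ [] := by rintro rfl; simp at hl
    exact ⟨_, List.getLast?_eq_some_getLast hne⟩

lemma halfPrefix_zero (R : Rule) (j : Step) (x y : ℝ) : halfPrefix R j 0 x y = 1 := by
  classical
  rw [halfPrefix, partitionFn_zero]
  exact if_pos (Or.inl rfl)

lemma halfPartition_zero (R : Rule) (j : Step) (x y : ℝ) : halfPartition R j 0 x y = 0 := by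
  classical
  rw [halfPartition, partitionFn_zero, if_neg]
  simp [HalfPlaneWalk, IsWalk]

/-- Boundary walks have height 0. This freedom in y is what the kernel method exploits: the same
boundary series appears at (τ, t) and on the lower branch. -/
lemma boundaryFn_eq (R : Rule) (m : ℕ) (x y y' : ℝ) : boundaryFn R m x y = boundaryFn R m x y' := by
  unfold boundaryFn partitionFn
  refine Finset.sum_congr rfl fun v _ => ?_
  split_ifs with h
  · rw [h.2]; simp
  · rfl

lemma boundaryFn_nonneg (R : Rule) (m : ℕ) {x y : ℝ} (hx : 0 < x) : 0 ≤ boundaryFn R m x y := by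
  rw [boundaryFn_eq R m x y 1]
  exact partitionFn_nonneg _ _ hx one_pos

lemma halfPrefix_nonneg (R : Rule) (j : Step) (m : ℕ) {x y : ℝ} (hx : 0 < x) (hy : 0 < y) :
    0 ≤ halfPrefix R j m x y := partitionFn_nonneg _ _ hx hy

lemma halfPrefix_mono (R : Rule) (j : Step) (m : ℕ) {x y y' : ℝ} (hx : 0 < x) (hy : 0 < y)
    (h : y ≤ y') : halfPrefix R j m x y ≤ halfPrefix R j m x y' := by
  unfold halfPrefix partitionFn
  refine Finset.sum_le_sum fun v _ => ?_
  split_ifs with hv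
  · refine mul_le_mul_of_nonneg_left ?_ (zpow_pos hx _).le
    obtain ⟨b, hb⟩ := Int.eq_ofNat_of_zero_le hv.yEnd_nonneg
    rw [hb]
    simp only [zpow_natCast]
    exact pow_le_pow_left₀ hy.le h b
  · exact le_rfl

end TwoStep

namespace TwoStep

instance : Nonempty Step := ⟨Step.e⟩

section FirstPassageGF

open scoped Matrix

/-! ### Generating functions of first-passage walks -/

/-- The weighted transfer matrix. -/
noncomputable def weightMatrix (R : Rule) (x y : ℝ) : Matrix Step Step ℝ :=
  Matrix.of fun i j => stepWeight x y i * transferReal R i j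

/-- The weighted transfer matrix times `t`, with the row of `θ` deleted. -/
noncomputable def killedMatrix (R : Rule) (θ : Step) (t x y : ℝ) : Matrix Step Step ℝ :=
  Matrix.of fun i j => if i = θ then 0 else t * (stepWeight x y i * transferReal R i j)

/-- The generating function of the walks from `j` to the first `θ` step. -/
noncomputable def firstPassageGF (R : Rule) (θ j : Step) (t x y : ℝ) : ℝ :=
  genFun (FirstPassage R θ j) t x y

lemma firstPassageGF_eq (R : Rule) (θ j : Step) (t x y : ℝ) :
    firstPassageGF R θ j t x y = ∑' m, firstPassageFn R θ j m x y * t ^ m := rfl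

lemma D_eq (R : Rule) (θ : Step) (t x y : ℝ) : D R θ t x y = firstPassageGF R θ Step.s t x y := rfl

lemma weightMatrix_nonneg (R : Rule) {x y : ℝ} (hx : 0 < x) (hy : 0 < y) (i j : Step) :
    0 ≤ weightMatrix R x y i j :=
  mul_nonneg (stepWeight_pos hx hy i).le (transferReal_nonneg R i j)

lemma killedMatrix_nonneg (R : Rule) (θ : Step) {t x y : ℝ} (ht : 0 < t) (hx : 0 < x) (hy : 0 < y)
    (i j : Step) : 0 ≤ killedMatrix R θ t x y i j := by
  simp only [killedMatrix, Matrix.of_apply]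
  split_ifs
  · exact le_rfl
  · exact mul_nonneg ht.le (mul_nonneg (stepWeight_pos hx hy i).le (transferReal_nonneg R i j))

lemma weightMatrix_pow_pos {R : Rule} {k : ℕ} (hk : ∀ i j : Step, 0 < (transferMatrix R ^ k) i j)
    {x y : ℝ} (hx : 0 < x) (hy : 0 < y) (i j : Step) : 0 < (weightMatrix R x y ^ k) i j := by
  obtain ⟨i₀, hi₀⟩ := Finite.exists_min fun i => stepWeight x y i
  set c := stepWeight x y i₀
  have hc : 0 < c := stepWeight_pos hx hy i₀
  set T : Matrix Step Step ℝ := (Nat.castRingHom ℝ).mapMatrix (transferMatrix R) with hT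
  have hTij : ∀ i j, T i j = transferReal R i j := by
    intro i j
    simp [hT, transferMatrix, transferReal]
  have hTk : 0 < (T ^ k) i j := by
    rw [hT, ← map_pow]
    simpa using hk i j
  have hle : ((c • T) ^ k) i j ≤ (weightMatrix R x y ^ k) i j := by
    refine pow_apply_mono (fun i j => ?_) (fun i j => ?_) k i j
    · rw [Matrix.smul_apply, hTij, smul_eq_mul]
      exact mul_nonneg hc.le (transferReal_nonneg R i j)
    · rw [Matrix.smul_apply, hTij, smul_eq_mul]
      exact mul_le_mul_of_nonneg_right (hi₀ i) (transferReal_nonneg R i j)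
  refine lt_of_lt_of_le ?_ hle
  rw [smul_pow, Matrix.smul_apply, smul_eq_mul]
  exact mul_pos (pow_pos hc k) hTk

lemma hasSum_firstPassageFn_self (R : Rule) (θ : Step) (t : ℝ) {x y : ℝ} (hx : x ≠ 0) (hy : y ≠ 0) :
    HasSum (fun m => firstPassageFn R θ θ m x y * t ^ m) (t * stepWeight x y θ) := by
  have h := hasSum_single (f := fun m => firstPassageFn R θ θ m x y * t ^ m) 1 (by
    intro m hm
    cases m with
    | zero => simp [firstPassageFn_zero]
    | succ m => simp [firstPassageFn_succ_self R θ m hx hy, (by simpa using hm : m ≠ 0)])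
  simp only [firstPassageFn_succ_self R θ 0 hx hy, if_true, pow_one] at h
  rwa [mul_comm] at h

/-- A positive supersolution g of the killed matrix dominates the partial sums, by induction on
their length; the factor c makes c g match the source in the row of `θ`. -/
lemma summable_firstPassageFn {R : Rule} {θ : Step} {t x y : ℝ} (ht : 0 < t) (hx : 0 < x)
    (hy : 0 < y) {g : Step → ℝ} (hg : ∀ i, 0 < g i)
    (h : ∀ i, (killedMatrix R θ t x y *ᵥ g) i ≤ g i) (j : Step) :
    Summable fun m => firstPassageFn R θ j m x y * t ^ m := by
  have hnn : ∀ j m, 0 ≤ firstPassageFn R θ j m x y * t ^ m := fun j m =>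
    mul_nonneg (firstPassageFn_nonneg R θ j m hx hy) (pow_nonneg ht.le m)
  set c := t * stepWeight x y θ / g θ with hc
  have hc0 : 0 ≤ c := div_nonneg (mul_nonneg ht.le (stepWeight_pos hx hy θ).le) (hg θ).le
  have hb : ∀ N j, ∑ m ∈ Finset.range N, firstPassageFn R θ j m x y * t ^ m ≤ c * g j := by
    intro N
    induction N with
    | zero => intro j; simpa using mul_nonneg hc0 (hg j).le
    | succ N ih =>
      intro j
      by_cases hj : j = θ
      · subst hj
        have h1 := hasSum_firstPassageFn_self R j t hx.ne' hy.ne'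
        refine (sum_le_hasSum _ (fun m _ => hnn j m) h1).trans (le_of_eq ?_)
        rw [hc, div_mul_cancel₀ _ (hg j).ne']
      · rw [Finset.sum_range_succ', firstPassageFn_zero, zero_mul, add_zero]
        calc _ = ∑ k, killedMatrix R θ t x y j k *
              ∑ m ∈ Finset.range N, firstPassageFn R θ k m x y * t ^ m := by
              simp_rw [Finset.mul_sum]
              rw [Finset.sum_comm]
              refine Finset.sum_congr rfl fun m _ => ?_
              rw [firstPassageFn_succ R hj m hx.ne' hy.ne', Finset.mul_sum, Finset.sum_mul]
              refine Finset.sum_congr rfl fun k _ => ?_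
              simp only [killedMatrix, Matrix.of_apply, if_neg hj]
              ring
          _ ≤ ∑ k, killedMatrix R θ t x y j k * (c * g k) :=
              Finset.sum_le_sum fun k _ =>
                mul_le_mul_of_nonneg_left (ih k) (killedMatrix_nonneg R θ ht hx hy j k)
          _ = c * (killedMatrix R θ t x y *ᵥ g) j := by
              simp only [Matrix.mulVec, dotProduct, Finset.mul_sum]
              exact Finset.sum_congr rfl fun k _ => by ring
          _ ≤ c * g j := mul_le_mul_of_nonneg_left (h j) hc0
  exact summable_of_sum_range_le (hnn j) (hb · j)

lemma firstPassageGF_self (R : Rule) (θ : Step) (t : ℝ) {x y : ℝ} (hx : x ≠ 0) (hy : y ≠ 0) :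
    firstPassageGF R θ θ t x y = t * stepWeight x y θ :=
  (hasSum_firstPassageFn_self R θ t hx hy).tsum_eq

section Summable

variable {R : Rule} {θ : Step} {t x y : ℝ}

lemma firstPassageGF_of_ne (hx : x ≠ 0) (hy : y ≠ 0)
    (hs : ∀ k, Summable fun m => firstPassageFn R θ k m x y * t ^ m) {j : Step} (hj : j ≠ θ) :
    firstPassageGF R θ j t x y =
      t * (stepWeight x y j * ∑ k, transferReal R j k * firstPassageGF R θ k t x y) := by
  simp only [firstPassageGF_eq]
  rw [(hs j).tsum_eq_zero_add, firstPassageFn_zero, zero_mul, zero_add]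
  simp_rw [← tsum_mul_left]
  rw [← Summable.tsum_finsetSum fun k _ => (hs k).mul_left _, ← tsum_mul_left, ← tsum_mul_left]
  refine tsum_congr fun m => ?_
  rw [firstPassageFn_succ R hj m hx hy, Finset.mul_sum, Finset.sum_mul, Finset.mul_sum,
    Finset.mul_sum]
  exact Finset.sum_congr rfl fun k _ => by ring

lemma B_eq_sum (hs : ∀ k, Summable fun m => firstPassageFn R θ k m x y * t ^ m) :
    B R θ t x y = ∑ k, transferReal R θ k * firstPassageGF R θ k t x y := by
  simp only [B, genFun, partitionFn_B, firstPassageGF_eq]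
  simp_rw [← tsum_mul_left]
  rw [← Summable.tsum_finsetSum fun k _ => (hs k).mul_left _]
  refine tsum_congr fun m => ?_
  rw [Finset.sum_mul]
  exact Finset.sum_congr rfl fun k _ => by ring

lemma C_eq_sum (hs : ∀ k, Summable fun m => firstPassageFn R θ k m x y * t ^ m) :
    C R θ t x y = ∑ k, if k ≠ Step.s then firstPassageGF R θ k t x y else 0 := by
  simp only [C, genFun, partitionFn_C, firstPassageGF_eq]
  simp_rw [Finset.sum_mul]
  rw [Summable.tsum_finsetSum]
  · refine Finset.sum_congr rfl fun k _ => ?_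
    split_ifs <;> simp
  · intro k _
    split_ifs
    · exact hs k
    · simp

/-- The first-passage vector as an eigenvector with defect. -/
lemma firstPassageGF_eigen (hx : x ≠ 0) (hy : y ≠ 0)
    (hs : ∀ k, Summable fun m => firstPassageFn R θ k m x y * t ^ m) (j : Step) :
    firstPassageGF R θ j t x y =
      t * (weightMatrix R x y *ᵥ fun k => firstPassageGF R θ k t x y) j +
        if j = θ then t * stepWeight x y θ * (1 - B R θ t x y) else 0 := by
  have h1 : (weightMatrix R x y *ᵥ fun k => firstPassageGF R θ k t x y) j =
      stepWeight x y j * ∑ k, transferReal R j k * firstPassageGF R θ k t x y := by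
    simp only [Matrix.mulVec, dotProduct, weightMatrix, Matrix.of_apply, Finset.mul_sum, mul_assoc]
  rw [h1]
  by_cases hj : j = θ
  · subst hj
    rw [if_pos rfl, firstPassageGF_self R j t hx hy, ← B_eq_sum hs]
    ring
  · rw [if_neg hj, firstPassageGF_of_ne hx hy hs hj, add_zero]

end Summable

/-- Points `(y, t)` in the interior of the domain of convergence of the first-passage series. -/
def Subcritical (R : Rule) (θ : Step) (x : ℝ) (p : ℝ × ℝ) : Prop :=
  0 < p.1 ∧ 0 < p.2 ∧ ∃ g : Step → ℝ, (∀ i, 0 < g i) ∧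
    ∀ i, (killedMatrix R θ p.2 x p.1 *ᵥ g) i < g i

lemma Subcritical.summable {R : Rule} {θ : Step} {x : ℝ} {p : ℝ × ℝ} (h : Subcritical R θ x p)
    (hx : 0 < x) (j : Step) : Summable fun m => firstPassageFn R θ j m x p.1 * p.2 ^ m := by
  obtain ⟨h1, h2, g, hg, hQ⟩ := h
  exact summable_firstPassageFn h2 hx h1 hg (fun i => (hQ i).le) j

lemma contDiffAt_stepWeight (x : ℝ) (j : Step) {p : ℝ × ℝ} (hp : p.1 ≠ 0) {n : WithTop ℕ∞} :
    ContDiffAt ℝ n (fun q : ℝ × ℝ => stepWeight x q.1 j) p := by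
  unfold stepWeight
  refine contDiffAt_const.mul ?_
  cases j
  · simpa [Step.dy] using contDiffAt_const
  · simpa [Step.dy] using contDiffAt_fst
  · simpa [Step.dy] using contDiffAt_const
  · simp only [Step.dy, zpow_neg_one]
    exact contDiffAt_fst.inv hp

lemma contDiffAt_killedMatrix (R : Rule) (θ : Step) (x : ℝ) (i j : Step) {p : ℝ × ℝ}
    (hp : p.1 ≠ 0) {n : WithTop ℕ∞} :
    ContDiffAt ℝ n (fun q : ℝ × ℝ => killedMatrix R θ q.2 x q.1 i j) p := by
  simp only [killedMatrix, Matrix.of_apply]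
  split_ifs
  · exact contDiffAt_const
  · exact contDiffAt_snd.mul ((contDiffAt_stepWeight x i hp).mul contDiffAt_const)

/-- The same g works nearby, as finitely many strict inequalities are an open condition. -/
lemma Subcritical.eventually {R : Rule} {θ : Step} {x : ℝ} {p : ℝ × ℝ} (h : Subcritical R θ x p) :
    ∀ᶠ q in 𝓝 p, Subcritical R θ x q := by
  obtain ⟨h1, h2, g, hg, hQ⟩ := h
  have hc : ∀ i, ∀ᶠ q : ℝ × ℝ in 𝓝 p, (killedMatrix R θ q.2 x q.1 *ᵥ g) i < g i := by
    intro i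
    have h3 : ContDiffAt ℝ 0 (fun q : ℝ × ℝ => (killedMatrix R θ q.2 x q.1 *ᵥ g) i) p := by
      simp only [Matrix.mulVec, dotProduct]
      exact ContDiffAt.sum fun j _ => (contDiffAt_killedMatrix R θ x i j h1.ne').mul contDiffAt_const
    exact h3.continuousAt.eventually (gt_mem_nhds (hQ i))
  filter_upwards [continuousAt_fst.eventually (lt_mem_nhds h1),
    continuousAt_snd.eventually (lt_mem_nhds h2), eventually_all.2 hc] with q hq1 hq2 hq3
  exact ⟨hq1, hq2, g, hg, hq3⟩

lemma contDiffAt_det {ι E : Type*} [Fintype ι] [DecidableEq ι] [NormedAddCommGroup E]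
    [NormedSpace ℝ E] {A : E → Matrix ι ι ℝ} {p : E} {n : WithTop ℕ∞}
    (h : ∀ i j, ContDiffAt ℝ n (fun q => A q i j) p) : ContDiffAt ℝ n (fun q => (A q).det) p := by
  simp only [Matrix.det_apply']
  exact ContDiffAt.sum fun σ _ => contDiffAt_const.mul (contDiffAt_prod fun i _ => h _ _)

lemma Subcritical.killed_eq {R : Rule} {θ : Step} {x : ℝ} {p : ℝ × ℝ} (h : Subcritical R θ x p)
    (hx : 0 < x) : (1 - killedMatrix R θ p.2 x p.1) *ᵥ (fun j => firstPassageGF R θ j p.2 x p.1) =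
      fun j => if j = θ then p.2 * stepWeight x p.1 θ else 0 := by
  have hs := h.summable hx
  funext j
  rw [Matrix.sub_mulVec, Matrix.one_mulVec, Pi.sub_apply]
  by_cases hj : j = θ
  · subst hj
    simp [Matrix.mulVec, dotProduct, killedMatrix, firstPassageGF_self R j p.2 hx.ne' h.1.ne']
  · rw [firstPassageGF_of_ne hx.ne' h.1.ne' hs hj, if_neg hj]
    simp only [Matrix.mulVec, dotProduct, killedMatrix, Matrix.of_apply, if_neg hj, Finset.mul_sum]
    rw [sub_eq_zero]
    exact Finset.sum_congr rfl fun k _ => by ring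

lemma Subcritical.det_ne_zero {R : Rule} {θ : Step} {x : ℝ} {p : ℝ × ℝ} (h : Subcritical R θ x p)
    (hx : 0 < x) : (1 - killedMatrix R θ p.2 x p.1).det ≠ 0 := by
  obtain ⟨h1, h2, g, hg, hQ⟩ := h
  exact det_one_sub_ne_zero (killedMatrix_nonneg R θ h2 hx h1) hg hQ

/-- Cramer's rule writes the series as a quotient of determinants with smooth entries and
nonvanishing denominator, so nothing is differentiated term by term. -/
lemma Subcritical.contDiffAt_firstPassageGF {R : Rule} {θ : Step} {x : ℝ} {p : ℝ × ℝ}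
    (h : Subcritical R θ x p) (hx : 0 < x) (j : Step) {n : WithTop ℕ∞} :
    ContDiffAt ℝ n (fun q : ℝ × ℝ => firstPassageGF R θ j q.2 x q.1) p := by
  have hA : ∀ i k, ContDiffAt ℝ n (fun q : ℝ × ℝ => (1 - killedMatrix R θ q.2 x q.1) i k) p :=
    fun i k => contDiffAt_const.sub (contDiffAt_killedMatrix R θ x i k h.1.ne')
  have hb : ∀ i, ContDiffAt ℝ n
      (fun q : ℝ × ℝ => if i = θ then q.2 * stepWeight x q.1 θ else 0) p := by
    intro i
    split_ifs
    · exact contDiffAt_snd.mul (contDiffAt_stepWeight x θ h.1.ne')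
    · exact contDiffAt_const
  have hnum : ContDiffAt ℝ n (fun q : ℝ × ℝ => ((1 - killedMatrix R θ q.2 x q.1).updateCol j
      fun i => if i = θ then q.2 * stepWeight x q.1 θ else 0).det) p := by
    refine contDiffAt_det fun i k => ?_
    simp only [Matrix.updateCol_apply]
    split_ifs with hk h1
    · simpa [h1] using hb θ
    · exact contDiffAt_const
    · exact hA i k
  refine (hnum.div (contDiffAt_det hA) (h.det_ne_zero hx)).congr_of_eventuallyEq ?_
  filter_upwards [h.eventually] with q hq
  rw [Pi.div_apply, eq_div_iff (hq.det_ne_zero hx), ← hq.killed_eq hx, ← Matrix.cramer_apply,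
    Matrix.cramer_eq_adjugate_mulVec, Matrix.mulVec_mulVec, Matrix.adjugate_mul, Matrix.smul_mulVec,
    Matrix.one_mulVec, Pi.smul_apply, smul_eq_mul, mul_comm]

lemma Subcritical.contDiffAt_B {R : Rule} {θ : Step} {x : ℝ} {p : ℝ × ℝ}
    (h : Subcritical R θ x p) (hx : 0 < x) {n : WithTop ℕ∞} :
    ContDiffAt ℝ n (fun q : ℝ × ℝ => B R θ q.2 x q.1) p := by
  refine ContDiffAt.congr_of_eventuallyEq (ContDiffAt.sum fun k (_ : k ∈ Finset.univ) =>
    (contDiffAt_const (c := transferReal R θ k)).mul (h.contDiffAt_firstPassageGF hx k)) ?_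
  filter_upwards [h.eventually] with q hq
  exact B_eq_sum (hq.summable hx)

lemma Subcritical.contDiffAt_C {R : Rule} {θ : Step} {x : ℝ} {p : ℝ × ℝ}
    (h : Subcritical R θ x p) (hx : 0 < x) {n : WithTop ℕ∞} :
    ContDiffAt ℝ n (fun q : ℝ × ℝ => C R θ q.2 x q.1) p := by
  have h1 : ∀ k, ContDiffAt ℝ n (fun q : ℝ × ℝ =>
      if k ≠ Step.s then firstPassageGF R θ k q.2 x q.1 else 0) p := by
    intro k
    split_ifs
    · exact h.contDiffAt_firstPassageGF hx k
    · exact contDiffAt_const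
  refine ContDiffAt.congr_of_eventuallyEq (ContDiffAt.sum fun k (_ : k ∈ Finset.univ) => h1 k) ?_
  filter_upwards [h.eventually] with q hq
  exact C_eq_sum (hq.summable hx)

/-! ### The Perron root -/

section Perron

variable {R : Rule} {k : ℕ} {x y t : ℝ} {r : Step → ℝ}

lemma smul_weightMatrix_mulVec (ht : 0 < t) (h : weightMatrix R x y *ᵥ r = t⁻¹ • r) :
    (t • weightMatrix R x y) *ᵥ r = r := by
  rw [Matrix.smul_mulVec, h, smul_smul, mul_inv_cancel₀ ht.ne', one_smul]

lemma smul_weightMatrix_pow_pos (hk : ∀ i j : Step, 0 < (transferMatrix R ^ k) i j) (hx : 0 < x)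
    (hy : 0 < y) (ht : 0 < t) (i j : Step) : 0 < ((t • weightMatrix R x y) ^ k) i j := by
  rw [smul_pow, Matrix.smul_apply, smul_eq_mul]
  exact mul_pos (pow_pos ht k) (weightMatrix_pow_pos hk hx hy i j)

lemma smul_weightMatrix_nonneg (hx : 0 < x) (hy : 0 < y) (ht : 0 < t) (i j : Step) :
    0 ≤ (t • weightMatrix R x y) i j :=
  mul_nonneg ht.le (weightMatrix_nonneg R hx hy i j)

lemma subcritical_of_eigenvector (hk1 : 1 ≤ k)
    (hk : ∀ i j : Step, 0 < (transferMatrix R ^ k) i j) (hx : 0 < x) (hy : 0 < y) (ht : 0 < t)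
    (hr : ∀ i, 0 < r i) (h : weightMatrix R x y *ᵥ r = t⁻¹ • r) (θ : Step) :
    Subcritical R θ x (y, t) := by
  refine ⟨hy, ht, ?_⟩
  refine exists_strict_supersolution (smul_weightMatrix_nonneg hx hy ht) hk1
    (smul_weightMatrix_pow_pos hk hx hy ht) hr (smul_weightMatrix_mulVec ht h) (θ := θ) ?_ ?_
  · intro j; simp [killedMatrix]
  · intro i hi j; simp [killedMatrix, hi, weightMatrix]

/-- The first-passage vector and the rescaled eigenvector solve the same killed linear system, and
its solution is unique. -/
lemma firstPassageGF_eq_of_eigenvector (hk1 : 1 ≤ k)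
    (hk : ∀ i j : Step, 0 < (transferMatrix R ^ k) i j) (hx : 0 < x) (hy : 0 < y) (ht : 0 < t)
    (hr : ∀ i, 0 < r i) (h : weightMatrix R x y *ᵥ r = t⁻¹ • r) (θ j : Step) :
    firstPassageGF R θ j t x y = t * stepWeight x y θ / r θ * r j := by
  have hsub := subcritical_of_eigenvector hk1 hk hx hy ht hr h θ
  have h1 := hsub.killed_eq hx
  obtain ⟨-, -, g, hg, hQ⟩ := id hsub
  have h2 : (fun j => firstPassageGF R θ j t x y) - (t * stepWeight x y θ / r θ) • r = 0 := by
    refine eq_zero_of_mulVec_eq_self (killedMatrix_nonneg R θ ht hx hy) hg hQ ?_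
    have h3 : (1 - killedMatrix R θ t x y) *ᵥ ((t * stepWeight x y θ / r θ) • r) =
        fun j => if j = θ then t * stepWeight x y θ else 0 := by
      funext i
      have h4 := congrFun (smul_weightMatrix_mulVec ht h) i
      rw [Matrix.mulVec_smul, Matrix.sub_mulVec, Matrix.one_mulVec]
      simp only [Pi.smul_apply, Pi.sub_apply, smul_eq_mul]
      by_cases hi : i = θ
      · subst hi
        simp [Matrix.mulVec, dotProduct, killedMatrix, (hr i).ne']
      · rw [if_neg hi]
        refine mul_eq_zero_of_right _ (sub_eq_zero.2 ?_)
        nth_rewrite 1 [← h4]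
        simp only [Matrix.mulVec, dotProduct, killedMatrix, Matrix.of_apply, if_neg hi,
          weightMatrix, Matrix.smul_apply, smul_eq_mul]
    have h5 := h1.trans h3.symm
    rw [← sub_eq_zero, ← Matrix.mulVec_sub, Matrix.sub_mulVec, Matrix.one_mulVec, sub_eq_zero] at h5
    exact h5.symm
  have := congrFun h2 j
  simpa [sub_eq_zero] using this

/-- Proportionality to the eigenvector leaves no defect in the row of `θ`, and the defect is a
positive multiple of 1 - B. -/
lemma B_eq_one_of_eigenvector (hk1 : 1 ≤ k)
    (hk : ∀ i j : Step, 0 < (transferMatrix R ^ k) i j) (hx : 0 < x) (hy : 0 < y) (ht : 0 < t)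
    (hr : ∀ i, 0 < r i) (h : weightMatrix R x y *ᵥ r = t⁻¹ • r) (θ : Step) : B R θ t x y = 1 := by
  have hsub := subcritical_of_eigenvector hk1 hk hx hy ht hr h θ
  have h1 := firstPassageGF_eigen hx.ne' hy.ne' (hsub.summable hx) θ
  have h2 : (fun k => firstPassageGF R θ k t x y) = (t * stepWeight x y θ / r θ) • r :=
    funext fun j => firstPassageGF_eq_of_eigenvector hk1 hk hx hy ht hr h θ j
  rw [if_pos rfl, h2, Matrix.mulVec_smul, h, firstPassageGF_self R θ t hx.ne' hy.ne'] at h1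
  simp only [Pi.smul_apply, smul_eq_mul] at h1
  have hw := stepWeight_pos hx hy θ
  have h3 : t * (t * stepWeight x y θ / r θ * (t⁻¹ * r θ)) = t * stepWeight x y θ := by
    field_simp [(hr θ).ne', ht.ne']
  rw [h3] at h1
  have h4 : t * stepWeight x y θ * (1 - B R θ t x y) = 0 := by linarith
  rcases mul_eq_zero.1 h4 with h5 | h5
  · exact absurd h5 (mul_pos ht hw).ne'
  · linarith

/-- The coefficients of `B`. -/
lemma B_eq_tsum (R : Rule) (θ : Step) (t x y : ℝ) : B R θ t x y =
    ∑' m, (∑ k, transferReal R θ k * firstPassageFn R θ k m x y) * t ^ m := by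
  simp only [B, genFun, partitionFn_B]

lemma B_coeff_nonneg (R : Rule) (θ : Step) (m : ℕ) (hx : 0 < x) (hy : 0 < y) :
    0 ≤ ∑ k, transferReal R θ k * firstPassageFn R θ k m x y :=
  Finset.sum_nonneg fun k _ =>
    mul_nonneg (transferReal_nonneg R θ k) (firstPassageFn_nonneg R θ k m hx hy)

/-- A divergent `tsum` is 0 by convention, so a nonzero value certifies convergence; in particular
no spurious root of B = 1 appears beyond the radius of convergence. -/
lemma summable_of_B_ne_zero {θ : Step} (h : B R θ t x y ≠ 0) :
    Summable fun m => (∑ k, transferReal R θ k * firstPassageFn R θ k m x y) * t ^ m := by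
  by_contra hns
  rw [B_eq_tsum, tsum_eq_zero_of_not_summable hns] at h
  exact h rfl

lemma B_lt_of_lt {θ : Step} (hx : 0 < x) (hy : 0 < y) {t t' : ℝ} (ht : 0 < t) (hlt : t < t')
    (h' : B R θ t' x y ≠ 0) : B R θ t x y < B R θ t' x y := by
  have hs' := summable_of_B_ne_zero h'
  have hnn := fun m => B_coeff_nonneg R θ m hx hy
  have hle : ∀ m, (∑ k, transferReal R θ k * firstPassageFn R θ k m x y) * t ^ m ≤
      (∑ k, transferReal R θ k * firstPassageFn R θ k m x y) * t' ^ m := fun m =>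
    mul_le_mul_of_nonneg_left (pow_le_pow_left₀ ht.le hlt.le m) (hnn m)
  have hs : Summable fun m => (∑ k, transferReal R θ k * firstPassageFn R θ k m x y) * t ^ m :=
    Summable.of_nonneg_of_le (fun m => mul_nonneg (hnn m) (pow_nonneg ht.le m)) hle hs'
  obtain ⟨m, hm⟩ : ∃ m, (∑ k, transferReal R θ k * firstPassageFn R θ k m x y) ≠ 0 := by
    by_contra hcon
    push Not at hcon
    rw [B_eq_tsum] at h'
    simp [hcon] at h'
  have hm0 : m ≠ 0 := by
    rintro rfl
    simp [firstPassageFn_zero] at hm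
  rw [B_eq_tsum, B_eq_tsum]
  exact Summable.tsum_lt_tsum hle (mul_lt_mul_of_pos_left (pow_lt_pow_left₀ hlt ht.le hm0)
    (lt_of_le_of_ne (hnn m) hm.symm)) hs hs'

lemma B_root_unique {θ : Step} (hx : 0 < x) (hy : 0 < y) {t t' : ℝ} (ht : 0 < t) (ht' : 0 < t')
    (h : B R θ t x y = 1) (h' : B R θ t' x y = 1) : t = t' := by
  rcases lt_trichotomy t t' with hlt | rfl | hlt
  · have := B_lt_of_lt hx hy ht hlt (by rw [h']; exact one_ne_zero)
    linarith
  · rfl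
  · have := B_lt_of_lt hx hy ht' hlt (by rw [h]; exact one_ne_zero)
    linarith

lemma rho_eq_of_B_eq_one {θ : Step} (hx : 0 < x) (hy : 0 < y) (ht : 0 < t)
    (h : B R θ t x y = 1) : rho R θ x y = t := by
  have : {t : ℝ | 0 < t ∧ B R θ t x y = 1} = {t} := by
    ext t'
    constructor
    · rintro ⟨h1, h2⟩
      exact B_root_unique hx hy h1 ht h2 h
    · rintro rfl
      exact ⟨ht, h⟩
  rw [rho, this, csInf_singleton]

end Perron

end FirstPassageGF

end TwoStep

namespace TwoStep

/-! ### The root ρ as inverse Perron eigenvalue: regularity and derivatives -/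

section Rho

open scoped Matrix

variable {R : Rule} {k : ℕ} {x : ℝ}

/-- At `t = ρ(x,y)` the weighted transfer matrix has positive right and left eigenvectors with
eigenvalue `1 / t`. -/
lemma exists_perron (hk1 : 1 ≤ k) (hk : ∀ i j : Step, 0 < (transferMatrix R ^ k) i j) (hx : 0 < x)
    {y : ℝ} (hy : 0 < y) : ∃ t : ℝ, 0 < t ∧ (∀ θ, rho R θ x y = t) ∧
      (∃ r : Step → ℝ, (∀ i, 0 < r i) ∧ weightMatrix R x y *ᵥ r = t⁻¹ • r) ∧
      ∃ l : Step → ℝ, (∀ i, 0 < l i) ∧ l ᵥ* weightMatrix R x y = t⁻¹ • l := by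
  obtain ⟨a, ha, r, hr, har⟩ := exists_pos_eigenvector (weightMatrix_nonneg R hx hy) hk1
    (weightMatrix_pow_pos hk hx hy)
  obtain ⟨l, hl, hal⟩ := exists_pos_left_eigenvector (weightMatrix_nonneg R hx hy) hk1
    (weightMatrix_pow_pos hk hx hy) hr har
  have ha' : 0 < a⁻¹ := inv_pos.2 ha
  have har' : weightMatrix R x y *ᵥ r = (a⁻¹)⁻¹ • r := by rw [inv_inv, har]
  refine ⟨a⁻¹, ha', fun θ => rho_eq_of_B_eq_one hx hy ha' ?_, ⟨r, hr, har'⟩, l, hl, ?_⟩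
  · exact B_eq_one_of_eigenvector hk1 hk hx hy ha' hr har' θ
  · rw [inv_inv, hal]

lemma rho_eq_rho (hk1 : 1 ≤ k) (hk : ∀ i j : Step, 0 < (transferMatrix R ^ k) i j) (hx : 0 < x)
    {y : ℝ} (hy : 0 < y) (θ φ : Step) : rho R θ x y = rho R φ x y := by
  obtain ⟨t, -, h, -⟩ := exists_perron hk1 hk hx hy
  rw [h, h]

lemma rho_pos (hk1 : 1 ≤ k) (hk : ∀ i j : Step, 0 < (transferMatrix R ^ k) i j) (hx : 0 < x)
    {y : ℝ} (hy : 0 < y) (θ : Step) : 0 < rho R θ x y := by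
  obtain ⟨t, ht, h, -⟩ := exists_perron hk1 hk hx hy
  rwa [h]

lemma exists_right_eigenvector (hk1 : 1 ≤ k) (hk : ∀ i j : Step, 0 < (transferMatrix R ^ k) i j)
    (hx : 0 < x) {y : ℝ} (hy : 0 < y) (θ : Step) : ∃ r : Step → ℝ, (∀ i, 0 < r i) ∧
      weightMatrix R x y *ᵥ r = (rho R θ x y)⁻¹ • r := by
  obtain ⟨t, -, h, hr, -⟩ := exists_perron hk1 hk hx hy
  rwa [h]

lemma exists_left_eigenvector (hk1 : 1 ≤ k) (hk : ∀ i j : Step, 0 < (transferMatrix R ^ k) i j)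
    (hx : 0 < x) {y : ℝ} (hy : 0 < y) (θ : Step) : ∃ l : Step → ℝ, (∀ i, 0 < l i) ∧
      l ᵥ* weightMatrix R x y = (rho R θ x y)⁻¹ • l := by
  obtain ⟨t, -, h, -, hl⟩ := exists_perron hk1 hk hx hy
  rwa [h]

lemma B_rho (hk1 : 1 ≤ k) (hk : ∀ i j : Step, 0 < (transferMatrix R ^ k) i j) (hx : 0 < x)
    {y : ℝ} (hy : 0 < y) (θ φ : Step) : B R θ (rho R φ x y) x y = 1 := by
  obtain ⟨r, hr, har⟩ := exists_right_eigenvector hk1 hk hx hy φ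
  exact B_eq_one_of_eigenvector hk1 hk hx hy (rho_pos hk1 hk hx hy φ) hr har θ

lemma subcritical_rho (hk1 : 1 ≤ k) (hk : ∀ i j : Step, 0 < (transferMatrix R ^ k) i j) (hx : 0 < x)
    {y : ℝ} (hy : 0 < y) (θ φ : Step) : Subcritical R θ x (y, rho R φ x y) := by
  obtain ⟨r, hr, har⟩ := exists_right_eigenvector hk1 hk hx hy φ
  exact subcritical_of_eigenvector hk1 hk hx hy (rho_pos hk1 hk hx hy φ) hr har θ

lemma firstPassageGF_rho_pos (hk1 : 1 ≤ k) (hk : ∀ i j : Step, 0 < (transferMatrix R ^ k) i j)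
    (hx : 0 < x) {y : ℝ} (hy : 0 < y) (θ φ j : Step) :
    0 < firstPassageGF R θ j (rho R φ x y) x y := by
  obtain ⟨r, hr, har⟩ := exists_right_eigenvector hk1 hk hx hy φ
  have ht := rho_pos hk1 hk hx hy φ
  rw [firstPassageGF_eq_of_eigenvector hk1 hk hx hy ht hr har θ]
  exact mul_pos (div_pos (mul_pos ht (stepWeight_pos hx hy θ)) (hr θ)) (hr j)

/-- The first-passage vector at `t = ρ` is an eigenvector. -/
lemma weightMatrix_mulVec_firstPassageGF (hk1 : 1 ≤ k)
    (hk : ∀ i j : Step, 0 < (transferMatrix R ^ k) i j) (hx : 0 < x) {y : ℝ} (hy : 0 < y)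
    (θ φ : Step) : (weightMatrix R x y *ᵥ fun j => firstPassageGF R θ j (rho R φ x y) x y) =
      (rho R φ x y)⁻¹ • fun j => firstPassageGF R θ j (rho R φ x y) x y := by
  have ht := rho_pos hk1 hk hx hy φ
  funext j
  have h := firstPassageGF_eigen hx.ne' hy.ne'
    ((subcritical_rho hk1 hk hx hy θ φ).summable hx) j
  rw [B_rho hk1 hk hx hy, sub_self, mul_zero, ite_self, add_zero] at h
  simp only [Pi.smul_apply, smul_eq_mul]
  rw [eq_inv_mul_iff_mul_eq₀ ht.ne']
  exact h.symm

/-- The derivative of `B` in `t` at `ρ`, through a left eigenvector. -/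
lemma hasDerivAt_B_rho (hk1 : 1 ≤ k) (hk : ∀ i j : Step, 0 < (transferMatrix R ^ k) i j)
    (hx : 0 < x) {y : ℝ} (hy : 0 < y) (θ φ : Step) {l : Step → ℝ} (hl : ∀ i, 0 < l i)
    (hal : l ᵥ* weightMatrix R x y = (rho R φ x y)⁻¹ • l) :
    HasDerivAt (fun t => B R θ t x y)
      ((l ⬝ᵥ fun j => firstPassageGF R θ j (rho R φ x y) x y) /
        (rho R φ x y * (l θ * firstPassageGF R θ θ (rho R φ x y) x y))) (rho R φ x y) := by
  set t₀ := rho R φ x y with ht₀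
  have ht : 0 < t₀ := rho_pos hk1 hk hx hy φ
  have hsub := subcritical_rho hk1 hk hx hy θ φ
  set w := stepWeight x y θ with hw
  have hw0 : 0 < w := stepWeight_pos hx hy θ
  have hd : DifferentiableAt ℝ (fun t => (l ⬝ᵥ fun j => firstPassageGF R θ j t x y) / (t * w * l θ))
      t₀ := by
    refine DifferentiableAt.div ?_ (by fun_prop) (by have := hl θ; positivity)
    simp only [dotProduct]
    refine DifferentiableAt.fun_sum fun j _ => (differentiableAt_const _).mul ?_
    have h1 := (hsub.contDiffAt_firstPassageGF hx j (n := 1)).differentiableAt one_ne_zero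
    exact h1.comp t₀ (f := fun t => (y, t)) (by fun_prop)
  -- Pairing the defective eigenvector equation with l gives (1 - t/t₀) l·F = t w l_θ (1 - B). The
  -- factor vanishing at t₀ means that F itself need not be differentiated explicitly.
  have hev : (fun t => 1 - (1 - t * t₀⁻¹) * ((l ⬝ᵥ fun j => firstPassageGF R θ j t x y) /
      (t * w * l θ))) =ᶠ[𝓝 t₀] fun t => B R θ t x y := by
    have hc : Tendsto (fun t : ℝ => (y, t)) (𝓝 t₀) (𝓝 (y, t₀)) :=
      Continuous.tendsto (by fun_prop) _
    filter_upwards [hc.eventually hsub.eventually] with t hsub'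
    have ht' : 0 < t := hsub'.2.1
    have hs := hsub'.summable hx
    have h1 : (l ⬝ᵥ fun j => firstPassageGF R θ j t x y) =
        t * t₀⁻¹ * (l ⬝ᵥ fun j => firstPassageGF R θ j t x y) +
          l θ * (t * w * (1 - B R θ t x y)) := by
      have h2 : (l ⬝ᵥ fun j => firstPassageGF R θ j t x y) = ∑ j, l j *
          (t * (weightMatrix R x y *ᵥ fun k => firstPassageGF R θ k t x y) j +
          if j = θ then t * w * (1 - B R θ t x y) else 0) :=
        Finset.sum_congr rfl fun j _ => congrArg (l j * ·) (firstPassageGF_eigen hx.ne' hy.ne' hs j)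
      have h3 : l ⬝ᵥ (weightMatrix R x y *ᵥ fun k => firstPassageGF R θ k t x y) =
          t₀⁻¹ * (l ⬝ᵥ fun j => firstPassageGF R θ j t x y) := by
        rw [Matrix.dotProduct_mulVec, hal, smul_dotProduct, smul_eq_mul]
      rw [mul_assoc t, ← h3]
      nth_rewrite 1 [h2]
      simp only [mul_add, Finset.sum_add_distrib, mul_ite, mul_zero, Finset.sum_ite_eq',
        Finset.mem_univ, if_true, dotProduct]
      congr 1
      rw [Finset.mul_sum]
      exact Finset.sum_congr rfl fun j _ => by ring
    have h4 := (hl θ).ne'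
    rw [mul_div_assoc', eq_comm, eq_sub_iff_add_eq, ← eq_sub_iff_add_eq', div_eq_iff (by positivity)]
    linarith
  have h5 := ((((hasDerivAt_id t₀).mul_const t₀⁻¹).const_sub 1).mul hd.hasDerivAt).const_sub 1
  refine (h5.congr_of_eventuallyEq hev.symm).congr_deriv ?_
  rw [firstPassageGF_self R θ t₀ hx.ne' hy.ne', ← hw]
  have h4 := (hl θ).ne'
  simp only [id_eq, mul_inv_cancel₀ ht.ne', sub_self, zero_mul, add_zero]
  field_simp

lemma deriv_B_rho_pos (hk1 : 1 ≤ k) (hk : ∀ i j : Step, 0 < (transferMatrix R ^ k) i j)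
    (hx : 0 < x) {y : ℝ} (hy : 0 < y) (θ φ : Step) :
    0 < deriv (fun t => B R θ t x y) (rho R φ x y) := by
  obtain ⟨l, hl, hal⟩ := exists_left_eigenvector hk1 hk hx hy φ
  rw [(hasDerivAt_B_rho hk1 hk hx hy θ φ hl hal).deriv]
  have hF := firstPassageGF_rho_pos hk1 hk hx hy θ φ
  refine div_pos (Finset.sum_pos (fun j _ => mul_pos (hl j) (hF j)) Finset.univ_nonempty)
    (mul_pos (rho_pos hk1 hk hx hy φ) (mul_pos (hl θ) (hF θ)))

/-- Partial derivatives from the total derivative. -/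
lemma hasDerivAt_snd_of_hasFDerivAt {f : ℝ × ℝ → ℝ} {f' : ℝ × ℝ →L[ℝ] ℝ} {p : ℝ × ℝ}
    (h : HasFDerivAt f f' p) : HasDerivAt (fun t => f (p.1, t)) (f' (0, 1)) p.2 :=
  h.comp_hasDerivAt (f := fun t : ℝ => (p.1, t)) p.2 ((hasDerivAt_const _ _).prodMk (hasDerivAt_id _))

lemma hasDerivAt_fst_of_hasFDerivAt {f : ℝ × ℝ → ℝ} {f' : ℝ × ℝ →L[ℝ] ℝ} {p : ℝ × ℝ}
    (h : HasFDerivAt f f' p) : HasDerivAt (fun v => f (v, p.2)) (f' (1, 0)) p.1 :=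
  h.comp_hasDerivAt (f := fun v : ℝ => (v, p.2)) p.1 ((hasDerivAt_id _).prodMk (hasDerivAt_const _ _))

/-- Implicit function theorem for B = 1, where ∂_t B > 0; uniqueness of the positive root identifies
the implicit function with ρ. -/
lemma contDiffAt_rho (hk1 : 1 ≤ k) (hk : ∀ i j : Step, 0 < (transferMatrix R ^ k) i j)
    (hx : 0 < x) {y : ℝ} (hy : 0 < y) (φ : Step) {n : WithTop ℕ∞} (hn : n ≠ 0) :
    ContDiffAt ℝ n (fun v => rho R φ x v) y := by
  have hsub := subcritical_rho hk1 hk hx hy φ φ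
  have hB := hsub.contDiffAt_B hx (n := n)
  have hB1 := (hB.differentiableAt hn).hasFDerivAt
  have hBt := hasDerivAt_snd_of_hasFDerivAt hB1
  have hne : (fderiv ℝ (fun q : ℝ × ℝ => B R φ q.2 x q.1) (y, rho R φ x y)) (0, 1) ≠ 0 := by
    rw [← hBt.deriv]
    exact (deriv_B_rho_pos hk1 hk hx hy φ φ).ne'
  have hinv : (fderiv ℝ (fun q : ℝ × ℝ => B R φ q.2 x q.1) (y, rho R φ x y) ∘L
      .inr ℝ ℝ ℝ).IsInvertible := by
    refine ⟨ContinuousLinearEquiv.unitsEquivAut ℝ (Units.mk0 _ hne), ?_⟩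
    ext
    simp
  refine (hB.contDiffAt_implicitFunction hn hinv).congr_of_eventuallyEq ?_
  have h0 := hB.implicitFunction_apply_self hn hinv
  have hc := (hB.contDiffAt_implicitFunction hn hinv).continuousAt
  have hpos : ∀ᶠ v in 𝓝 y, 0 < hB.implicitFunction hn hinv v := by
    refine hc.eventually (lt_mem_nhds ?_)
    have : hB.implicitFunction hn hinv y = rho R φ x y := h0
    rw [this]
    exact rho_pos hk1 hk hx hy φ
  filter_upwards [hB.eventually_apply_implicitFunction hn hinv, hpos, lt_mem_nhds hy]
    with v hv1 hv2 hv3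
  rw [B_rho hk1 hk hx hy] at hv1
  exact rho_eq_of_B_eq_one hx hv3 hv2 hv1

/-- The derivative of `B` in `y` at `t = ρ`, from implicit differentiation. -/
lemma hasDerivAt_B_snd (hk1 : 1 ≤ k) (hk : ∀ i j : Step, 0 < (transferMatrix R ^ k) i j)
    (hx : 0 < x) {y : ℝ} (hy : 0 < y) (θ φ : Step) :
    HasDerivAt (fun v => B R θ (rho R φ x y) x v)
      (-(deriv (fun v => rho R φ x v) y * deriv (fun t => B R θ t x y) (rho R φ x y))) y := by
  have hsub := subcritical_rho hk1 hk hx hy θ φ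
  have hB := ((hsub.contDiffAt_B hx (n := 1)).differentiableAt one_ne_zero).hasFDerivAt
  set f' := fderiv ℝ (fun q : ℝ × ℝ => B R θ q.2 x q.1) (y, rho R φ x y) with hf'
  have hBt : deriv (fun t => B R θ t x y) (rho R φ x y) = f' (0, 1) :=
    (hasDerivAt_snd_of_hasFDerivAt hB).deriv
  have hrho := ((contDiffAt_rho hk1 hk hx hy φ one_ne_zero).differentiableAt one_ne_zero).hasDerivAt
  have hchain := hB.comp_hasDerivAt (f := fun v : ℝ => (v, rho R φ x v)) y
    ((hasDerivAt_id y).prodMk hrho)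
  have hconst : (fun v => B R θ (rho R φ x v) x v) =ᶠ[𝓝 y] fun _ => (1 : ℝ) := by
    filter_upwards [lt_mem_nhds hy] with v hv
    exact B_rho hk1 hk hx hv θ φ
  have h0 := hchain.unique ((hasDerivAt_const y (1 : ℝ)).congr_of_eventuallyEq hconst)
  refine (hasDerivAt_fst_of_hasFDerivAt hB).congr_deriv ?_
  have hlin : f' (1, deriv (fun v => rho R φ x v) y) =
      f' (1, 0) + deriv (fun v => rho R φ x v) y * f' (0, 1) := by
    rw [← smul_eq_mul, ← map_smul, ← map_add]
    simp
  rw [hBt]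
  linarith

end Rho

end TwoStep

namespace TwoStep

section Unimodal

variable {R : Rule} {k : ℕ} {x : ℝ}

/-! ### Convexity and the critical point of `ρ` -/

/-- The walks counted by `B`. -/
def ReturnWalk (R : Rule) (θ : Step) (l : List Step) : Prop :=
  SingleLast R θ l ∧ ∃ φ, l.head? = some φ ∧ R θ φ = true

lemma B_eq_tsum_returnWalk (R : Rule) (θ : Step) (t x y : ℝ) :
    B R θ t x y = ∑' m, partitionFn (ReturnWalk R θ) m x y * t ^ m := rfl

lemma summable_returnWalk {θ : Step} {t x y : ℝ} (h : B R θ t x y ≠ 0) :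
    Summable fun m => partitionFn (ReturnWalk R θ) m x y * t ^ m := by
  by_contra hns
  rw [B_eq_tsum_returnWalk, tsum_eq_zero_of_not_summable hns] at h
  exact h rfl

lemma partitionFn_eq_add {P : List Step → Prop} {l₀ : List Step} (h : P l₀) (x y : ℝ) :
    partitionFn P l₀.length x y = x ^ xEnd l₀ * y ^ yEnd l₀ +
      partitionFn (fun l => P l ∧ ¬l = l₀) l₀.length x y := by
  rw [← partitionFn_and_add_and_not P (fun l => l = l₀)]
  congr 1
  unfold partitionFn
  let v₀ : List.Vector Step l₀.length := ⟨l₀, rfl⟩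
  rw [Fintype.sum_eq_single v₀]
  · exact if_pos ⟨h, rfl⟩
  · intro v hv
    exact if_neg fun h' => hv (Subtype.ext h'.2)

lemma convexOn_finsetSum {ι : Type*} (t : Finset ι) {f : ι → ℝ → ℝ} {s : Set ℝ} (hs : Convex ℝ s)
    (h : ∀ i ∈ t, ConvexOn ℝ s (f i)) : ConvexOn ℝ s fun y => ∑ i ∈ t, f i y := by
  classical
  induction t using Finset.induction_on with
  | empty => simpa using convexOn_const (0 : ℝ) hs
  | insert a t ha ih =>
    simp only [Finset.sum_insert ha]
    exact (h a (Finset.mem_insert_self _ _)).add (ih fun i hi => h i (Finset.mem_insert_of_mem hi))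

lemma convexOn_partitionFn (P : List Step → Prop) (m : ℕ) (hx : 0 < x) :
    ConvexOn ℝ (Ioi 0) fun y => partitionFn P m x y := by
  unfold partitionFn
  refine convexOn_finsetSum _ (convex_Ioi 0) fun v _ => ?_
  split_ifs
  · exact (convexOn_zpow _).smul (zpow_pos hx _).le
  · exact convexOn_const _ (convex_Ioi 0)

lemma yEnd_eq_zero {l : List Step} (hn : Step.n ∉ l) (hs : Step.s ∉ l) : yEnd l = 0 := by
  induction l with
  | nil => rfl
  | cons j l ih =>
    simp only [List.mem_cons, not_or] at hn hs
    rw [yEnd_cons, ih hn.2 hs.2]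
    cases j <;> simp_all [Step.dy]

/-- Cutting at the first return to `θ`. With `θ`, `θ'` the two vertical directions, the result is a
walk counted by B_θ whose only vertical step is its last one, hence of height ±1. -/
lemma exists_returnWalk {θ θ' : Step} {l : List Step} (hl : IsWalk R (θ :: (l ++ [θ])))
    (hθ' : θ' ∉ l) : ∃ l₁, θ ∉ l₁ ∧ θ' ∉ l₁ ∧ ReturnWalk R θ (l₁ ++ [θ]) := by
  obtain ⟨l₁, l₂, h1, h2⟩ : ∃ l₁ l₂, l ++ [θ] = l₁ ++ θ :: l₂ ∧ θ ∉ l₁ :=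
    List.eq_append_cons_of_mem (by simp)
  have hsub : θ' ∉ l₁ := by
    intro h
    have hmem : θ' ∈ l ++ [θ] := by rw [h1]; simp [h]
    rcases List.mem_append.1 hmem with h3 | h3
    · exact hθ' h3
    · exact h2 (List.mem_singleton.1 h3 ▸ h)
  have hchain : (θ :: (l₁ ++ [θ])).IsChain fun i j => R i j = true := by
    have h3 := hl.2
    rw [h1] at h3
    refine h3.prefix ⟨l₂, ?_⟩
    simp
  refine ⟨l₁, h2, hsub, ⟨⟨⟨by simp, ?_⟩, ?_, by simp⟩, ?_⟩⟩
  · exact hchain.tail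
  · rw [List.count_append, List.count_eq_zero.2 h2]; simp
  · cases l₁ with
    | nil => exact ⟨θ, rfl, by simpa using hchain⟩
    | cons j l₁ =>
      refine ⟨j, rfl, ?_⟩
      simp only [List.cons_append, List.isChain_cons_cons] at hchain
      exact hchain.1

lemma exists_returnWalk_south (h : ¬NorthBound R) :
    ∃ l, ReturnWalk R Step.s l ∧ yEnd l = -1 := by
  simp only [NorthBound, not_forall] at h
  obtain ⟨l, hl, hn⟩ := h
  obtain ⟨l₁, h1, h2, h3⟩ := exists_returnWalk hl hn
  exact ⟨_, h3, by rw [yEnd_concat, yEnd_eq_zero h2 h1]; rfl⟩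

lemma exists_returnWalk_north (h : ¬SouthBound R) :
    ∃ l, ReturnWalk R Step.n l ∧ yEnd l = 1 := by
  simp only [SouthBound, not_forall] at h
  obtain ⟨l, hl, hs⟩ := h
  obtain ⟨l₁, h1, h2, h3⟩ := exists_returnWalk hl hs
  exact ⟨_, h3, by rw [yEnd_concat, yEnd_eq_zero h1 h2]; rfl⟩

lemma le_B_of_returnWalk {θ : Step} {l : List Step} (hl : ReturnWalk R θ l) (hx : 0 < x) {y t : ℝ}
    (hy : 0 < y) (ht : 0 < t) (h : B R θ t x y ≠ 0) :
    x ^ xEnd l * y ^ yEnd l * t ^ l.length ≤ B R θ t x y := by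
  have h1 := (summable_returnWalk h).le_tsum l.length
    fun m _ => mul_nonneg (partitionFn_nonneg _ m hx hy) (pow_nonneg ht.le m)
  refine le_trans (mul_le_mul_of_nonneg_right ?_ (pow_nonneg ht.le _)) h1
  rw [partitionFn_eq_add hl]
  linarith [partitionFn_nonneg (fun l' => ReturnWalk R θ l' ∧ ¬l' = l) l.length hx hy]

/-- `B_s(t; x, ·)` is so convex that its tangents leave a quadratic gap. -/
lemma one_add_le_B {l : List Step} (hl : ReturnWalk R Step.s l) (hyl : yEnd l = -1)
    (hx : 0 < x) {y₀ t₀ : ℝ} (hy₀ : 0 < y₀) (ht₀ : 0 < t₀) (h₀ : B R Step.s t₀ x y₀ ≠ 0)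
    (hd : HasDerivAt (fun v => B R Step.s t₀ x v) 0 y₀) {y : ℝ} (hy : 0 < y)
    (h : B R Step.s t₀ x y ≠ 0) :
    B R Step.s t₀ x y₀ + x ^ xEnd l * t₀ ^ l.length * ((y - y₀) ^ 2 / (y * y₀ ^ 2)) ≤
      B R Step.s t₀ x y := by
  set c := x ^ xEnd l * t₀ ^ l.length with hc
  -- Convexity is meaningful only where the series converges, since the `tsum` drops to 0 elsewhere;
  -- J is itself convex.
  set J : Set ℝ := {v | 0 < v ∧ Summable fun m => partitionFn (ReturnWalk R Step.s) m x v * t₀ ^ m}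
    with hJ
  have hterm : ∀ m, ∀ v₁ ∈ Ioi (0 : ℝ), ∀ v₂ ∈ Ioi (0 : ℝ), ∀ a b : ℝ, 0 ≤ a → 0 ≤ b → a + b = 1 →
      partitionFn (ReturnWalk R Step.s) m x (a * v₁ + b * v₂) * t₀ ^ m ≤
        a * (partitionFn (ReturnWalk R Step.s) m x v₁ * t₀ ^ m) +
        b * (partitionFn (ReturnWalk R Step.s) m x v₂ * t₀ ^ m) := by
    intro m v₁ hv₁ v₂ hv₂ a b ha hb hab
    have := mul_le_mul_of_nonneg_right
      ((convexOn_partitionFn (ReturnWalk R Step.s) m hx).2 hv₁ hv₂ ha hb hab) (pow_nonneg ht₀.le m)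
    simp only [smul_eq_mul] at this
    linarith
  have hconv : Convex ℝ J := by
    intro v₁ hv₁ v₂ hv₂ a b ha hb hab
    have hpos : 0 < a • v₁ + b • v₂ := convex_Ioi (0 : ℝ) hv₁.1 hv₂.1 ha hb hab
    refine ⟨hpos, Summable.of_nonneg_of_le (fun m => mul_nonneg (partitionFn_nonneg _ m hx hpos)
      (pow_nonneg ht₀.le m)) (fun m => hterm m v₁ hv₁.1 v₂ hv₂.1 a b ha hb hab)
      ((hv₁.2.mul_left a).add (hv₂.2.mul_left b))⟩
  -- B stays convex after the removal of the single term c/v contributed by the walk l, so the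
  -- tangent gap of B is at least that of c/v, which is the explicit quadratic expression.
  have hH : ConvexOn ℝ J fun v => B R Step.s t₀ x v - c * v⁻¹ := by
    refine ⟨hconv, fun v₁ hv₁ v₂ hv₂ a b ha hb hab => ?_⟩
    have hmem : a * v₁ + b * v₂ ∈ J := hconv hv₁ hv₂ ha hb hab
    have h1 : ∑' m, (a * (partitionFn (ReturnWalk R Step.s) m x v₁ * t₀ ^ m) +
        b * (partitionFn (ReturnWalk R Step.s) m x v₂ * t₀ ^ m) -
        partitionFn (ReturnWalk R Step.s) m x (a * v₁ + b * v₂) * t₀ ^ m) =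
        a * B R Step.s t₀ x v₁ + b * B R Step.s t₀ x v₂ - B R Step.s t₀ x (a * v₁ + b * v₂) := by
      rw [((hv₁.2.mul_left a).add (hv₂.2.mul_left b)).tsum_sub hmem.2,
        (hv₁.2.mul_left a).tsum_add (hv₂.2.mul_left b), tsum_mul_left, tsum_mul_left]
      rfl
    have h2 := (((hv₁.2.mul_left a).add (hv₂.2.mul_left b)).sub hmem.2).le_tsum l.length
      fun m _ => sub_nonneg.2 (hterm m v₁ hv₁.1 v₂ hv₂.1 a b ha hb hab)
    rw [h1] at h2
    have h3 := (convexOn_partitionFn (fun l' => ReturnWalk R Step.s l' ∧ ¬l' = l) l.length hx).2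
      hv₁.1 hv₂.1 ha hb hab
    have h4 := mul_le_mul_of_nonneg_right h3 (pow_nonneg ht₀.le l.length)
    simp only [partitionFn_eq_add hl, hyl, zpow_neg_one] at h2
    simp only [smul_eq_mul] at h4 ⊢
    have h5 : ∀ v : ℝ, c * v⁻¹ = x ^ xEnd l * v⁻¹ * t₀ ^ l.length := fun v => by rw [hc]; ring
    rw [h5, h5, h5]
    linarith
  have hyJ : y ∈ J := ⟨hy, summable_returnWalk h⟩
  have hy₀J : y₀ ∈ J := ⟨hy₀, summable_returnWalk h₀⟩
  have hder : HasDerivAt (fun v => B R Step.s t₀ x v - c * v⁻¹) (c / y₀ ^ 2) y₀ := by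
    refine (hd.sub ((hasDerivAt_inv hy₀.ne').const_mul c)).congr_deriv ?_
    ring
  have htan : B R Step.s t₀ x y₀ - c * y₀⁻¹ + c / y₀ ^ 2 * (y - y₀) ≤
      B R Step.s t₀ x y - c * y⁻¹ := by
    rcases lt_trichotomy y y₀ with hlt | rfl | hlt
    · have := hH.slope_le_of_hasDerivAt hyJ hy₀J hlt hder
      rw [slope_def_field, div_le_iff₀ (by linarith)] at this
      linarith
    · simp
    · have := hH.le_slope_of_hasDerivAt hy₀J hyJ hlt hder
      rw [slope_def_field, le_div_iff₀ (by linarith)] at this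
      linarith
  have hgap : c * ((y - y₀) ^ 2 / (y * y₀ ^ 2)) = c * y⁻¹ - c * y₀⁻¹ + c / y₀ ^ 2 * (y - y₀) := by
    field_simp
    ring
  linarith

/-- A single walk contributes at most B = 1 at t = ρ, so a large value of its power of y forces ρ to
be small. -/
lemma exists_rho_lt {θ : Step} {l : List Step} (hl : ReturnWalk R θ l) (hk1 : 1 ≤ k)
    (hk : ∀ i j : Step, 0 < (transferMatrix R ^ k) i j) (hx : 0 < x) {ε : ℝ} (hε : 0 < ε) :
    ∃ δ : ℝ, ∀ y, 0 < y → δ < y ^ yEnd l → rho R Step.s x y < ε := by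
  refine ⟨1 / (x ^ xEnd l * ε ^ l.length), fun y hy hyδ => ?_⟩
  by_contra hcon
  push Not at hcon
  have hpos := rho_pos hk1 hk hx hy Step.s
  have h1 := B_rho hk1 hk hx hy θ Step.s
  have h2 := le_B_of_returnWalk hl hx hy hpos (by rw [h1]; exact one_ne_zero)
  rw [h1] at h2
  have hxp : 0 < x ^ xEnd l := zpow_pos hx _
  rw [div_lt_iff₀ (by positivity)] at hyδ
  have h3 : x ^ xEnd l * y ^ yEnd l * ε ^ l.length ≤
      x ^ xEnd l * y ^ yEnd l * rho R Step.s x y ^ l.length := by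
    have := (zpow_pos hy (yEnd l)).le
    gcongr
  have h4 : y ^ yEnd l * (x ^ xEnd l * ε ^ l.length) = x ^ xEnd l * y ^ yEnd l * ε ^ l.length := by
    ring
  linarith

/-- At a critical point y₀ of ρ also ∂_y B vanishes, so convexity gives B(ρ(y₀); y) > 1 if the
series converges there. Were ρ(y) ≥ ρ(y₀), it would converge with a sum of at most B(ρ(y); y) = 1.
-/
lemma rho_lt_of_deriv_eq_zero {l : List Step} (hl : ReturnWalk R Step.s l) (hyl : yEnd l = -1)
    (hk1 : 1 ≤ k) (hk : ∀ i j : Step, 0 < (transferMatrix R ^ k) i j) (hx : 0 < x) {y₀ : ℝ}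
    (hy₀ : 0 < y₀) (hd : deriv (fun v => rho R Step.s x v) y₀ = 0) {y : ℝ} (hy : 0 < y)
    (hne : y ≠ y₀) : rho R Step.s x y < rho R Step.s x y₀ := by
  by_contra hcon
  push Not at hcon
  have ht₀ := rho_pos hk1 hk hx hy₀ Step.s
  have h1 := B_rho hk1 hk hx hy Step.s Step.s
  have h2 := B_rho hk1 hk hx hy₀ Step.s Step.s
  have hder := hasDerivAt_B_snd hk1 hk hx hy₀ Step.s Step.s
  rw [hd, zero_mul, neg_zero] at hder
  have hs := summable_returnWalk (R := R) (θ := Step.s) (by rw [h1]; exact one_ne_zero)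
  have hnn := fun m => partitionFn_nonneg (ReturnWalk R Step.s) m hx hy
  have hle : ∀ m, partitionFn (ReturnWalk R Step.s) m x y * rho R Step.s x y₀ ^ m ≤
      partitionFn (ReturnWalk R Step.s) m x y * rho R Step.s x y ^ m := fun m =>
    mul_le_mul_of_nonneg_left (pow_le_pow_left₀ ht₀.le hcon m) (hnn m)
  have hs' : Summable fun m => partitionFn (ReturnWalk R Step.s) m x y * rho R Step.s x y₀ ^ m :=
    Summable.of_nonneg_of_le (fun m => mul_nonneg (hnn m) (pow_nonneg ht₀.le m)) hle hs
  have hle1 : B R Step.s (rho R Step.s x y₀) x y ≤ 1 := by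
    rw [← h1]
    exact Summable.tsum_le_tsum hle hs' hs
  have hpos : 0 < B R Step.s (rho R Step.s x y₀) x y := by
    have h3 := hs'.le_tsum l.length fun m _ => mul_nonneg (hnn m) (pow_nonneg ht₀.le m)
    refine lt_of_lt_of_le ?_ h3
    refine mul_pos ?_ (pow_pos ht₀ _)
    rw [partitionFn_eq_add hl]
    have := partitionFn_nonneg (fun l' => ReturnWalk R Step.s l' ∧ ¬l' = l) l.length hx hy
    have h4 : 0 < x ^ xEnd l * y ^ yEnd l := mul_pos (zpow_pos hx _) (zpow_pos hy _)
    linarith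
  have h5 := one_add_le_B hl hyl hx hy₀ ht₀ (by rw [h2]; exact one_ne_zero) hder hy hpos.ne'
  rw [h2] at h5
  have h6 : 0 < x ^ xEnd l * rho R Step.s x y₀ ^ l.length * ((y - y₀) ^ 2 / (y * y₀ ^ 2)) := by
    have h7 : 0 < x ^ xEnd l := zpow_pos hx _
    have h8 : 0 < (y - y₀) ^ 2 := by
      have := sub_ne_zero.2 hne
      positivity
    positivity
  linarith

/-- The shape of `ρ(x, ·)`. -/
theorem exists_unimodal (hk1 : 1 ≤ k) (hk : ∀ i j : Step, 0 < (transferMatrix R ^ k) i j)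
    (hV : VerticallyUnbounded R) (hx : 0 < x) : ∃ τ, 0 < τ ∧
      deriv (fun v => rho R Step.s x v) τ = 0 ∧
      (∀ y ∈ Ioo 0 τ, 0 < deriv (fun v => rho R Step.s x v) y) ∧
      (∀ y ∈ Ioi τ, deriv (fun v => rho R Step.s x v) y < 0) ∧
      Tendsto (fun v => rho R Step.s x v) (𝓝[>] 0) (𝓝 0) ∧
      Tendsto (fun v => rho R Step.s x v) atTop (𝓝 0) := by
  obtain ⟨l, hl, hyl⟩ := exists_returnWalk_south hV.1
  obtain ⟨l', hl', hyl'⟩ := exists_returnWalk_north hV.2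
  set f := fun v => rho R Step.s x v with hf
  have hfpos : ∀ y, 0 < y → 0 < f y := fun y hy => rho_pos hk1 hk hx hy Step.s
  have hfd : ∀ y, 0 < y → DifferentiableAt ℝ f y := fun y hy =>
    (contDiffAt_rho hk1 hk hx hy Step.s one_ne_zero).differentiableAt one_ne_zero
  have h0 : ∀ ε > 0, ∃ a > 0, ∀ y, 0 < y → y < a → f y < ε := by
    intro ε hε
    obtain ⟨δ, hδ⟩ := exists_rho_lt hl hk1 hk hx hε
    refine ⟨(max δ 1)⁻¹, by positivity, fun y hy hya => hδ y hy ?_⟩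
    rw [hyl, zpow_neg_one]
    exact (le_max_left δ 1).trans_lt ((lt_inv_comm₀ hy (by positivity)).1 hya)
  have hinf : ∀ ε > 0, ∃ b > 0, ∀ y, b < y → f y < ε := by
    intro ε hε
    obtain ⟨δ, hδ⟩ := exists_rho_lt hl' hk1 hk hx hε
    refine ⟨max δ 1, by positivity, fun y hyb => hδ y (lt_trans (by positivity) hyb) ?_⟩
    rw [hyl', zpow_one]
    exact (le_max_left δ 1).trans_lt hyb
  obtain ⟨a, ha, hfa⟩ := h0 (f 1) (hfpos 1 one_pos)
  obtain ⟨b, hb, hfb⟩ := hinf (f 1) (hfpos 1 one_pos)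
  have ha1 : a ≤ 1 := not_lt.1 fun h => lt_irrefl _ (hfa 1 one_pos h)
  have hb1 : 1 ≤ b := not_lt.1 fun h => lt_irrefl _ (hfb 1 h)
  obtain ⟨τ, hτmem, hτmax⟩ := isCompact_Icc.exists_isMaxOn (s := Icc a b) ⟨1, ha1, hb1⟩
    (f := f) fun y hy => (hfd y (lt_of_lt_of_le ha hy.1)).continuousAt.continuousWithinAt
  have hτ0 : 0 < τ := lt_of_lt_of_le ha hτmem.1
  have hmax : ∀ y, 0 < y → f y ≤ f τ := by
    intro y hy
    have h1 : f 1 ≤ f τ := hτmax ⟨ha1, hb1⟩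
    by_cases h2 : y < a
    · exact (hfa y hy h2).le.trans h1
    by_cases h3 : b < y
    · exact (hfb y h3).le.trans h1
    exact hτmax ⟨not_lt.1 h2, not_lt.1 h3⟩
  have hτd : deriv f τ = 0 := by
    refine IsLocalMax.deriv_eq_zero ?_
    filter_upwards [lt_mem_nhds hτ0] with y hy
    exact hmax y hy
  have hcrit : ∀ y, 0 < y → deriv f y = 0 → y = τ := by
    intro y hy hd
    by_contra hne
    have := rho_lt_of_deriv_eq_zero hl hyl hk1 hk hx hy hd hτ0 (Ne.symm hne)
    exact absurd (hmax y hy) (not_le.2 this)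
  have hlt : ∀ y, 0 < y → y ≠ τ → f y < f τ := fun y hy hne =>
    rho_lt_of_deriv_eq_zero hl hyl hk1 hk hx hτ0 hτd hy hne
  refine ⟨τ, hτ0, hτd, ?_, ?_, ?_, ?_⟩
  -- Darboux: a derivative without zeros on an interval has constant sign, and the wrong sign would
  -- contradict the maximum at τ.
  · rcases hasDerivWithinAt_forall_lt_or_forall_gt_of_forall_ne (convex_Ioo 0 τ)
      (fun y hy => (hfd y hy.1).hasDerivAt.hasDerivWithinAt)
      (fun y hy h => hy.2.ne (hcrit y hy.1 h)) with h | h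
    · exfalso
      have hanti : StrictAntiOn f (Ioc 0 τ) := by
        refine strictAntiOn_of_deriv_neg (convex_Ioc 0 τ)
          (fun y hy => (hfd y hy.1).continuousAt.continuousWithinAt) fun y hy => ?_
        rw [interior_Ioc] at hy
        exact h y hy
      have h1 := hanti ⟨half_pos hτ0, by linarith⟩ ⟨hτ0, le_rfl⟩ (half_lt_self hτ0)
      have h2 := hmax (τ / 2) (half_pos hτ0)
      linarith
    · exact h
  · rcases hasDerivWithinAt_forall_lt_or_forall_gt_of_forall_ne (convex_Ioi τ)
      (fun y hy => (hfd y (hτ0.trans hy)).hasDerivAt.hasDerivWithinAt)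
      (fun y hy h => (ne_of_gt hy) (hcrit y (hτ0.trans hy) h)) with h | h
    · exact h
    · exfalso
      have hmono : StrictMonoOn f (Ici τ) := by
        refine strictMonoOn_of_deriv_pos (convex_Ici τ)
          (fun y hy => (hfd y (lt_of_lt_of_le hτ0 hy)).continuousAt.continuousWithinAt) fun y hy => ?_
        rw [interior_Ici] at hy
        exact h y hy
      have h1 := hmono (mem_Ici.2 le_rfl) (mem_Ici.2 (by linarith : τ ≤ τ + 1)) (by linarith)
      have h2 := hmax (τ + 1) (by linarith)
      linarith
  · rw [Metric.tendsto_nhds]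
    intro ε hε
    obtain ⟨a, ha, hfa⟩ := h0 ε hε
    filter_upwards [Ioo_mem_nhdsGT ha] with y hy
    rw [Real.dist_eq, sub_zero, abs_of_pos (hfpos y hy.1)]
    exact hfa y hy.1 hy.2
  · rw [Metric.tendsto_nhds]
    intro ε hε
    obtain ⟨b, hb, hfb⟩ := hinf ε hε
    filter_upwards [eventually_gt_atTop b] with y hy
    rw [Real.dist_eq, sub_zero, abs_of_pos (hfpos y (hb.trans hy))]
    exact hfb y hy

end Unimodal

end TwoStep

namespace TwoStep

/-! ### Inverse branches of `ρ` -/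

/-- A section chosen pointwise agrees, by injectivity on I, with the local inverses of the inverse
function theorem, and so inherits their smoothness. -/
lemma exists_contDiffOn_rightInverse {f : ℝ → ℝ} {I J : Set ℝ} (hI : IsOpen I) (hJ : IsOpen J)
    (hinj : InjOn f I) (hf : ∀ y ∈ I, ContDiffAt ℝ 1 f y) (hd : ∀ y ∈ I, deriv f y ≠ 0)
    (hsurj : ∀ t ∈ J, ∃ y ∈ I, f y = t) :
    ∃ υ : ℝ → ℝ, (∀ t ∈ J, υ t ∈ I ∧ f (υ t) = t) ∧ ContDiffOn ℝ 1 υ J := by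
  choose! υ hυ using hsurj
  refine ⟨υ, hυ, fun t ht => ContDiffAt.contDiffWithinAt ?_⟩
  obtain ⟨hmem, hft⟩ := hυ t ht
  have h1 := hf _ hmem
  have hder : HasFDerivAt f (ContinuousLinearEquiv.unitsEquivAut ℝ (Units.mk0 _ (hd _ hmem)) :
      ℝ →L[ℝ] ℝ) (υ t) := by
    have h2 := ((h1.differentiableAt one_ne_zero).hasDerivAt).hasFDerivAt
    have heq : ((ContinuousLinearEquiv.unitsEquivAut ℝ (Units.mk0 _ (hd _ hmem)) : ℝ ≃L[ℝ] ℝ) :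
        ℝ →L[ℝ] ℝ) = ContinuousLinearMap.toSpanSingleton ℝ (deriv f (υ t)) := by
      ext
      simp
    exact h2.congr_fderiv heq.symm
  have h3 := h1.to_localInverse hder one_ne_zero
  have h4 := (h1.hasStrictFDerivAt' hder one_ne_zero).eventually_right_inverse
  have h5 := h1.localInverse_apply_image hder one_ne_zero
  rw [hft] at h3 h4 h5
  refine h3.congr_of_eventuallyEq ?_
  have h6 : ∀ᶠ t' in 𝓝 t, h1.localInverse hder one_ne_zero t' ∈ I :=
    h3.continuousAt.eventually (by rw [h5]; exact hI.mem_nhds hmem)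
  filter_upwards [h4, h6, hJ.mem_nhds ht] with t' h7 h8 h9
  exact hinj (hυ t' h9).1 h8 ((hυ t' h9).2.trans h7.symm)

lemma taylor_two_isLittleO {f : ℝ → ℝ} {a : ℝ} (hf : ContDiffAt ℝ 2 f a) (hd : deriv f a = 0) :
    (fun y => f y - f a - iteratedDeriv 2 f a / 2 * (y - a) ^ 2) =o[𝓝 a] fun y => (y - a) ^ 2 := by
  obtain ⟨u, hu, hfu⟩ := hf.contDiffOn le_rfl (by simp)
  obtain ⟨ε, hε, hball⟩ := Metric.mem_nhds_iff.1 (by simpa using hu)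
  have hmem : a ∈ Metric.ball a ε := Metric.mem_ball_self hε
  have h := taylor_isLittleO (n := 2) (convex_ball a ε) hmem (hfu.mono hball)
  rw [Metric.isOpen_ball.nhdsWithin_eq hmem] at h
  refine h.congr_left fun y => ?_
  have h1 : iteratedDerivWithin 1 f (Metric.ball a ε) a = 0 := by
    rw [iteratedDerivWithin_of_isOpen Metric.isOpen_ball hmem, iteratedDeriv_one, hd]
  have h2 : iteratedDerivWithin 2 f (Metric.ball a ε) a = iteratedDeriv 2 f a :=
    iteratedDerivWithin_of_isOpen Metric.isOpen_ball hmem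
  rw [taylorWithinEval_succ, taylorWithinEval_succ, taylor_within_zero_eval, zero_add,
    show 1 + 1 = 2 from rfl, h1, h2]
  simp [Nat.factorial]
  ring

section KappaTau

variable {R : Rule} {k : ℕ} {x : ℝ}

lemma strictMonoOn_rho (hk1 : 1 ≤ k) (hk : ∀ i j : Step, 0 < (transferMatrix R ^ k) i j)
    (hx : 0 < x) {τ : ℝ} (h : ∀ y ∈ Ioo 0 τ, 0 < deriv (fun v => rho R Step.s x v) y) :
    StrictMonoOn (fun v => rho R Step.s x v) (Ioc 0 τ) := by
  refine strictMonoOn_of_deriv_pos (convex_Ioc 0 τ) (fun y hy => ContinuousAt.continuousWithinAt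
    (contDiffAt_rho hk1 hk hx hy.1 Step.s one_ne_zero).continuousAt) fun y hy => ?_
  rw [interior_Ioc] at hy
  exact h y hy

lemma strictAntiOn_rho (hk1 : 1 ≤ k) (hk : ∀ i j : Step, 0 < (transferMatrix R ^ k) i j)
    (hx : 0 < x) {τ : ℝ} (hτ : 0 < τ) (h : ∀ y ∈ Ioi τ, deriv (fun v => rho R Step.s x v) y < 0) :
    StrictAntiOn (fun v => rho R Step.s x v) (Ici τ) := by
  refine strictAntiOn_of_deriv_neg (convex_Ici τ) (fun y hy => ContinuousAt.continuousWithinAt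
    (contDiffAt_rho hk1 hk hx (lt_of_lt_of_le hτ hy) Step.s one_ne_zero).continuousAt) fun y hy => ?_
  rw [interior_Ici] at hy
  exact h y hy

lemma isKappaTau_rho (hk1 : 1 ≤ k) (hk : ∀ i j : Step, 0 < (transferMatrix R ^ k) i j)
    (hx : 0 < x) {τ : ℝ} (hτ : 0 < τ)
    (h1 : ∀ y ∈ Ioo 0 τ, 0 < deriv (fun v => rho R Step.s x v) y)
    (h2 : ∀ y ∈ Ioi τ, deriv (fun v => rho R Step.s x v) y < 0)
    (h3 : Tendsto (fun v => rho R Step.s x v) (𝓝[>] 0) (𝓝 0))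
    (h4 : Tendsto (fun v => rho R Step.s x v) atTop (𝓝 0)) :
    IsKappaTau R x (rho R Step.s x τ) τ := by
  have hmono := strictMonoOn_rho hk1 hk hx h1
  have hanti := strictAntiOn_rho hk1 hk hx hτ h2
  set f := fun v => rho R Step.s x v with hf
  set κ := rho R Step.s x τ with hκ
  have hfκ : f τ = κ := rfl
  have hC : ∀ y, 0 < y → ContDiffAt ℝ 1 f y := fun y hy =>
    contDiffAt_rho hk1 hk hx hy Step.s one_ne_zero
  have hκ0 : 0 < κ := rho_pos hk1 hk hx hτ Step.s
  obtain ⟨υm, hm, hmC⟩ := exists_contDiffOn_rightInverse (f := f) (I := Ioo 0 τ) (J := Ioo 0 κ)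
    isOpen_Ioo isOpen_Ioo (hmono.injOn.mono Ioo_subset_Ioc_self) (fun y hy => hC y hy.1)
    (fun y hy => (h1 y hy).ne') (by
      intro t ht
      obtain ⟨a, ha1, ha2⟩ := ((h3.eventually (gt_mem_nhds ht.1)).and (Ioo_mem_nhdsGT hτ)).exists
      obtain ⟨y, hy, hyt⟩ := intermediate_value_Ioo ha2.2.le
        (fun v hv => (hC v (lt_of_lt_of_le ha2.1 hv.1)).continuousAt.continuousWithinAt) ⟨ha1, ht.2⟩
      exact ⟨y, ⟨ha2.1.trans hy.1, hy.2⟩, hyt⟩)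
  obtain ⟨υp, hp, hpC⟩ := exists_contDiffOn_rightInverse (f := f) (I := Ioi τ) (J := Ioo 0 κ)
    isOpen_Ioi isOpen_Ioo (hanti.injOn.mono Ioi_subset_Ici_self) (fun y hy => hC y (hτ.trans hy))
    (fun y hy => (h2 y hy).ne) (by
      intro t ht
      obtain ⟨b, hb1, hb2⟩ := ((h4.eventually (gt_mem_nhds ht.1)).and (eventually_gt_atTop τ)).exists
      obtain ⟨y, hy, hyt⟩ := intermediate_value_Ioo' hb2.le
        (fun v hv => (hC v (lt_of_lt_of_le hτ hv.1)).continuousAt.continuousWithinAt) ⟨hb1, ht.2⟩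
      exact ⟨y, hy.1, hyt⟩)
  have hm' : ∀ t ∈ Ioo 0 κ, υm t ∈ Ioc 0 τ := fun t ht => Ioo_subset_Ioc_self (hm t ht).1
  have hp' : ∀ t ∈ Ioo 0 κ, υp t ∈ Ici τ := fun t ht => Ioi_subset_Ici_self (hp t ht).1
  have hp0 : ∀ t ∈ Ioo 0 κ, 0 < υp t := fun t ht => hτ.trans (hp t ht).1
  refine ⟨hκ0, hτ, υm, υp, fun t ht => ⟨(hm t ht).1.1, hp0 t ht⟩, hmC, hpC, fun θ t ht => ⟨?_, ?_⟩,
    fun t ht t' ht' htt' => ?_, fun t ht t' ht' htt' => ?_, ?_, ?_, ?_, ?_⟩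
  · have := B_rho hk1 hk hx (hm t ht).1.1 θ Step.s
    rwa [show rho R Step.s x (υm t) = t from (hm t ht).2] at this
  · have := B_rho hk1 hk hx (hp0 t ht) θ Step.s
    rwa [show rho R Step.s x (υp t) = t from (hp t ht).2] at this
  · rw [← hmono.lt_iff_lt (hm' t ht) (hm' t' ht'), (hm t ht).2, (hm t' ht').2]
    exact htt'
  · rw [← hanti.lt_iff_gt (hp' t ht) (hp' t' ht'), (hp t ht).2, (hp t' ht').2]
    exact htt'
  · rw [tendsto_order]
    constructor
    · intro a ha
      filter_upwards [Ioo_mem_nhdsGT hκ0] with t ht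
      exact ha.trans (hm t ht).1.1
    · intro a ha
      have hb : 0 < min a τ := lt_min ha hτ
      have hfb : 0 < f (min a τ) := rho_pos hk1 hk hx hb Step.s
      filter_upwards [Ioo_mem_nhdsGT hκ0, Ioo_mem_nhdsGT hfb] with t ht htb
      refine lt_of_lt_of_le ?_ (min_le_left a τ)
      rw [← hmono.lt_iff_lt (hm' t ht) ⟨hb, min_le_right _ _⟩, (hm t ht).2]
      exact htb.2
  · rw [tendsto_order]
    constructor
    · intro a ha
      have hb : max a (τ / 2) ∈ Ioc 0 τ :=
        ⟨lt_max_of_lt_right (half_pos hτ), max_le ha.le (half_le_self hτ.le)⟩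
      have hfb : f (max a (τ / 2)) < κ :=
        hmono hb ⟨hτ, le_rfl⟩ (max_lt ha (half_lt_self hτ))
      filter_upwards [Ioo_mem_nhdsLT hκ0, Ioo_mem_nhdsLT hfb] with t ht htb
      refine lt_of_le_of_lt (le_max_left a (τ / 2)) ?_
      rw [← hmono.lt_iff_lt hb (hm' t ht), (hm t ht).2]
      exact htb.1
    · intro a ha
      filter_upwards [Ioo_mem_nhdsLT hκ0] with t ht
      exact (hm t ht).1.2.trans ha
  · rw [tendsto_atTop]
    intro b
    have hb : max b τ ∈ Ici τ := le_max_right b τ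
    have hfb : 0 < f (max b τ) := rho_pos hk1 hk hx (lt_of_lt_of_le hτ hb) Step.s
    filter_upwards [Ioo_mem_nhdsGT hκ0, Ioo_mem_nhdsGT hfb] with t ht htb
    refine (le_max_left b τ).trans (le_of_lt ?_)
    rw [← hanti.lt_iff_gt (hp' t ht) hb, (hp t ht).2]
    exact htb.2
  · rw [tendsto_order]
    constructor
    · intro a ha
      filter_upwards [Ioo_mem_nhdsLT hκ0] with t ht
      exact ha.trans (hp t ht).1
    · intro a ha
      have hfb : f a < κ := hanti (mem_Ici.2 le_rfl) (mem_Ici.2 ha.le) ha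
      filter_upwards [Ioo_mem_nhdsLT hκ0, Ioo_mem_nhdsLT hfb] with t ht htb
      rw [← hanti.lt_iff_gt (mem_Ici.2 ha.le) (hp' t ht), (hp t ht).2]
      exact htb.1

/-- The lower branch: `ρ(x, υ⁻(t)) = t`, with `υ⁻ < τ` and `υ⁻ → τ`. -/
lemma IsKappaTau.lower_branch {κ τ : ℝ} (h : IsKappaTau R x κ τ) (hx : 0 < x) : ∃ υ : ℝ → ℝ,
    (∀ t ∈ Ioo 0 κ, 0 < υ t ∧ υ t < τ ∧ rho R Step.s x (υ t) = t) ∧ Tendsto υ (𝓝[<] κ) (𝓝 τ) := by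
  obtain ⟨hκ, hτ, υm, υp, h0, -, -, hB, hm, -, -, hmτ, -, -⟩ := h
  refine ⟨υm, fun t ht => ⟨(h0 t ht).1, ?_, ?_⟩, hmτ⟩
  · obtain ⟨t', h1, h2⟩ := exists_between ht.2
    refine lt_of_lt_of_le (hm ht ⟨ht.1.trans h1, h2⟩ h1) (ge_of_tendsto hmτ ?_)
    filter_upwards [Ioo_mem_nhdsLT h2] with t'' ht''
    exact (hm ⟨ht.1.trans h1, h2⟩ ⟨ht.1.trans (h1.trans ht''.1), ht''.2⟩ ht''.1).le
  · exact rho_eq_of_B_eq_one hx (h0 t ht).1 ht.1 (hB Step.s t ht).1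

lemma IsKappaTau.upper_branch {κ τ : ℝ} (h : IsKappaTau R x κ τ) (hx : 0 < x) : ∃ υ : ℝ → ℝ,
    (∀ t ∈ Ioo 0 κ, 0 < υ t ∧ τ < υ t ∧ rho R Step.s x (υ t) = t) ∧ Tendsto υ (𝓝[<] κ) (𝓝 τ) := by
  obtain ⟨hκ, hτ, υm, υp, h0, -, -, hB, -, hp, -, -, -, hpτ⟩ := h
  refine ⟨υp, fun t ht => ⟨(h0 t ht).2, ?_, ?_⟩, hpτ⟩
  · obtain ⟨t', h1, h2⟩ := exists_between ht.2
    refine lt_of_le_of_lt (le_of_tendsto hpτ ?_) (hp ht ⟨ht.1.trans h1, h2⟩ h1)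
    filter_upwards [Ioo_mem_nhdsLT h2] with t'' ht''
    exact (hp ⟨ht.1.trans h1, h2⟩ ⟨ht.1.trans (h1.trans ht''.1), ht''.2⟩ ht''.1).le
  · exact rho_eq_of_B_eq_one hx (h0 t ht).2 ht.1 (hB Step.s t ht).2

lemma IsKappaTau.eq_rho {κ τ : ℝ} (h : IsKappaTau R x κ τ) (hk1 : 1 ≤ k)
    (hk : ∀ i j : Step, 0 < (transferMatrix R ^ k) i j) (hx : 0 < x) :
    rho R Step.s x τ = κ := by
  obtain ⟨υ, h1, h2⟩ := h.lower_branch hx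
  obtain ⟨hκ, hτ, -⟩ := h
  have hc := (contDiffAt_rho hk1 hk hx hτ Step.s one_ne_zero).continuousAt.tendsto.comp h2
  refine tendsto_nhds_unique hc (Tendsto.congr' ?_ (tendsto_id.mono_left nhdsWithin_le_nhds))
  filter_upwards [Ioo_mem_nhdsLT hκ] with t ht
  exact (h1 t ht).2.2.symm

/-- If τ' < τ, the upper branch comes close to τ' from above, where ρ increases, so ρ would exceed
ρ(τ') = κ there, although it equals t < κ. The lower branch excludes τ' > τ in the same way. -/
lemma IsKappaTau.eq {κ τ' τ : ℝ} (h : IsKappaTau R x κ τ') (hk1 : 1 ≤ k)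
    (hk : ∀ i j : Step, 0 < (transferMatrix R ^ k) i j) (hx : 0 < x) (hτ : 0 < τ)
    (h1 : ∀ y ∈ Ioo 0 τ, 0 < deriv (fun v => rho R Step.s x v) y)
    (h2 : ∀ y ∈ Ioi τ, deriv (fun v => rho R Step.s x v) y < 0) : τ' = τ := by
  have hmono := strictMonoOn_rho hk1 hk hx h1
  have hanti := strictAntiOn_rho hk1 hk hx hτ h2
  have hκ := h.eq_rho hk1 hk hx
  obtain ⟨υm, hm, hmτ⟩ := h.lower_branch hx
  obtain ⟨υp, hp, hpτ⟩ := h.upper_branch hx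
  obtain ⟨hκ0, hτ', -⟩ := h
  rcases lt_trichotomy τ' τ with hlt | heq | hlt
  · exfalso
    obtain ⟨t, ht1, ht2⟩ := ((hpτ.eventually (gt_mem_nhds hlt)).and (Ioo_mem_nhdsLT hκ0)).exists
    obtain ⟨h3, h4, h5⟩ := hp t ht2
    have h6 := hmono ⟨hτ', hlt.le⟩ ⟨h3, ht1.le⟩ h4
    simp only [h5, hκ] at h6
    linarith [ht2.2]
  · exact heq
  · exfalso
    obtain ⟨t, ht1, ht2⟩ := ((hmτ.eventually (lt_mem_nhds hlt)).and (Ioo_mem_nhdsLT hκ0)).exists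
    obtain ⟨h3, h4, h5⟩ := hm t ht2
    have h6 := hanti (mem_Ici.2 ht1.le) (mem_Ici.2 hlt.le) h4
    simp only [h5, hκ] at h6
    linarith [ht2.2]

/-! ### The second derivative of `μ` -/

lemma contDiffAt_mu (hk1 : 1 ≤ k) (hk : ∀ i j : Step, 0 < (transferMatrix R ^ k) i j)
    (hx : 0 < x) {y : ℝ} (hy : 0 < y) (θ : Step) {n : WithTop ℕ∞} (hn : n ≠ 0) :
    ContDiffAt ℝ n (fun v => mu R θ x v) y := by
  have h := (contDiffAt_rho hk1 hk hx hy θ hn).inv (rho_pos hk1 hk hx hy θ).ne'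
  simpa only [mu, one_div] using! h

lemma rho_funext (hk1 : 1 ≤ k) (hk : ∀ i j : Step, 0 < (transferMatrix R ^ k) i j)
    (hx : 0 < x) {y : ℝ} (hy : 0 < y) (θ φ : Step) :
    (fun v => rho R θ x v) =ᶠ[𝓝 y] fun v => rho R φ x v := by
  filter_upwards [lt_mem_nhds hy] with v hv
  exact rho_eq_rho hk1 hk hx hv θ φ

lemma hasDerivAt_mu (hk1 : 1 ≤ k) (hk : ∀ i j : Step, 0 < (transferMatrix R ^ k) i j)
    (hx : 0 < x) {τ : ℝ} (hτ : 0 < τ) (hd : deriv (fun v => rho R Step.s x v) τ = 0) (θ : Step) :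
    HasDerivAt (fun v => mu R θ x v) 0 τ := by
  have h1 := ((contDiffAt_rho hk1 hk hx hτ θ one_ne_zero).differentiableAt one_ne_zero).hasDerivAt
  rw [(rho_funext hk1 hk hx hτ θ Step.s).deriv_eq, hd] at h1
  have h2 := h1.inv (rho_pos hk1 hk hx hτ θ).ne'
  rw [neg_zero, zero_div] at h2
  simpa only [mu, one_div] using! h2

/-- Nondegeneracy of the maximum: the convexity gap bounds B(κ; y) - 1 below by a multiple of
(y-τ)², and a Lipschitz bound for B in t converts this into a lower bound on κ - ρ(y). -/
lemma exists_mul_sq_le_mu_sub (hk1 : 1 ≤ k) (hk : ∀ i j : Step, 0 < (transferMatrix R ^ k) i j)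
    (hV : VerticallyUnbounded R) (hx : 0 < x) {τ : ℝ} (hτ : 0 < τ)
    (hd : deriv (fun v => rho R Step.s x v) τ = 0) (θ : Step) :
    ∃ c > 0, ∀ᶠ y in 𝓝 τ, c * (y - τ) ^ 2 ≤ mu R θ x y - mu R θ x τ := by
  obtain ⟨l, hl, hyl⟩ := exists_returnWalk_south hV.1
  set κ := rho R Step.s x τ with hκ
  have hκ0 : 0 < κ := rho_pos hk1 hk hx hτ Step.s
  have hB1 := B_rho hk1 hk hx hτ Step.s Step.s
  have hsub := subcritical_rho hk1 hk hx hτ Step.s Step.s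
  have hder := hasDerivAt_B_snd hk1 hk hx hτ Step.s Step.s
  rw [hd, zero_mul, neg_zero] at hder
  obtain ⟨L, u, hu, hL⟩ := (hsub.contDiffAt_B hx (n := 1)).exists_lipschitzOnWith
  have hρc := (contDiffAt_rho hk1 hk hx hτ Step.s one_ne_zero).continuousAt
  have hu1 : ∀ᶠ y in 𝓝 τ, (y, κ) ∈ u :=
    (Continuous.tendsto (by fun_prop : Continuous fun y : ℝ => (y, κ)) τ).eventually hu
  have hu2 : ∀ᶠ y in 𝓝 τ, (y, rho R Step.s x y) ∈ u :=
    (continuousAt_id.prodMk hρc).eventually hu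
  have hne : ∀ᶠ y in 𝓝 τ, B R Step.s κ x y ≠ 0 :=
    hder.continuousAt.eventually_ne (by rw [hB1]; exact one_ne_zero)
  have hmax : ∀ᶠ y in 𝓝 τ, rho R Step.s x y ≤ κ := by
    filter_upwards [lt_mem_nhds hτ] with y hy
    by_cases hyτ : y = τ
    · rw [hyτ]
    · exact (rho_lt_of_deriv_eq_zero hl hyl hk1 hk hx hτ hd hy hyτ).le
  set c := x ^ xEnd l * κ ^ l.length / (2 * τ * τ ^ 2) with hc
  have hxp : 0 < x ^ xEnd l := zpow_pos hx _
  have hc0 : 0 < c := by positivity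
  refine ⟨c / (L + 1) / κ ^ 2, by positivity, ?_⟩
  filter_upwards [hu1, hu2, hne, hmax, lt_mem_nhds hτ, gt_mem_nhds (by linarith : τ < 2 * τ)]
    with y h1 h2 h3 h4 hy0 hy2
  have h5 := one_add_le_B hl hyl hx hτ hκ0 (by rw [hB1]; exact one_ne_zero) hder hy0 h3
  rw [hB1] at h5
  have h6 := hL.dist_le_mul _ h1 _ h2
  rw [Real.dist_eq, Prod.dist_eq, dist_self, max_eq_right dist_nonneg, Real.dist_eq,
    abs_of_nonneg (sub_nonneg.2 h4)] at h6
  simp only at h6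
  rw [B_rho hk1 hk hx hy0] at h6
  have h7 := (le_abs_self _).trans h6
  have h8 : c * (y - τ) ^ 2 ≤ x ^ xEnd l * κ ^ l.length * ((y - τ) ^ 2 / (y * τ ^ 2)) := by
    rw [hc, div_mul_eq_mul_div, mul_div_assoc]
    refine mul_le_mul_of_nonneg_left ?_ (by positivity)
    exact div_le_div_of_nonneg_left (sq_nonneg _) (by positivity) (by gcongr)
  have h9 : c * (y - τ) ^ 2 ≤ (L + 1) * (κ - rho R Step.s x y) := by
    have : 0 ≤ κ - rho R Step.s x y := sub_nonneg.2 h4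
    linarith
  have hρ0 := rho_pos hk1 hk hx hy0 Step.s
  have h10 : c / (L + 1) * (y - τ) ^ 2 ≤ κ - rho R Step.s x y := by
    rw [div_mul_eq_mul_div, div_le_iff₀ (by positivity)]
    linarith
  have h11 : mu R θ x y - mu R θ x τ = (κ - rho R Step.s x y) / (rho R Step.s x y * κ) := by
    rw [mu, mu, rho_eq_rho hk1 hk hx hy0 θ Step.s, rho_eq_rho hk1 hk hx hτ θ Step.s, ← hκ]
    field_simp
  rw [h11, div_mul_eq_mul_div]
  refine div_le_div₀ (sub_nonneg.2 h4) h10 (by positivity) ?_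
  rw [sq]
  gcongr

lemma iteratedDeriv_two_mu_pos (hk1 : 1 ≤ k) (hk : ∀ i j : Step, 0 < (transferMatrix R ^ k) i j)
    (hV : VerticallyUnbounded R) (hx : 0 < x) {τ : ℝ} (hτ : 0 < τ)
    (hd : deriv (fun v => rho R Step.s x v) τ = 0) (θ : Step) :
    0 < iteratedDeriv 2 (fun v => mu R θ x v) τ := by
  obtain ⟨c, hc, hle⟩ := exists_mul_sq_le_mu_sub hk1 hk hV hx hτ hd θ
  have htay := taylor_two_isLittleO (contDiffAt_mu hk1 hk hx hτ θ (n := 2) two_ne_zero)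
    (hasDerivAt_mu hk1 hk hx hτ hd θ).deriv
  have h1 := (htay.def (half_pos hc)).and hle
  obtain ⟨y, ⟨h2, h3⟩, h4⟩ := ((h1.filter_mono nhdsWithin_le_nhds).and
    (self_mem_nhdsWithin : ∀ᶠ y in 𝓝[≠] τ, y ∈ ({τ}ᶜ : Set ℝ))).exists
  have h5 : 0 < (y - τ) ^ 2 := by
    have := sub_ne_zero.2 h4
    positivity
  rw [Real.norm_eq_abs, Real.norm_eq_abs, abs_of_pos h5] at h2
  have h6 := (le_abs_self _).trans h2
  by_contra hcon
  push Not at hcon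
  nlinarith [mul_nonneg (neg_nonneg.2 hcon) h5.le]

/-- The square-root behaviour of the lower branch. -/
lemma tendsto_lower_branch (hk1 : 1 ≤ k) (hk : ∀ i j : Step, 0 < (transferMatrix R ^ k) i j)
    (hV : VerticallyUnbounded R) (hx : 0 < x) {τ κ : ℝ} (hτ : 0 < τ) (hκ : rho R Step.s x τ = κ)
    (hd : deriv (fun v => rho R Step.s x v) τ = 0) (θ : Step) {υ : ℝ → ℝ}
    (hυ : ∀ t ∈ Ioo 0 κ, 0 < υ t ∧ υ t < τ ∧ rho R Step.s x (υ t) = t)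
    (hυτ : Tendsto υ (𝓝[<] κ) (𝓝 τ)) :
    Tendsto (fun s => (τ - υ (κ * s)) / √(1 - s)) (𝓝[<] 1)
      (𝓝 √(2 / (κ * iteratedDeriv 2 (fun v => mu R θ x v) τ))) := by
  have hκ0 : 0 < κ := hκ ▸ rho_pos hk1 hk hx hτ Step.s
  have hμ := iteratedDeriv_two_mu_pos hk1 hk hV hx hτ hd θ
  set M := iteratedDeriv 2 (fun v => mu R θ x v) τ with hM
  have htay := taylor_two_isLittleO (contDiffAt_mu hk1 hk hx hτ θ (n := 2) two_ne_zero)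
    (hasDerivAt_mu hk1 hk hx hτ hd θ).deriv
  have hI : ∀ᶠ s in 𝓝[<] (1 : ℝ), s ∈ Ioo (0 : ℝ) 1 := Ioo_mem_nhdsLT one_pos
  have hmul : Tendsto (fun s : ℝ => κ * s) (𝓝[<] 1) (𝓝[<] κ) := by
    refine tendsto_nhdsWithin_iff.2 ⟨?_, ?_⟩
    · have : Tendsto (fun s : ℝ => κ * s) (𝓝 1) (𝓝 (κ * 1)) := Continuous.tendsto (by fun_prop) 1
      rw [mul_one] at this
      exact this.mono_left nhdsWithin_le_nhds
    · filter_upwards [hI] with s hs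
      exact mul_lt_of_lt_one_right hκ0 hs.2
  have hmem : ∀ s ∈ Ioo (0 : ℝ) 1, κ * s ∈ Ioo 0 κ := fun s hs =>
    ⟨mul_pos hκ0 hs.1, mul_lt_of_lt_one_right hκ0 hs.2⟩
  have h1 := (htay.comp_tendsto (hυτ.comp hmul)).tendsto_div_nhds_zero.add_const (M / 2)
  rw [zero_add] at h1
  have h2 : Tendsto (fun s => κ * s * ((1 - s) / (κ * s) / (υ (κ * s) - τ) ^ 2)) (𝓝[<] 1)
      (𝓝 (κ * (M / 2))) := by
    refine (hmul.mono_right nhdsWithin_le_nhds).mul (h1.congr' ?_)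
    filter_upwards [hI] with s hs
    obtain ⟨h3, h4, h5⟩ := hυ _ (hmem s hs)
    have h6 : (υ (κ * s) - τ) ^ 2 ≠ 0 := by
      have := sub_ne_zero.2 h4.ne
      positivity
    -- On the branch μ = 1/(κs), so the second-order Taylor expansion of μ at τ can be solved for τ
    -- - υ.
    have h7 : mu R θ x (υ (κ * s)) - mu R θ x τ = (1 - s) / (κ * s) := by
      rw [mu, mu, rho_eq_rho hk1 hk hx h3 θ Step.s, rho_eq_rho hk1 hk hx hτ θ Step.s, h5, hκ]
      have := hs.1
      field_simp
    simp only [Function.comp]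
    rw [h7, ← hM, sub_div, mul_div_cancel_right₀ _ h6, sub_add_cancel]
  have h3 := (h2.inv₀ (by positivity)).sqrt
  have h4 : (κ * (M / 2))⁻¹ = 2 / (κ * M) := by field_simp
  rw [h4] at h3
  refine h3.congr' ?_
  filter_upwards [hI] with s hs
  obtain ⟨-, h4, -⟩ := hυ _ (hmem s hs)
  have h5 : 0 < 1 - s := by linarith [hs.2]
  have h6 : 0 < τ - υ (κ * s) := sub_pos.2 h4
  have h7 : (κ * s * ((1 - s) / (κ * s) / (υ (κ * s) - τ) ^ 2))⁻¹ = (τ - υ (κ * s)) ^ 2 / (1 - s) := by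
    have h8 := hs.1
    have h9 : υ (κ * s) - τ ≠ 0 := sub_ne_zero.2 h4.ne
    field_simp
    ring
  rw [h7, Real.sqrt_div (sq_nonneg _), Real.sqrt_sq h6.le]

end KappaTau

end TwoStep

namespace TwoStep

section Driftless

open scoped Matrix

variable {R : Rule} {k : ℕ} {x τ κ : ℝ}

/-! ### The constants at the driftless point -/

lemma hasDerivAt_B_driftless (hk1 : 1 ≤ k) (hk : ∀ i j : Step, 0 < (transferMatrix R ^ k) i j)
    (hx : 0 < x) (hτ : 0 < τ) (hκ : rho R Step.s x τ = κ)
    (hd : deriv (fun v => rho R Step.s x v) τ = 0) (θ : Step) :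
    HasDerivAt (fun v => B R θ κ x v) 0 τ := by
  have h := hasDerivAt_B_snd hk1 hk hx hτ θ Step.s
  rwa [hd, zero_mul, neg_zero, hκ] at h

lemma hasDerivAt_stepWeight (x : ℝ) (j : Step) {y : ℝ} (hy : y ≠ 0) :
    HasDerivAt (fun v => stepWeight x v j) (j.dy / y * stepWeight x y j) y := by
  refine ((hasDerivAt_zpow j.dy y (Or.inl hy)).const_mul (x ^ j.dx)).congr_deriv ?_
  rw [stepWeight, zpow_sub_one₀ hy]
  ring

lemma differentiableAt_firstPassageGF (hk1 : 1 ≤ k)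
    (hk : ∀ i j : Step, 0 < (transferMatrix R ^ k) i j) (hx : 0 < x) (hτ : 0 < τ)
    (hκ : rho R Step.s x τ = κ) (θ j : Step) :
    DifferentiableAt ℝ (fun v => firstPassageGF R θ j κ x v) τ := by
  have hsub := subcritical_rho hk1 hk hx hτ θ Step.s
  rw [hκ] at hsub
  exact (hasDerivAt_fst_of_hasFDerivAt ((hsub.contDiffAt_firstPassageGF hx j
    (n := 1)).differentiableAt one_ne_zero).hasFDerivAt).differentiableAt

/-- The Poisson equation satisfied by the derivative of the first-passage vector. -/
lemma deriv_firstPassageGF (hk1 : 1 ≤ k) (hk : ∀ i j : Step, 0 < (transferMatrix R ^ k) i j)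
    (hx : 0 < x) (hτ : 0 < τ) (hκ : rho R Step.s x τ = κ)
    (hd : deriv (fun v => rho R Step.s x v) τ = 0) (θ j : Step) :
    deriv (fun v => firstPassageGF R θ j κ x v) τ =
      ((κ • weightMatrix R x τ) *ᵥ fun i => deriv (fun v => firstPassageGF R θ i κ x v) τ) j +
        j.dy / τ * firstPassageGF R θ j κ x τ := by
  have hκ0 : 0 < κ := hκ ▸ rho_pos hk1 hk hx hτ Step.s
  have hsub := subcritical_rho hk1 hk hx hτ θ Step.s
  rw [hκ] at hsub
  have hB := hasDerivAt_B_driftless hk1 hk hx hτ hκ hd θ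
  have hB1 : B R θ κ x τ = 1 := hκ ▸ B_rho hk1 hk hx hτ θ Step.s
  have hF := fun i => (differentiableAt_firstPassageGF hk1 hk hx hτ hκ θ i).hasDerivAt
  have hev : (fun v => firstPassageGF R θ j κ x v) =ᶠ[𝓝 τ] fun v =>
      κ * (stepWeight x v j * ∑ i, transferReal R j i * firstPassageGF R θ i κ x v) +
        (if j = θ then κ else 0) * (stepWeight x v θ * (1 - B R θ κ x v)) := by
    have hc : Tendsto (fun v : ℝ => (v, κ)) (𝓝 τ) (𝓝 (τ, κ)) := Continuous.tendsto (by fun_prop) _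
    filter_upwards [hc.eventually hsub.eventually] with v hv
    rw [firstPassageGF_eigen hx.ne' hv.1.ne' (hv.summable hx) j]
    simp only [Matrix.mulVec, dotProduct, weightMatrix, Matrix.of_apply, Finset.mul_sum, ite_mul,
      zero_mul, mul_assoc]
  -- At the driftless point both 1 - B and its y-derivative vanish, so the defect term drops out and
  -- the only source comes from differentiating the step weights.
  have hder := (((hasDerivAt_stepWeight x j hτ.ne').mul (HasDerivAt.fun_sum fun i (_ : i ∈ Finset.univ)
    => (hF i).const_mul (transferReal R j i))).const_mul κ).add
    (((hasDerivAt_stepWeight x θ hτ.ne').mul (hB.const_sub 1)).const_mul (if j = θ then κ else 0))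
  rw [hev.deriv_eq]
  refine hder.deriv.trans ?_
  have hj := congrFun (weightMatrix_mulVec_firstPassageGF hk1 hk hx hτ θ Step.s) j
  rw [hκ] at hj
  simp only [Pi.smul_apply, smul_eq_mul] at hj
  rw [eq_inv_mul_iff_mul_eq₀ hκ0.ne'] at hj
  rw [← hj, Matrix.smul_mulVec, Pi.smul_apply, smul_eq_mul]
  simp only [hB1, sub_self, mul_zero, neg_zero, add_zero, Matrix.mulVec, dotProduct, weightMatrix,
    Matrix.of_apply, mul_assoc, ← Finset.mul_sum]
  ring

/-- The amplitude `C' - D' C / D` of the square-root singularity. -/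
noncomputable def amplitude (R : Rule) (θ : Step) (x κ τ : ℝ) : ℝ :=
  deriv (fun v => C R θ κ x v) τ - deriv (fun v => D R θ κ x v) τ * (C R θ κ x τ / D R θ κ x τ)

lemma firstPassageGF_driftless_pos (hk1 : 1 ≤ k)
    (hk : ∀ i j : Step, 0 < (transferMatrix R ^ k) i j) (hx : 0 < x) (hτ : 0 < τ)
    (hκ : rho R Step.s x τ = κ) (θ j : Step) : 0 < firstPassageGF R θ j κ x τ :=
  hκ ▸ firstPassageGF_rho_pos hk1 hk hx hτ θ Step.s j

lemma C_eq_driftless (hk1 : 1 ≤ k) (hk : ∀ i j : Step, 0 < (transferMatrix R ^ k) i j)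
    (hx : 0 < x) (hτ : 0 < τ) (hκ : rho R Step.s x τ = κ) (θ : Step) :
    C R θ κ x τ = ∑ i, if i ≠ Step.s then firstPassageGF R θ i κ x τ else 0 := by
  have hsub := subcritical_rho hk1 hk hx hτ θ Step.s
  rw [hκ] at hsub
  exact C_eq_sum (hsub.summable hx)

lemma hasDerivAt_C_driftless (hk1 : 1 ≤ k) (hk : ∀ i j : Step, 0 < (transferMatrix R ^ k) i j)
    (hx : 0 < x) (hτ : 0 < τ) (hκ : rho R Step.s x τ = κ) (θ : Step) :
    HasDerivAt (fun v => C R θ κ x v)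
      (∑ i, if i ≠ Step.s then deriv (fun v => firstPassageGF R θ i κ x v) τ else 0) τ := by
  have hsub := subcritical_rho hk1 hk hx hτ θ Step.s
  rw [hκ] at hsub
  have hev : (fun v => C R θ κ x v) =ᶠ[𝓝 τ] fun v =>
      ∑ i, if i ≠ Step.s then firstPassageGF R θ i κ x v else 0 := by
    have hc : Tendsto (fun v : ℝ => (v, κ)) (𝓝 τ) (𝓝 (τ, κ)) := Continuous.tendsto (by fun_prop) _
    filter_upwards [hc.eventually hsub.eventually] with v hv
    exact C_eq_sum (hv.summable hx)
  refine HasDerivAt.congr_of_eventuallyEq (HasDerivAt.fun_sum fun i _ => ?_) hev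
  split_ifs
  · exact (differentiableAt_firstPassageGF hk1 hk hx hτ hκ θ i).hasDerivAt
  · exact hasDerivAt_const _ _

lemma C_driftless_pos (hk1 : 1 ≤ k) (hk : ∀ i j : Step, 0 < (transferMatrix R ^ k) i j)
    (hx : 0 < x) (hτ : 0 < τ) (hκ : rho R Step.s x τ = κ) (θ : Step) : 0 < C R θ κ x τ := by
  have hF := firstPassageGF_driftless_pos hk1 hk hx hτ hκ θ
  rw [C_eq_driftless hk1 hk hx hτ hκ θ]
  refine Finset.sum_pos' (fun i _ => ?_) ⟨Step.n, Finset.mem_univ _, ?_⟩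
  · split_ifs
    exacts [(hF i).le, le_rfl]
  · rw [if_pos (by decide)]
    exact hF _

/-- With r the first-passage vector and v its y-derivative, the amplitude is the sum over i ≠ s of
r_i (v_i/r_i - v_s/r_s). The source dy/τ of the Poisson equation is negative only at `s`, so v/r is
minimal there; it is positive at `n`, which makes that term strictly positive. -/
lemma amplitude_pos (hk1 : 1 ≤ k) (hk : ∀ i j : Step, 0 < (transferMatrix R ^ k) i j)
    (hx : 0 < x) (hτ : 0 < τ) (hκ : rho R Step.s x τ = κ)
    (hd : deriv (fun v => rho R Step.s x v) τ = 0) (θ : Step) : 0 < amplitude R θ x κ τ := by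
  have hκ0 : 0 < κ := hκ ▸ rho_pos hk1 hk hx hτ Step.s
  have hF := firstPassageGF_driftless_pos hk1 hk hx hτ hκ θ
  have heig := weightMatrix_mulVec_firstPassageGF hk1 hk hx hτ θ Step.s
  rw [hκ] at heig
  obtain ⟨h1, h2⟩ := poisson_min (smul_weightMatrix_nonneg hx hτ hκ0)
    (smul_weightMatrix_pow_pos hk hx hτ hκ0) hF (smul_weightMatrix_mulVec hκ0 heig)
    (deriv_firstPassageGF hk1 hk hx hτ hκ hd θ) (s := Step.s) (by
      intro i hi
      refine div_nonneg ?_ hτ.le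
      cases i <;> simp_all [Step.dy])
  set v := fun i => deriv (fun v => firstPassageGF R θ i κ x v) τ with hv
  set r := fun i => firstPassageGF R θ i κ x τ with hr
  have hamp : amplitude R θ x κ τ = ∑ i, if i ≠ Step.s then r i * (v i / r i - v Step.s / r Step.s)
      else 0 := by
    rw [amplitude, (hasDerivAt_C_driftless hk1 hk hx hτ hκ θ).deriv,
      C_eq_driftless hk1 hk hx hτ hκ θ, Finset.sum_div, Finset.mul_sum, ← Finset.sum_sub_distrib]
    refine Finset.sum_congr rfl fun i _ => ?_
    split_ifs
    · have h3 := (hF i).ne'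
      have h4 := (hF Step.s).ne'
      change v i - v Step.s * (r i / r Step.s) = _
      rw [mul_sub, mul_div_cancel₀ _ h3]
      ring
    · simp
  rw [hamp]
  refine Finset.sum_pos' (fun i _ => ?_) ⟨Step.n, Finset.mem_univ _, ?_⟩
  · split_ifs
    exacts [mul_nonneg (hF i).le (sub_nonneg.2 (h1 i)), le_rfl]
  · rw [if_pos (by decide)]
    exact mul_pos (hF _) (sub_pos.2 (h2 _ (div_pos (by norm_num [Step.dy]) hτ)))

lemma c0_eq (R : Rule) (θ : Step) (x κ τ : ℝ) :
    c0 R θ x κ τ = √(2 / (κ * iteratedDeriv 2 (fun v => mu R θ x v) τ)) *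
      (1 / (κ * deriv (fun t => B R θ t x τ) κ)) * amplitude R θ x κ τ := rfl

lemma c0_pos (hk1 : 1 ≤ k) (hk : ∀ i j : Step, 0 < (transferMatrix R ^ k) i j)
    (hV : VerticallyUnbounded R) (hx : 0 < x) (hτ : 0 < τ) (hκ : rho R Step.s x τ = κ)
    (hd : deriv (fun v => rho R Step.s x v) τ = 0) (θ : Step) : 0 < c0 R θ x κ τ := by
  have hκ0 : 0 < κ := hκ ▸ rho_pos hk1 hk hx hτ Step.s
  have h1 : 0 < deriv (fun t => B R θ t x τ) κ := hκ ▸ deriv_B_rho_pos hk1 hk hx hτ θ Step.s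
  have h2 := iteratedDeriv_two_mu_pos hk1 hk hV hx hτ hd θ
  have h3 := amplitude_pos hk1 hk hx hτ hκ hd θ
  rw [c0_eq]
  positivity

end Driftless

end TwoStep

namespace TwoStep

section Kernel

open scoped Matrix

variable {R : Rule} {k : ℕ} {x y t τ κ : ℝ} {r : Step → ℝ}

/-! ### The kernel equation -/

lemma halfPrefix_succ_eq_vecMul (hx : x ≠ 0) (hy : y ≠ 0) (m : ℕ) :
    (fun j => halfPrefix R j (m + 1) x y) =
      (fun i => halfPrefix R i m x y - if i = Step.s then boundaryFn R m x y else 0) ᵥ*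
        weightMatrix R x y := by
  funext j
  rw [halfPrefix_succ]
  simp only [Matrix.vecMul, dotProduct, weightMatrix, Matrix.of_apply]
  refine Finset.sum_congr rfl fun i _ => ?_
  rw [halfPartition_succ R i m hx hy]
  ring

/-- The half-plane walks of length `m`, weighted by an eigenvector. -/
noncomputable def weightedMass (R : Rule) (r : Step → ℝ) (t x y : ℝ) (m : ℕ) : ℝ :=
  t ^ m * ((fun j => halfPrefix R j m x y) ⬝ᵥ r)

lemma weightedMass_zero : weightedMass R r t x y 0 = ∑ j, r j := by
  simp [weightedMass, dotProduct, halfPrefix_zero]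

/-- Pairing with a fixed vector of tW hides the transfer step; only the loss of the forbidden south
steps at the boundary remains. -/
lemma weightedMass_succ (hx : x ≠ 0) (hy : y ≠ 0)
    (h : (t • weightMatrix R x y) *ᵥ r = r) (m : ℕ) :
    weightedMass R r t x y (m + 1) =
      weightedMass R r t x y m - t ^ m * boundaryFn R m x y * r Step.s := by
  have h1 : t * ((fun j => halfPrefix R j (m + 1) x y) ⬝ᵥ r) =
      (fun i => halfPrefix R i m x y - if i = Step.s then boundaryFn R m x y else 0) ⬝ᵥ r := by
    rw [halfPrefix_succ_eq_vecMul hx hy, ← Matrix.dotProduct_mulVec, ← smul_eq_mul,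
      ← dotProduct_smul, ← Matrix.smul_mulVec, h]
  rw [weightedMass, pow_succ, mul_assoc, h1, weightedMass]
  simp only [dotProduct, sub_mul, Finset.sum_sub_distrib, ite_mul, zero_mul, Finset.sum_ite_eq',
    Finset.mem_univ, if_true]
  ring

lemma weightedMass_nonneg (hx : 0 < x) (hy : 0 < y) (ht : 0 < t) (hr : ∀ i, 0 < r i) (m : ℕ) :
    0 ≤ weightedMass R r t x y m :=
  mul_nonneg (pow_nonneg ht.le m)
    (Finset.sum_nonneg fun j _ => mul_nonneg (halfPrefix_nonneg R j m hx hy) (hr j).le)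

lemma weightedMass_antitone (hx : 0 < x) (hy : 0 < y) (ht : 0 < t) (hr : ∀ i, 0 < r i)
    (h : (t • weightMatrix R x y) *ᵥ r = r) : Antitone (weightedMass R r t x y) := by
  refine antitone_nat_of_succ_le fun m => ?_
  rw [weightedMass_succ hx.ne' hy.ne' h]
  have := mul_nonneg (mul_nonneg (pow_nonneg ht.le m) (boundaryFn_nonneg R m (y := y) hx))
    (hr Step.s).le
  linarith

lemma halfPrefix_le_weightedMass (hx : 0 < x) (hy : 0 < y) (ht : 0 < t) (hr : ∀ i, 0 < r i)
    (j : Step) (m : ℕ) :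
    t ^ m * halfPrefix R j m x y ≤ weightedMass R r t x y m / r j := by
  rw [le_div_iff₀ (hr j), mul_assoc]
  refine mul_le_mul_of_nonneg_left ?_ (pow_nonneg ht.le m)
  exact Finset.single_le_sum (f := fun j => halfPrefix R j m x y * r j)
    (fun i _ => mul_nonneg (halfPrefix_nonneg R i m hx hy) (hr i).le) (Finset.mem_univ j)

/-- The kernel equation, on the branch of the kernel below the driftless point. -/
lemma hasSum_boundaryFn {r' : Step → ℝ} (hx : 0 < x) (hy : 0 < y) (hyτ : y ≤ τ) (ht : 0 < t)
    (htκ : t < κ) (hr : ∀ i, 0 < r i) (h : (t • weightMatrix R x y) *ᵥ r = r)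
    (hr' : ∀ i, 0 < r' i) (h' : (κ • weightMatrix R x τ) *ᵥ r' = r') :
    HasSum (fun m => t ^ m * boundaryFn R m x τ) ((∑ j, r j) / r Step.s) := by
  have hτ : 0 < τ := hy.trans_le hyτ
  have hκ : 0 < κ := ht.trans htκ
  have hsum : ∀ N, ∑ m ∈ Finset.range N, t ^ m * boundaryFn R m x τ =
      (∑ j, r j - weightedMass R r t x y N) / r Step.s := by
    intro N
    rw [eq_div_iff (hr Step.s).ne', Finset.sum_mul, ← weightedMass_zero (R := R) (r := r) (t := t)
      (x := x) (y := y), ← Finset.sum_range_sub']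
    refine Finset.sum_congr rfl fun m _ => ?_
    rw [weightedMass_succ hx.ne' hy.ne' h, boundaryFn_eq R m x τ y]
    ring
  -- Heights are nonnegative, so y ≤ τ bounds the walks at y by those at τ; the mass at (τ, κ) is
  -- bounded, and t < κ yields the factor (t/κ)^m.
  have hlim : Tendsto (weightedMass R r t x y) atTop (𝓝 0) := by
    have hgeo : Tendsto (fun m : ℕ => (t / κ) ^ m * ∑ j, (∑ i, r' i) / r' j * r j) atTop
        (𝓝 0) := by
      have := (tendsto_pow_atTop_nhds_zero_of_lt_one (div_nonneg ht.le hκ.le)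
        ((div_lt_one hκ).2 htκ)).mul_const (∑ j, (∑ i, r' i) / r' j * r j)
      rwa [zero_mul] at this
    refine squeeze_zero (weightedMass_nonneg hx hy ht hr) (fun m => ?_) hgeo
    rw [weightedMass, dotProduct, Finset.mul_sum, Finset.mul_sum]
    refine Finset.sum_le_sum fun j _ => ?_
    have h1 := halfPrefix_le_weightedMass (R := R) hx hτ hκ hr' j m
    have h2 : weightedMass R r' κ x τ m ≤ ∑ i, r' i := by
      rw [← weightedMass_zero (R := R) (r := r') (t := κ) (x := x) (y := τ)]
      exact weightedMass_antitone hx hτ hκ hr' h' (Nat.zero_le m)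
    have h3 : κ ^ m * halfPrefix R j m x y ≤ (∑ i, r' i) / r' j :=
      (mul_le_mul_of_nonneg_left (halfPrefix_mono R j m hx hy hyτ) (pow_nonneg hκ.le m)).trans
        (h1.trans (div_le_div_of_nonneg_right h2 (hr' j).le))
    have h4 : t ^ m * (halfPrefix R j m x y * r j) =
        (t / κ) ^ m * (κ ^ m * halfPrefix R j m x y * r j) := by
      rw [div_pow]
      field_simp
    rw [h4]
    exact mul_le_mul_of_nonneg_left (mul_le_mul_of_nonneg_right h3 (hr j).le)
      (pow_nonneg (div_nonneg ht.le hκ.le) m)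
  rw [hasSum_iff_tendsto_nat_of_nonneg
    (fun m => mul_nonneg (pow_nonneg ht.le m) (boundaryFn_nonneg R m hx))]
  simp_rw [hsum]
  simpa using (hlim.const_sub (∑ j, r j)).div_const (r Step.s)

/-- The generating function of the weighted masses. -/
lemma one_sub_mul_tsum_weightedMass {s S : ℝ} (hx : 0 < x) (hτ : 0 < τ) (hκ : 0 < κ)
    (hr : ∀ i, 0 < r i) (h : (κ • weightMatrix R x τ) *ᵥ r = r) (hs0 : 0 < s) (hs1 : s < 1)
    (hS : HasSum (fun m => (κ * s) ^ m * boundaryFn R m x τ) S) :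
    (1 - s) * ∑' m, weightedMass R r κ x τ m * s ^ m = ∑ j, r j - s * r Step.s * S := by
  have hsum := summable_mul_pow_of_antitone (weightedMass_nonneg (R := R) hx hτ hκ hr)
    (weightedMass_antitone hx hτ hκ hr h) hs0.le hs1
  have h1 : ∑' m, weightedMass R r κ x τ m * s ^ m =
      ∑ j, r j + ∑' m, weightedMass R r κ x τ (m + 1) * s ^ (m + 1) := by
    rw [hsum.tsum_eq_zero_add, pow_zero, mul_one, weightedMass_zero]
  have h2 : ∑' m, weightedMass R r κ x τ (m + 1) * s ^ (m + 1) =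
      s * ∑' m, weightedMass R r κ x τ m * s ^ m - s * r Step.s * S := by
    rw [← hS.tsum_eq, ← tsum_mul_left, ← tsum_mul_left, ← (hsum.mul_left s).tsum_sub
      (hS.summable.mul_left _)]
    refine tsum_congr fun m => ?_
    rw [weightedMass_succ hx.ne' hτ.ne' h]
    ring
  linarith

/-- The square-root singularity of the generating function of the weighted masses. -/
lemma tendsto_sqrt_mul_tsum_weightedMass (hk1 : 1 ≤ k)
    (hk : ∀ i j : Step, 0 < (transferMatrix R ^ k) i j) (hV : VerticallyUnbounded R) (hx : 0 < x)
    (hτ : 0 < τ) (hκ : rho R Step.s x τ = κ) (hd : deriv (fun v => rho R Step.s x v) τ = 0)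
    (θ : Step) {υ : ℝ → ℝ} (hυ : ∀ t ∈ Ioo 0 κ, 0 < υ t ∧ υ t < τ ∧ rho R Step.s x (υ t) = t)
    (hυτ : Tendsto υ (𝓝[<] κ) (𝓝 τ)) :
    Tendsto (fun s => √(1 - s) *
        ∑' m, weightedMass R (fun j => firstPassageGF R θ j κ x τ) κ x τ m * s ^ m) (𝓝[<] 1)
      (𝓝 (√(2 / (κ * iteratedDeriv 2 (fun v => mu R θ x v) τ)) * amplitude R θ x κ τ)) := by
  have hκ0 : 0 < κ := hκ ▸ rho_pos hk1 hk hx hτ Step.s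
  have hF := firstPassageGF_driftless_pos hk1 hk hx hτ hκ θ
  have hsub := subcritical_rho hk1 hk hx hτ θ Step.s
  have heig := weightMatrix_mulVec_firstPassageGF hk1 hk hx hτ θ Step.s
  rw [hκ] at hsub heig
  have heig' := smul_weightMatrix_mulVec hκ0 heig
  have hbr := tendsto_lower_branch hk1 hk hV hx hτ hκ hd θ hυ hυτ
  set M := √(2 / (κ * iteratedDeriv 2 (fun v => mu R θ x v) τ)) with hM
  have hI : ∀ᶠ s in 𝓝[<] (1 : ℝ), s ∈ Ioo (0 : ℝ) 1 := Ioo_mem_nhdsLT one_pos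
  -- The boundary series at κs is 1 + g at (υ(κs), κs), because the entries of the first-passage
  -- vector add up to D + C and its south entry is D.
  set g : ℝ × ℝ → ℝ := fun q => C R θ q.2 x q.1 / D R θ q.2 x q.1 with hg
  have hD0 : D R θ κ x τ ≠ 0 := (hF Step.s).ne'
  have hgd : DifferentiableAt ℝ g (τ, κ) := by
    have hD' : ContDiffAt ℝ 1 (fun q : ℝ × ℝ => D R θ q.2 x q.1) (τ, κ) :=
      hsub.contDiffAt_firstPassageGF hx Step.s
    exact ((hsub.contDiffAt_C hx).div hD' hD0).differentiableAt one_ne_zero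
  have hg1 : fderiv ℝ g (τ, κ) (1, 0) * D R θ κ x τ = amplitude R θ x κ τ := by
    have h1 := hasDerivAt_fst_of_hasFDerivAt hgd.hasFDerivAt
    have h2 := (hasDerivAt_C_driftless hk1 hk hx hτ hκ θ).differentiableAt.hasDerivAt.div
      (differentiableAt_firstPassageGF hk1 hk hx hτ hκ θ Step.s).hasDerivAt hD0
    rw [h1.unique h2, amplitude]
    simp only [D_eq] at hD0 ⊢
    field_simp
  set d : ℝ → ℝ × ℝ := fun s => (υ (κ * s) - τ, κ * s - κ) with hdd
  have hsq : Tendsto (fun s : ℝ => √(1 - s)) (𝓝[<] 1) (𝓝 0) := by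
    have : Tendsto (fun s : ℝ => √(1 - s)) (𝓝 1) (𝓝 √(1 - 1)) :=
      Continuous.tendsto (by fun_prop) 1
    rw [sub_self, Real.sqrt_zero] at this
    exact this.mono_left nhdsWithin_le_nhds
  have hcd : Tendsto (fun s => (√(1 - s))⁻¹ • d s) (𝓝[<] 1) (𝓝 (-M, 0)) := by
    refine Tendsto.prodMk_nhds ?_ ?_
    · refine hbr.neg.congr fun s => ?_
      simp only [hdd, smul_eq_mul]
      ring
    · have := (hsq.const_mul (-κ))
      rw [mul_zero] at this
      refine this.congr' ?_
      filter_upwards [hI] with s hs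
      have h1 : 0 < 1 - s := by linarith [hs.2]
      have h2 := Real.mul_self_sqrt h1.le
      have h3 : √(1 - s) ≠ 0 := (Real.sqrt_pos.2 h1).ne'
      simp only [hdd, smul_eq_mul]
      rw [eq_inv_mul_iff_mul_eq₀ h3]
      linear_combination (-κ) * h2
  have hd0 : Tendsto d (𝓝[<] 1) (𝓝 0) := by
    have h1 := hsq.smul hcd
    rw [zero_smul] at h1
    refine h1.congr' ?_
    filter_upwards [hI] with s hs
    have h1 : 0 < 1 - s := by linarith [hs.2]
    rw [smul_smul, mul_inv_cancel₀ (Real.sqrt_pos.2 h1).ne', one_smul]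
  have hlim := (hasFDerivWithinAt_univ.2 hgd.hasFDerivAt).lim hd0
    (Eventually.of_forall fun _ => mem_univ _) hcd
  have hcont : Tendsto (fun s => g ((τ, κ) + d s)) (𝓝[<] 1) (𝓝 (g (τ, κ))) := by
    refine hgd.continuousAt.tendsto.comp ?_
    simpa using hd0.const_add (τ, κ)
  -- With g₁ and g₀ the values of g on the branch and at (τ, κ), the recursion divided by √(1-s)
  -- reads √(1-s) Σ p_m s^m = D (√(1-s)(1 + g₁) - (g₁ - g₀)/√(1-s)).
  have hfin := ((hsq.mul (hcont.const_add 1)).sub hlim).const_mul (D R θ κ x τ)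
  have hval : D R θ κ x τ * (0 * (1 + g (τ, κ)) - fderiv ℝ g (τ, κ) (-M, 0)) =
      M * amplitude R θ x κ τ := by
    have : ((-M, 0) : ℝ × ℝ) = (-M) • (1, 0) := by simp
    rw [this, map_smul, smul_eq_mul, ← hg1]
    ring
  rw [hval] at hfin
  refine hfin.congr' ?_
  filter_upwards [hI] with s hs
  have hmem : κ * s ∈ Ioo 0 κ := ⟨mul_pos hκ0 hs.1, mul_lt_of_lt_one_right hκ0 hs.2⟩
  obtain ⟨hy, hyτ, hρ⟩ := hυ _ hmem
  have hFs := firstPassageGF_driftless_pos hk1 hk hx hy hρ θ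
  have heigs := weightMatrix_mulVec_firstPassageGF hk1 hk hx hy θ Step.s
  rw [hρ] at heigs
  have hS := hasSum_boundaryFn hx hy hyτ.le hmem.1 hmem.2 hFs
    (smul_weightMatrix_mulVec hmem.1 heigs) hF heig'
  have hP := one_sub_mul_tsum_weightedMass hx hτ hκ0 hF heig' hs.1 hs.2 hS
  have hsplit : ∀ r : Step → ℝ, ∑ j, r j = r Step.s + ∑ j, if j ≠ Step.s then r j else 0 := by
    intro r
    have : r Step.s = ∑ j, if j = Step.s then r j else 0 := by simp
    rw [this, ← Finset.sum_add_distrib]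
    refine Finset.sum_congr rfl fun j _ => ?_
    by_cases hj : j = Step.s <;> simp [hj]
  have hCs := C_eq_driftless hk1 hk hx hy hρ θ
  have hC := C_eq_driftless hk1 hk hx hτ hκ θ
  rw [hsplit fun j => firstPassageGF R θ j κ x τ,
    hsplit fun j => firstPassageGF R θ j (κ * s) x (υ (κ * s)), ← hCs, ← hC] at hP
  have hq : (τ, κ) + d s = (υ (κ * s), κ * s) := by simp [hdd]
  have h1 : 0 < 1 - s := by linarith [hs.2]
  have h3 : √(1 - s) ≠ 0 := (Real.sqrt_pos.2 h1).ne'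
  have h2 := Real.mul_self_sqrt h1.le
  rw [hq]
  have hDs : firstPassageGF R θ Step.s (κ * s) x (υ (κ * s)) ≠ 0 := (hFs _).ne'
  have hD0' : firstPassageGF R θ Step.s κ x τ ≠ 0 := (hF _).ne'
  rw [add_div, div_self hDs] at hP
  simp only [hg, D_eq, smul_eq_mul]
  rw [← mul_left_inj' h3]
  set g₁ := C R θ (κ * s) x (υ (κ * s)) / firstPassageGF R θ Step.s (κ * s) x (υ (κ * s))
  have h5 : C R θ κ x τ = C R θ κ x τ / firstPassageGF R θ Step.s κ x τ *
      firstPassageGF R θ Step.s κ x τ := (div_mul_cancel₀ _ hD0').symm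
  set g₀ := C R θ κ x τ / firstPassageGF R θ Step.s κ x τ
  rw [h5] at hP
  have h6 : (√(1 - s))⁻¹ * √(1 - s) = 1 := inv_mul_cancel₀ h3
  set F := firstPassageGF R θ Step.s κ x τ
  set Q := ∑' m, weightedMass R (fun j => firstPassageGF R θ j κ x τ) κ x τ m * s ^ m
  linear_combination (F * (1 + g₁) - Q) * h2 - F * (g₁ - g₀) * h6 - hP

end Kernel

end TwoStep

namespace TwoStep

section Transfer

/-! ### Transfer to the coefficients and to the complex disc -/

lemma tendsto_sqrt_succ_div : Tendsto (fun m : ℕ => √((m : ℝ) + 1) / √m) atTop (𝓝 1) := by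
  have h1 : Tendsto (fun m : ℕ => √((m : ℝ) / (m + 1))⁻¹) atTop (𝓝 √1⁻¹) :=
    ((tendsto_natCast_div_add_atTop (1 : ℝ)).inv₀ one_ne_zero).sqrt
  rw [inv_one, Real.sqrt_one] at h1
  refine h1.congr fun m => ?_
  rw [inv_div, Real.sqrt_div (by positivity)]

lemma tendsto_sqrt_mul_succ {f : ℕ → ℝ} {c : ℝ}
    (h : Tendsto (fun m : ℕ => √m * f m) atTop (𝓝 c)) :
    Tendsto (fun m : ℕ => √m * f (m + 1)) atTop (𝓝 c) := by
  have h1 := ((tendsto_add_atTop_iff_nat 1).2 h).mul (tendsto_sqrt_succ_div.inv₀ one_ne_zero)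
  rw [inv_one, mul_one] at h1
  refine h1.congr fun m => ?_
  have : √((m : ℝ) + 1) ≠ 0 := (Real.sqrt_pos.2 (by positivity)).ne'
  push_cast
  rw [inv_div]
  field_simp

lemma tendsto_sqrt_mul_of_succ {f : ℕ → ℝ} {c : ℝ}
    (h : Tendsto (fun m : ℕ => √m * f (m + 1)) atTop (𝓝 c)) :
    Tendsto (fun m : ℕ => √m * f m) atTop (𝓝 c) := by
  rw [← tendsto_add_atTop_iff_nat 1]
  have h1 := h.mul tendsto_sqrt_succ_div
  rw [mul_one] at h1
  refine h1.congr' ?_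
  filter_upwards [eventually_gt_atTop 0] with m hm
  have : √(m : ℝ) ≠ 0 := (Real.sqrt_pos.2 (by exact_mod_cast hm)).ne'
  push_cast
  field_simp

variable {p h : ℕ → ℝ} {c q : ℝ}

lemma tendsto_sqrt_mul_of_sub (hc : Tendsto (fun m : ℕ => √m * p m) atTop (𝓝 (c / √Real.pi)))
    (he : Tendsto (fun m : ℕ => √m * |h (m + 1) - q * p m|) atTop (𝓝 0)) :
    Tendsto (fun m : ℕ => √m * h m) atTop (𝓝 (q * c / √Real.pi)) := by
  refine tendsto_sqrt_mul_of_succ ?_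
  have h1 : Tendsto (fun m : ℕ => √m * (h (m + 1) - q * p m)) atTop (𝓝 0) := by
    rw [tendsto_zero_iff_abs_tendsto_zero]
    refine he.congr fun m => ?_
    simp [abs_mul, abs_of_nonneg (Real.sqrt_nonneg _)]
  have h2 := (hc.const_mul q).add h1
  rw [add_zero, mul_div_assoc'] at h2
  exact h2.congr fun m => by ring

/-- The square-root singularity of the generating function of a sequence that is a summable
perturbation of a monotone one. -/
lemma isEquivalent_tsum_of_sub (hp0 : ∀ m, 0 ≤ p m) (hp : Antitone p) (hc0 : 0 < c) (hq : 0 < q)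
    (hc : Tendsto (fun m : ℕ => √m * p m) atTop (𝓝 (c / √Real.pi))) (h0 : h 0 = 0)
    (hs : Summable fun m => |h (m + 1) - q * p m|) :
    (fun z : ℂ => ∑' m, (h m : ℂ) * z ^ m) ~[𝓝[Metric.ball 0 1] 1]
      fun z : ℂ => ((q * c : ℝ) : ℂ) * (1 - z) ^ (-(1 / 2) : ℂ) := by
  have hlim := tendsto_sqrt_norm_mul_tsum_sub hp0 hp hc0.le hc
  set l := 𝓝[Metric.ball (0 : ℂ) 1] (1 : ℂ) with hl
  set K := ∑' m, |h (m + 1) - q * p m| with hK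
  have hball : ∀ᶠ z in l, ‖z‖ < 1 := by
    filter_upwards [self_mem_nhdsWithin] with z hz using by simpa using hz
  have hnorm : Tendsto (fun z : ℂ => ‖1 - z‖) l (𝓝 0) := by
    have : Tendsto (fun z : ℂ => ‖1 - z‖) (𝓝 1) (𝓝 ‖(1 : ℂ) - 1‖) :=
      Continuous.tendsto (by fun_prop) 1
    rw [sub_self, norm_zero] at this
    exact this.mono_left nhdsWithin_le_nhds
  have hG : ∀ z : ℂ, ‖z‖ < 1 → √‖1 - z‖ * ‖(1 - z) ^ (-(1 / 2) : ℂ)‖ = 1 := by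
    intro z hz
    have hz1 : 0 < ‖1 - z‖ := by
      rw [norm_pos_iff, sub_ne_zero]
      rintro rfl
      simp at hz
    have : (-(1 / 2) : ℂ) = ((-(1 / 2) : ℝ) : ℂ) := by push_cast; ring
    rw [this, Complex.norm_cpow_real, Real.sqrt_eq_rpow, ← Real.rpow_add hz1]
    simp
  have hbound : ∀ᶠ z in l, √‖1 - z‖ * ‖(∑' m, (h m : ℂ) * z ^ m) -
      ((q * c : ℝ) : ℂ) * (1 - z) ^ (-(1 / 2) : ℂ)‖ ≤
      q * (√‖1 - z‖ * ‖∑' m, (p m : ℂ) * z ^ m - c * ∑' m, (invSqrtCoeff m : ℂ) * z ^ m‖) +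
        √‖1 - z‖ * K + q * c * ‖1 - z‖ := by
    filter_upwards [hball] with z hz
    rw [(hasSum_invSqrtCoeff hz).tsum_eq]
    have hsp := summable_cast_mul_pow_of_antitone hp0 hp hz
    have hle : ∀ m, ‖((h (m + 1) - q * p m : ℝ) : ℂ) * z ^ m‖ ≤ |h (m + 1) - q * p m| := by
      intro m
      rw [norm_mul, norm_pow, Complex.norm_real, Real.norm_eq_abs]
      exact mul_le_of_le_one_right (abs_nonneg _) (pow_le_one₀ (norm_nonneg _) hz.le)
    have hse : Summable fun m => ((h (m + 1) - q * p m : ℝ) : ℂ) * z ^ m :=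
      Summable.of_norm_bounded hs hle
    have hE : ‖∑' m, ((h (m + 1) - q * p m : ℝ) : ℂ) * z ^ m‖ ≤ K :=
      tsum_of_norm_bounded hs.hasSum hle
    have hsum : HasSum (fun m => (h (m + 1) : ℂ) * z ^ (m + 1))
        (z * (q * ∑' m, (p m : ℂ) * z ^ m + ∑' m, ((h (m + 1) - q * p m : ℝ) : ℂ) * z ^ m)) := by
      refine (((hsp.hasSum.mul_left (q : ℂ)).add hse.hasSum).mul_left z).congr_fun ?_
      intro m
      push_cast
      ring
    have htot := (hasSum_nat_add_iff (f := fun m => (h m : ℂ) * z ^ m) 1).1 hsum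
    simp only [Finset.range_one, Finset.sum_singleton, h0, Complex.ofReal_zero, zero_mul,
      add_zero] at htot
    rw [htot.tsum_eq]
    set P := ∑' m, (p m : ℂ) * z ^ m
    set E := ∑' m, ((h (m + 1) - q * p m : ℝ) : ℂ) * z ^ m
    set G := (1 - z) ^ (-(1 / 2) : ℂ) with hGdef
    -- The factor z comes from the index shift; replacing it by 1 on the main term costs (1-z)G. E
    -- is bounded, so it disappears after multiplication by √|1-z|.
    have hid : z * (q * P + E) - ((q * c : ℝ) : ℂ) * G =
        z * q * (P - c * G) + z * E - (1 - z) * ((q * c : ℝ) : ℂ) * G := by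
      push_cast
      ring
    rw [hid]
    have h1 : ‖z * q * (P - c * G) + z * E - (1 - z) * ((q * c : ℝ) : ℂ) * G‖ ≤
        q * ‖P - c * G‖ + K + ‖1 - z‖ * (q * c) * ‖G‖ := by
      refine (norm_sub_le _ _).trans (add_le_add ((norm_add_le _ _).trans (add_le_add ?_ ?_)) ?_)
      · rw [norm_mul, norm_mul, Complex.norm_real, Real.norm_eq_abs, abs_of_pos hq]
        exact mul_le_mul_of_nonneg_right (mul_le_of_le_one_left hq.le hz.le) (norm_nonneg _)
      · rw [norm_mul]
        exact (mul_le_of_le_one_left (norm_nonneg _) hz.le).trans hE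
      · rw [norm_mul, norm_mul, Complex.norm_real, Real.norm_eq_abs, abs_of_pos (mul_pos hq hc0)]
    have h2 := mul_le_mul_of_nonneg_left h1 (Real.sqrt_nonneg ‖1 - z‖)
    refine h2.trans (le_of_eq ?_)
    linear_combination (‖1 - z‖ * (q * c)) * hG z hz
  have hzero : Tendsto (fun z : ℂ => √‖1 - z‖ * ‖(∑' m, (h m : ℂ) * z ^ m) -
      ((q * c : ℝ) : ℂ) * (1 - z) ^ (-(1 / 2) : ℂ)‖) l (𝓝 0) := by
    have hR := ((hlim.const_mul q).add (hnorm.sqrt.mul_const K)).add (hnorm.const_mul (q * c))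
    simp only [Real.sqrt_zero, mul_zero, zero_mul, add_zero] at hR
    exact squeeze_zero' (Eventually.of_forall fun z => by positivity) hbound hR
  have hqc : 0 < q * c := mul_pos hq hc0
  refine isLittleO_of_tendsto' ?_ ?_
  · filter_upwards [hball] with z hz hz0
    exfalso
    have h1 := hG z hz
    rcases mul_eq_zero.1 hz0 with h2 | h2
    · exact hqc.ne' (by exact_mod_cast h2)
    · rw [h2, norm_zero, mul_zero] at h1
      exact zero_ne_one h1
  · rw [tendsto_zero_iff_norm_tendsto_zero]
    have h1 := hzero.div_const (q * c)
    rw [zero_div] at h1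
    refine h1.congr' ?_
    filter_upwards [hball] with z hz
    have h2 := hG z hz
    have h3 : ‖(1 - z) ^ (-(1 / 2) : ℂ)‖ ≠ 0 := fun h3 => by rw [h3, mul_zero] at h2; simp at h2
    have h4 : ‖((q * c : ℝ) : ℂ)‖ = q * c := by
      rw [Complex.norm_real, Real.norm_eq_abs, abs_of_pos hqc]
    simp only [Pi.sub_apply]
    rw [norm_div, norm_mul ((q * c : ℝ) : ℂ), h4]
    rw [div_eq_div_iff hqc.ne' (mul_ne_zero hqc.ne' h3)]
    linear_combination (‖(∑' m, (h m : ℂ) * z ^ m) -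
      ((q * c : ℝ) : ℂ) * (1 - z) ^ (-(1 / 2) : ℂ)‖ * (q * c)) * h2

end Transfer

end TwoStep

namespace TwoStep

section Perturbation

open scoped Matrix

/-! ### Perturbed powers of a primitive matrix -/

variable {ι : Type*} [Fintype ι] [DecidableEq ι] {S : Matrix ι ι ℝ} {r w : ι → ℝ}
  {d : ℕ → ι → ℝ} {A : ℕ → ℝ}

/-- S does not expand the r-weighted norm, so the perturbations of k consecutive steps merely add
up. -/
lemma sum_abs_sub_vecMul_pow_le (hS : ∀ i j, 0 ≤ S i j) (hr : ∀ i, 0 < r i) (h : S *ᵥ r = r)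
    (hA : ∀ m, 0 ≤ A m) (hd : ∀ m, d (m + 1) = d m ᵥ* S - A m • w) (k m : ℕ) :
    ∑ j, |(d (m + k) - d m ᵥ* S ^ k) j| * r j ≤
      (∑ i ∈ Finset.range k, A (m + i)) * ∑ j, |w j| * r j := by
  induction k with
  | zero => simp
  | succ k ih =>
    have h1 : d (m + (k + 1)) - d m ᵥ* S ^ (k + 1) =
        (d (m + k) - d m ᵥ* S ^ k) ᵥ* S - A (m + k) • w := by
      rw [← add_assoc, hd, pow_succ, ← Matrix.vecMul_vecMul, Matrix.sub_vecMul]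
      abel
    have h2 := sum_abs_vecMul_mul_le hS hr (γ := 1) (by rw [h, one_smul])
      (d (m + k) - d m ᵥ* S ^ k)
    rw [h1, Finset.sum_range_succ, add_mul]
    calc ∑ j, |((d (m + k) - d m ᵥ* S ^ k) ᵥ* S - A (m + k) • w) j| * r j
        ≤ ∑ j, (|((d (m + k) - d m ᵥ* S ^ k) ᵥ* S) j| * r j + A (m + k) * (|w j| * r j)) := by
          refine Finset.sum_le_sum fun j _ => ?_
          have h3 := abs_sub (((d (m + k) - d m ᵥ* S ^ k) ᵥ* S) j) (A (m + k) * w j)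
          rw [abs_mul, abs_of_nonneg (hA _)] at h3
          rw [Pi.sub_apply, Pi.smul_apply, smul_eq_mul, ← mul_assoc, ← add_mul]
          exact mul_le_mul_of_nonneg_right h3 (hr j).le
      _ = ∑ j, |((d (m + k) - d m ᵥ* S ^ k) ᵥ* S) j| * r j +
            A (m + k) * ∑ j, |w j| * r j := by
          rw [Finset.sum_add_distrib, Finset.mul_sum]
      _ ≤ _ := by
          rw [one_mul] at h2
          exact add_le_add (h2.trans ih) le_rfl

lemma tendsto_sqrt_mul_add (hA : Tendsto (fun m : ℕ => √m * A m) atTop (𝓝 0)) (i : ℕ) :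
    Tendsto (fun m : ℕ => √m * A (m + i)) atTop (𝓝 0) := by
  induction i with
  | zero => simpa using hA
  | succ i ih =>
    exact (tendsto_sqrt_mul_succ (f := fun m => A (m + i)) ih).congr fun m => by
      rw [add_right_comm, add_assoc]

/-- Every k steps the weighted norm contracts on the hyperplane orthogonal to r, up to a sum of k
shifts of A; the contracting recursions then transfer both decay properties of A to d. -/
lemma summable_and_tendsto_of_vecMul [Nonempty ι] {k : ℕ} (hS : ∀ i j, 0 ≤ S i j)
    (hSk : ∀ i j, 0 < (S ^ k) i j) (hr : ∀ i, 0 < r i) (h : S *ᵥ r = r)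
    (hA : ∀ m, 0 ≤ A m) (hAs : Summable A)
    (hA0 : Tendsto (fun m : ℕ => √m * A m) atTop (𝓝 0))
    (hd : ∀ m, d (m + 1) = d m ᵥ* S - A m • w) (hdr : ∀ m, d m ⬝ᵥ r = 0) (j : ι) :
    (Summable fun m => |d m j|) ∧ Tendsto (fun m : ℕ => √m * |d m j|) atTop (𝓝 0) := by
  obtain ⟨γ, hγ0, hγ1, hγ⟩ := exists_contraction hSk hr h
  set N := ∑ j, |w j| * r j with hN
  have hN0 : 0 ≤ N := Finset.sum_nonneg fun j _ => mul_nonneg (abs_nonneg _) (hr j).le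
  have he0 : ∀ m, 0 ≤ ∑ j, |d m j| * r j := fun m =>
    Finset.sum_nonneg fun j _ => mul_nonneg (abs_nonneg _) (hr j).le
  have hrec : ∀ m, ∑ j, |d (m + k) j| * r j ≤
      γ * ∑ j, |d m j| * r j + (∑ i ∈ Finset.range k, A (m + i)) * N := by
    intro m
    have h1 := sum_abs_sub_vecMul_pow_le hS hr h hA hd k m
    have h2 := hγ (d m) (hdr m)
    refine le_trans ?_ (add_le_add h2 h1)
    rw [← Finset.sum_add_distrib]
    refine Finset.sum_le_sum fun j _ => ?_
    rw [← add_mul, Pi.sub_apply]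
    refine mul_le_mul_of_nonneg_right ?_ (hr j).le
    have := abs_add_le ((d m ᵥ* S ^ k) j) (d (m + k) j - (d m ᵥ* S ^ k) j)
    rwa [add_sub_cancel] at this
  have hb0 : ∀ m, 0 ≤ (∑ i ∈ Finset.range k, A (m + i)) * N := fun m =>
    mul_nonneg (Finset.sum_nonneg fun i _ => hA _) hN0
  have hbs : Summable fun m => (∑ i ∈ Finset.range k, A (m + i)) * N :=
    (summable_sum fun i _ => (summable_nat_add_iff i).2 hAs).mul_right N
  have hbt : Tendsto (fun m : ℕ => √m * ((∑ i ∈ Finset.range k, A (m + i)) * N)) atTop (𝓝 0) := by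
    have h1 := (tendsto_finsetSum (Finset.range k) fun i _ => tendsto_sqrt_mul_add hA0 i).mul_const N
    simp only [Finset.sum_const_zero, zero_mul] at h1
    refine h1.congr fun m => ?_
    rw [← Finset.mul_sum, mul_assoc]
  have hs := summable_of_le_mul_add he0 hb0 hγ1 hbs hrec
  have ht := tendsto_sqrt_mul_of_le_mul_add he0 hγ0 hγ1 hbt hrec
  have hle : ∀ m, |d m j| ≤ (∑ j, |d m j| * r j) * (r j)⁻¹ := by
    intro m
    rw [← div_eq_mul_inv, le_div_iff₀ (hr j)]
    exact Finset.single_le_sum (f := fun j => |d m j| * r j)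
      (fun i _ => mul_nonneg (abs_nonneg _) (hr i).le) (Finset.mem_univ j)
  refine ⟨Summable.of_nonneg_of_le (fun m => abs_nonneg _) hle (hs.mul_right _), ?_⟩
  have h3 := ht.mul_const (r j)⁻¹
  rw [zero_mul] at h3
  refine squeeze_zero (fun m => by positivity) (fun m => ?_) h3
  rw [mul_assoc]
  exact mul_le_mul_of_nonneg_left (hle m) (Real.sqrt_nonneg _)

end Perturbation

section Asymptotics

open scoped Matrix

variable {R : Rule} {k : ℕ} {x τ κ : ℝ}

/-! ### Half-plane walks at the driftless point -/

lemma summable_boundaryFn {r : Step → ℝ} (hx : 0 < x) (hτ : 0 < τ) (hκ : 0 < κ)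
    (hr : ∀ i, 0 < r i) (h : (κ • weightMatrix R x τ) *ᵥ r = r) :
    Summable fun m => κ ^ m * boundaryFn R m x τ := by
  refine summable_of_sum_range_le (c := weightedMass R r κ x τ 0 / r Step.s)
    (fun m => mul_nonneg (pow_nonneg hκ.le m) (boundaryFn_nonneg R m hx)) fun N => ?_
  rw [le_div_iff₀ (hr Step.s), Finset.sum_mul]
  have h1 : ∑ m ∈ Finset.range N, κ ^ m * boundaryFn R m x τ * r Step.s =
      weightedMass R r κ x τ 0 - weightedMass R r κ x τ N := by
    rw [← Finset.sum_range_sub']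
    refine Finset.sum_congr rfl fun m _ => ?_
    rw [weightedMass_succ hx.ne' hτ.ne' h]
    ring
  rw [h1]
  linarith [weightedMass_nonneg (R := R) hx hτ hκ hr N]

/-- The boundary term is a difference of consecutive masses, whose √m-rescalings have the same
limit. -/
lemma tendsto_sqrt_mul_boundaryFn {r : Step → ℝ} {c : ℝ} (hx : 0 < x) (hτ : 0 < τ)
    (hr : ∀ i, 0 < r i) (h : (κ • weightMatrix R x τ) *ᵥ r = r)
    (hc : Tendsto (fun m : ℕ => √m * weightedMass R r κ x τ m) atTop (𝓝 c)) :
    Tendsto (fun m : ℕ => √m * (κ ^ m * boundaryFn R m x τ)) atTop (𝓝 0) := by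
  have h1 := (hc.sub (tendsto_sqrt_mul_succ hc)).div_const (r Step.s)
  rw [sub_self, zero_div] at h1
  refine h1.congr fun m => ?_
  rw [weightedMass_succ hx.ne' hτ.ne' h, div_eq_iff (hr Step.s).ne']
  ring

/-- Half-plane walks are equidistributed along the left Perron eigenvector. -/
lemma summable_and_tendsto_halfPrefix_sub {r l : Step → ℝ} {c : ℝ}
    (hk : ∀ i j : Step, 0 < (transferMatrix R ^ k) i j) (hx : 0 < x) (hτ : 0 < τ) (hκ : 0 < κ)
    (hr : ∀ i, 0 < r i) (h : (κ • weightMatrix R x τ) *ᵥ r = r)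
    (hl : l ᵥ* (κ • weightMatrix R x τ) = l) (hlr : l ⬝ᵥ r = 1)
    (hc : Tendsto (fun m : ℕ => √m * weightedMass R r κ x τ m) atTop (𝓝 c)) (j : Step) :
    (Summable fun m => |κ ^ m * halfPrefix R j m x τ - weightedMass R r κ x τ m * l j|) ∧
      Tendsto (fun m : ℕ => √m * |κ ^ m * halfPrefix R j m x τ - weightedMass R r κ x τ m * l j|)
        atTop (𝓝 0) := by
  refine summable_and_tendsto_of_vecMul (S := κ • weightMatrix R x τ) (r := r)
    -- Each boundary walk removes the south row of κW from the vector and r_s from the mass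
    -- multiplying l.
    (w := (κ • weightMatrix R x τ) Step.s - r Step.s • l)
    (d := fun m j => κ ^ m * halfPrefix R j m x τ - weightedMass R r κ x τ m * l j)
    (A := fun m => κ ^ m * boundaryFn R m x τ)
    (smul_weightMatrix_nonneg hx hτ hκ) (smul_weightMatrix_pow_pos hk hx hτ hκ) hr h
    (fun m => mul_nonneg (pow_nonneg hκ.le m) (boundaryFn_nonneg R m hx))
    (summable_boundaryFn hx hτ hκ hr h) (tendsto_sqrt_mul_boundaryFn hx hτ hr h hc)
    (fun m => ?_) (fun m => ?_) j
  · funext j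
    have h1 := congrFun (halfPrefix_succ_eq_vecMul (R := R) hx.ne' hτ.ne' m) j
    have h2 := congrFun hl j
    simp only [Matrix.vecMul, dotProduct, Matrix.smul_apply, smul_eq_mul, sub_mul,
      Finset.sum_sub_distrib, ite_mul, zero_mul, Finset.sum_ite_eq', Finset.mem_univ, if_true,
      Pi.sub_apply, Pi.smul_apply] at h1 h2 ⊢
    rw [h1, weightedMass_succ hx.ne' hτ.ne' h]
    have h3 : ∑ i, κ ^ m * halfPrefix R i m x τ * (κ * weightMatrix R x τ i j) =
        κ ^ (m + 1) * ∑ i, halfPrefix R i m x τ * weightMatrix R x τ i j := by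
      rw [Finset.mul_sum]
      exact Finset.sum_congr rfl fun i _ => by ring
    have h4 : ∑ i, weightedMass R r κ x τ m * l i * (κ * weightMatrix R x τ i j) =
        weightedMass R r κ x τ m * l j := by
      rw [← h2, Finset.mul_sum]
      exact Finset.sum_congr rfl fun i _ => by ring
    rw [h3, h4]
    ring
  · have h1 : weightedMass R r κ x τ m = ∑ j, κ ^ m * halfPrefix R j m x τ * r j := by
      simp only [weightedMass, dotProduct, Finset.mul_sum, mul_assoc]
    have h2 : ∑ j, weightedMass R r κ x τ m * l j * r j = weightedMass R r κ x τ m := by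
      have h3 : ∑ j, l j * r j = 1 := hlr
      simp only [mul_assoc, ← Finset.mul_sum]
      rw [h3, mul_one]
    simp only [dotProduct, sub_mul, Finset.sum_sub_distrib]
    rw [h2, ← h1, sub_self]

lemma summable_and_tendsto_halfPartition_sub {c : ℝ} (hk1 : 1 ≤ k)
    (hk : ∀ i j : Step, 0 < (transferMatrix R ^ k) i j) (hx : 0 < x) (hτ : 0 < τ)
    (hκ : rho R Step.s x τ = κ) (θ : Step)
    (hc : Tendsto (fun m : ℕ => √m *
      weightedMass R (fun j => firstPassageGF R θ j κ x τ) κ x τ m) atTop (𝓝 c)) :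
    (Summable fun m => |halfPartition R θ (m + 1) x τ * κ ^ (m + 1) -
      1 / (κ * deriv (fun t => B R θ t x τ) κ) *
        weightedMass R (fun j => firstPassageGF R θ j κ x τ) κ x τ m|) ∧
    Tendsto (fun m : ℕ => √m * |halfPartition R θ (m + 1) x τ * κ ^ (m + 1) -
      1 / (κ * deriv (fun t => B R θ t x τ) κ) *
        weightedMass R (fun j => firstPassageGF R θ j κ x τ) κ x τ m|) atTop (𝓝 0) := by
  have hκ0 : 0 < κ := hκ ▸ rho_pos hk1 hk hx hτ Step.s
  have hF := firstPassageGF_driftless_pos hk1 hk hx hτ hκ θ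
  have heig := weightMatrix_mulVec_firstPassageGF hk1 hk hx hτ θ Step.s
  rw [hκ] at heig
  have heig' := smul_weightMatrix_mulVec hκ0 heig
  obtain ⟨l, hl, hal⟩ := exists_left_eigenvector hk1 hk hx hτ Step.s
  have hB := (hasDerivAt_B_rho hk1 hk hx hτ θ Step.s hl hal).deriv
  rw [hκ] at hB hal
  have hself := firstPassageGF_self R θ κ hx.ne' hτ.ne'
  set r := fun j => firstPassageGF R θ j κ x τ with hr
  have hlr : 0 < l ⬝ᵥ r := Finset.sum_pos (fun j _ => mul_pos (hl j) (hF j)) Finset.univ_nonempty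
  set l' := (l ⬝ᵥ r)⁻¹ • l with hl'
  have hl'S : l' ᵥ* (κ • weightMatrix R x τ) = l' := by
    rw [Matrix.vecMul_smul, hl', Matrix.smul_vecMul, hal, smul_comm κ, smul_smul κ,
      mul_inv_cancel₀ hκ0.ne', one_smul]
  have hl'r : l' ⬝ᵥ r = 1 := by
    rw [hl', smul_dotProduct, smul_eq_mul, inv_mul_cancel₀ hlr.ne']
  obtain ⟨h1, h2⟩ := summable_and_tendsto_halfPrefix_sub hk hx hτ hκ0 hF heig' hl'S hl'r hc θ
  have hAs := summable_boundaryFn hx hτ hκ0 hF heig'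
  have hAt := tendsto_sqrt_mul_boundaryFn hx hτ hF heig' hc
  have hw := stepWeight_pos hx hτ θ
  set p := weightedMass R r κ x τ with hp
  -- The proportion of the mass entering a final `θ` step is κ w_θ l'_θ; the formula for ∂_t B
  -- through the left eigenvector gives it the form occurring in c⁰.
  have hq : 1 / (κ * deriv (fun t => B R θ t x τ) κ) = κ * stepWeight x τ θ * l' θ := by
    rw [hB, hl', Pi.smul_apply, smul_eq_mul, ← hself]
    have h3 := (hl θ).ne'
    have h4 := (hF θ).ne'
    field_simp
  have hle : ∀ m, |halfPartition R θ (m + 1) x τ * κ ^ (m + 1) -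
      1 / (κ * deriv (fun t => B R θ t x τ) κ) * p m| ≤ κ * stepWeight x τ θ *
        (|κ ^ m * halfPrefix R θ m x τ - p m * l' θ| + κ ^ m * boundaryFn R m x τ) := by
    intro m
    have hA := mul_nonneg (pow_nonneg hκ0.le m) (boundaryFn_nonneg R m (y := τ) hx)
    have h3 : halfPartition R θ (m + 1) x τ * κ ^ (m + 1) -
        1 / (κ * deriv (fun t => B R θ t x τ) κ) * p m = κ * stepWeight x τ θ *
          ((κ ^ m * halfPrefix R θ m x τ - p m * l' θ) -
            if θ = Step.s then κ ^ m * boundaryFn R m x τ else 0) := by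
      rw [hq, halfPartition_succ R θ m hx.ne' hτ.ne']
      split_ifs <;> ring
    rw [h3, abs_mul, abs_of_pos (mul_pos hκ0 hw)]
    refine mul_le_mul_of_nonneg_left ((abs_sub _ _).trans (add_le_add le_rfl ?_))
      (mul_pos hκ0 hw).le
    split_ifs
    · rw [abs_of_nonneg hA]
    · rw [abs_zero]
      exact hA
  refine ⟨Summable.of_nonneg_of_le (fun m => abs_nonneg _) hle ((h1.add hAs).mul_left _), ?_⟩
  have h3 := (h2.add hAt).const_mul (κ * stepWeight x τ θ)
  rw [add_zero, mul_zero] at h3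
  refine squeeze_zero (fun m => by positivity) (fun m => ?_) h3
  rw [← mul_add, mul_left_comm]
  exact mul_le_mul_of_nonneg_left (hle m) (Real.sqrt_nonneg _)

end Asymptotics

end TwoStep

namespace TwoStep

section Coefficients

variable {a : ℕ → ℝ} {κ c : ℝ}

/-! ### From scaled coefficients to coefficients -/

/-- Ratio test: a nonzero limit of √m a_m κ^m forces consecutive coefficients to have ratio tending
to 1/κ. -/
lemma radius_ofScalars_of_tendsto (hκ : 0 < κ) (hc : 0 < c)
    (h : Tendsto (fun m : ℕ => √m * (a m * κ ^ m)) atTop (𝓝 c)) :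
    (FormalMultilinearSeries.ofScalars ℂ (fun m => (a m : ℂ))).radius = ENNReal.ofReal κ := by
  have h1 := ((((tendsto_sqrt_mul_succ h).div h hc.ne').norm).div_const κ)
  rw [div_self hc.ne', norm_one] at h1
  have h2 : Tendsto (fun m => ‖(a m.succ : ℂ)‖ / ‖(a m : ℂ)‖) atTop (𝓝 (1 / κ)) := by
    refine h1.congr' ?_
    filter_upwards [eventually_gt_atTop 0] with m hm
    have h3 : √(m : ℝ) ≠ 0 := (Real.sqrt_pos.2 (by exact_mod_cast hm)).ne'
    have h4 : κ ^ m ≠ 0 := (pow_pos hκ m).ne'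
    rw [Pi.div_apply, mul_div_mul_left _ _ h3, pow_succ, ← mul_assoc, mul_right_comm,
      mul_div_mul_right _ _ h4, norm_div, norm_mul, Real.norm_of_nonneg hκ.le,
      Complex.norm_real, Complex.norm_real, Nat.succ_eq_add_one]
    have := hκ.ne'
    field_simp
  set r : NNReal := (1 / κ).toNNReal with hr
  have hr0 : 0 < r := Real.toNNReal_pos.2 (by positivity)
  have h3 := FormalMultilinearSeries.ofScalars_radius_eq_inv_of_tendsto ℂ (fun m => (a m : ℂ))
    (r := r) hr0.ne' (by rwa [hr, Real.coe_toNNReal _ (by positivity)])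
  rw [h3, hr, one_div, Real.toNNReal_inv, inv_inv]
  rfl

lemma isEquivalent_of_tendsto_sqrt_mul (hκ : 0 < κ) (hc : 0 < c)
    (h : Tendsto (fun m : ℕ => √m * (a m * κ ^ m)) atTop (𝓝 (c / √Real.pi))) :
    a ~[atTop] fun m : ℕ => c / √(Real.pi * m) * (1 / κ) ^ m := by
  refine isEquivalent_of_tendsto_one ?_
  have hpi : √Real.pi ≠ 0 := (Real.sqrt_pos.2 Real.pi_pos).ne'
  have h1 := h.div_const (c / √Real.pi)
  rw [div_self (div_ne_zero hc.ne' hpi)] at h1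
  refine h1.congr' ?_
  filter_upwards [eventually_gt_atTop 0] with m hm
  have h3 : √(m : ℝ) ≠ 0 := (Real.sqrt_pos.2 (by exact_mod_cast hm)).ne'
  have h4 := hκ.ne'
  have h5 := hc.ne'
  rw [Pi.div_apply, Real.sqrt_mul Real.pi_pos.le, one_div, inv_pow]
  field_simp

lemma isEquivalent_tsum_of_scaled (hκ : 0 < κ)
    (h : (fun z : ℂ => ∑' m, ((a m * κ ^ m : ℝ) : ℂ) * z ^ m) ~[𝓝[Metric.ball 0 1] 1]
      fun z : ℂ => (c : ℂ) * (1 - z) ^ (-(1 / 2) : ℂ)) :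
    (fun t : ℂ => ∑' m, (a m : ℂ) * t ^ m) ~[𝓝[Metric.ball 0 κ] (κ : ℂ)]
      fun t : ℂ => (c : ℂ) * (1 - t / κ) ^ (-(1 / 2) : ℂ) := by
  have hκ' : (κ : ℂ) ≠ 0 := by exact_mod_cast hκ.ne'
  have hk : Tendsto (fun t : ℂ => t / κ) (𝓝[Metric.ball 0 κ] (κ : ℂ)) (𝓝[Metric.ball 0 1] 1) := by
    refine tendsto_nhdsWithin_iff.2 ⟨?_, ?_⟩
    · have : Tendsto (fun t : ℂ => t / κ) (𝓝 (κ : ℂ)) (𝓝 (κ / κ)) :=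
        (continuous_id.div_const _).tendsto _
      rw [div_self hκ'] at this
      exact this.mono_left nhdsWithin_le_nhds
    · filter_upwards [self_mem_nhdsWithin] with t ht
      rw [mem_ball_zero_iff] at ht ⊢
      rw [norm_div, Complex.norm_real, Real.norm_of_nonneg hκ.le]
      exact (div_lt_one hκ).2 ht
  have h1 := h.comp_tendsto hk
  have h2 : (fun z : ℂ => ∑' m, ((a m * κ ^ m : ℝ) : ℂ) * z ^ m) ∘ (fun t : ℂ => t / κ) =
      fun t : ℂ => ∑' m, (a m : ℂ) * t ^ m := by
    funext t
    refine tsum_congr fun m => ?_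
    push_cast
    rw [div_pow]
    field_simp
  rwa [h2] at h1

end Coefficients

/-! ### Vanishing drift and the asymptotics of half-plane walks -/

section Driftless

variable {R : Rule} {k : ℕ} {x τ κ : ℝ}

lemma verticalDrift_driftless (hk1 : 1 ≤ k) (hk : ∀ i j : Step, 0 < (transferMatrix R ^ k) i j)
    (hx : 0 < x) (hτ : 0 < τ) (hκ : rho R Step.s x τ = κ)
    (hd : deriv (fun v => rho R Step.s x v) τ = 0) (θ : Step) : verticalDrift R θ x τ = 0 := by
  rw [verticalDrift, rho_eq_rho hk1 hk hx hτ θ Step.s, hκ,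
    (hasDerivAt_B_driftless hk1 hk hx hτ hκ hd θ).deriv, zero_div]

/-- The asymptotics of half-plane walks at the driftless point. -/
lemma halfPartition_driftless (hk1 : 1 ≤ k) (hk : ∀ i j : Step, 0 < (transferMatrix R ^ k) i j)
    (hV : VerticallyUnbounded R) (hx : 0 < x) (hτ : 0 < τ) (hκ : rho R Step.s x τ = κ)
    (hd : deriv (fun v => rho R Step.s x v) τ = 0) {υ : ℝ → ℝ}
    (hυ : ∀ t ∈ Ioo 0 κ, 0 < υ t ∧ υ t < τ ∧ rho R Step.s x (υ t) = t)
    (hυτ : Tendsto υ (𝓝[<] κ) (𝓝 τ)) (θ : Step) :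
    Tendsto (fun m : ℕ => √m * (halfPartition R θ m x τ * κ ^ m)) atTop
      (𝓝 (c0 R θ x κ τ / √Real.pi)) ∧
    (fun z : ℂ => ∑' m, ((halfPartition R θ m x τ * κ ^ m : ℝ) : ℂ) * z ^ m)
      ~[𝓝[Metric.ball 0 1] 1] fun z : ℂ => (c0 R θ x κ τ : ℂ) * (1 - z) ^ (-(1 / 2) : ℂ) := by
  have hκ0 : 0 < κ := hκ ▸ rho_pos hk1 hk hx hτ Step.s
  have hF := firstPassageGF_driftless_pos hk1 hk hx hτ hκ θ
  have heig := weightMatrix_mulVec_firstPassageGF hk1 hk hx hτ θ Step.s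
  rw [hκ] at heig
  have heig' := smul_weightMatrix_mulVec hκ0 heig
  have hp0 := weightedMass_nonneg (R := R) hx hτ hκ0 hF
  have hp := weightedMass_antitone hx hτ hκ0 hF heig'
  have hsing := tendsto_sqrt_mul_tsum_weightedMass hk1 hk hV hx hτ hκ hd θ hυ hυτ
  have hμ := iteratedDeriv_two_mu_pos hk1 hk hV hx hτ hd θ
  have hamp := amplitude_pos hk1 hk hx hτ hκ hd θ
  have hB : 0 < deriv (fun t => B R θ t x τ) κ := hκ ▸ deriv_B_rho_pos hk1 hk hx hτ θ Step.s
  have hc := tendsto_sqrt_mul_of_tendsto_tsum hp0 hp hsing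
  obtain ⟨hs, ht⟩ := summable_and_tendsto_halfPartition_sub hk1 hk hx hτ hκ θ hc
  have hc0 : c0 R θ x κ τ = 1 / (κ * deriv (fun t => B R θ t x τ) κ) *
      (√(2 / (κ * iteratedDeriv 2 (fun v => mu R θ x v) τ)) * amplitude R θ x κ τ) := by
    rw [c0_eq]
    ring
  rw [hc0]
  refine ⟨tendsto_sqrt_mul_of_sub (h := fun m => halfPartition R θ m x τ * κ ^ m) hc ht,
    isEquivalent_tsum_of_sub (h := fun m => halfPartition R θ m x τ * κ ^ m) hp0 hp
      (by positivity) (by positivity) hc ?_ hs⟩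
  simp [halfPartition_zero]

end Driftless

end TwoStep
-- The theorem on half-plane walks at the driftless point
theorem mainTheorem5 (R : TwoStep.Rule) (hA : TwoStep.Aperiodic R)
    (hV : TwoStep.VerticallyUnbounded R) (x : ℝ) (hx : 0 < x) :
    -- `κ(x)` and `τ(x)` are well defined, and `ρ(x,y)` does not depend on the step direction
    (∃! p : ℝ × ℝ, TwoStep.IsKappaTau R x p.1 p.2) ∧
    (∀ θ φ : TwoStep.Step, ∀ y : ℝ, 0 < y → TwoStep.rho R θ x y = TwoStep.rho R φ x y) ∧
    ∀ κ τ : ℝ, TwoStep.IsKappaTau R x κ τ → ∀ θ : TwoStep.Step,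
      -- `ρ(x,τ) = κ` is a root of the kernel
      TwoStep.rho R θ x τ = κ ∧ TwoStep.B R θ κ x τ = 1 ∧
      -- the vertical drift vanishes
      TwoStep.verticalDrift R θ x τ = 0 ∧
      HasDerivAt (fun v => TwoStep.B R θ κ x v) 0 τ ∧
      HasDerivAt (fun v => Real.log (TwoStep.mu R θ x v)) 0 τ ∧
      -- the quantities entering `c⁰` are genuine
      0 < iteratedDeriv 2 (fun v => TwoStep.mu R θ x v) τ ∧
      0 < deriv (fun t => TwoStep.B R θ t x τ) κ ∧
      0 < TwoStep.C R θ κ x τ ∧ 0 < TwoStep.D R θ κ x τ ∧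
      DifferentiableAt ℝ (fun v => TwoStep.C R θ κ x v) τ ∧
      DifferentiableAt ℝ (fun v => TwoStep.D R θ κ x v) τ ∧
      0 < TwoStep.c0 R θ x κ τ ∧
      -- the radius of convergence of `H_θ` is `ρ(x,τ)`
      (FormalMultilinearSeries.ofScalars ℂ
        (fun m => (TwoStep.halfPartition R θ m x τ : ℂ))).radius
          = ENNReal.ofReal (TwoStep.rho R θ x τ) ∧
      -- behaviour of `H_θ` near `t = ρ(x,τ)`
      (fun t : ℂ => TwoStep.H R θ t x τ)
        ~[𝓝[Metric.ball 0 (TwoStep.rho R θ x τ)] (TwoStep.rho R θ x τ : ℂ)]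
        (fun t : ℂ => (TwoStep.c0 R θ x κ τ : ℂ) *
          (1 - t / (TwoStep.rho R θ x τ : ℂ)) ^ (-(1 / 2) : ℂ)) ∧
      -- behaviour of the coefficients
      (fun m : ℕ => TwoStep.halfPartition R θ m x τ)
        ~[atTop]
        (fun m : ℕ => TwoStep.c0 R θ x κ τ / √(Real.pi * m) * (1 / κ) ^ m) := by
  obtain ⟨k, hk1, hk⟩ := hA
  obtain ⟨τ₀, hτ₀, hd₀, hpos, hneg, hzero, hinf⟩ := TwoStep.exists_unimodal hk1 hk hV hx
  have hex := TwoStep.isKappaTau_rho hk1 hk hx hτ₀ hpos hneg hzero hinf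
  refine ⟨⟨(TwoStep.rho R TwoStep.Step.s x τ₀, τ₀), hex, ?_⟩,
    fun θ φ y hy => TwoStep.rho_eq_rho hk1 hk hx hy θ φ, ?_⟩
  · rintro ⟨κ, τ⟩ h
    have hτ := h.eq hk1 hk hx hτ₀ hpos hneg
    have hκ := h.eq_rho hk1 hk hx
    simp only at hτ hκ
    rw [← hκ, hτ]
  intro κ τ h θ
  have hτ : τ = τ₀ := h.eq hk1 hk hx hτ₀ hpos hneg
  subst hτ
  have hκ := h.eq_rho hk1 hk hx
  obtain ⟨υ, hυ, hυτ⟩ := h.lower_branch hx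
  have hκ0 : 0 < κ := h.1
  have hρ : TwoStep.rho R θ x τ = κ := (TwoStep.rho_eq_rho hk1 hk hx hτ₀ θ _).trans hκ
  have hμ := TwoStep.hasDerivAt_mu hk1 hk hx hτ₀ hd₀ θ
  have hμ0 : TwoStep.mu R θ x τ ≠ 0 := by
    rw [TwoStep.mu, hρ]
    exact (one_div_pos.2 hκ0).ne'
  have hlog := hμ.log hμ0
  rw [zero_div] at hlog
  have hc0 := TwoStep.c0_pos hk1 hk hV hx hτ₀ hκ hd₀ θ
  obtain ⟨hcoef, hsing⟩ := TwoStep.halfPartition_driftless hk1 hk hV hx hτ₀ hκ hd₀ hυ hυτ θ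
  rw [hρ]
  exact ⟨rfl, hκ ▸ TwoStep.B_rho hk1 hk hx hτ₀ θ _,
    TwoStep.verticalDrift_driftless hk1 hk hx hτ₀ hκ hd₀ θ,
    TwoStep.hasDerivAt_B_driftless hk1 hk hx hτ₀ hκ hd₀ θ, hlog,
    TwoStep.iteratedDeriv_two_mu_pos hk1 hk hV hx hτ₀ hd₀ θ,
    hκ ▸ TwoStep.deriv_B_rho_pos hk1 hk hx hτ₀ θ _,
    TwoStep.C_driftless_pos hk1 hk hx hτ₀ hκ θ,
    TwoStep.firstPassageGF_driftless_pos hk1 hk hx hτ₀ hκ θ _,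
    (TwoStep.hasDerivAt_C_driftless hk1 hk hx hτ₀ hκ θ).differentiableAt,
    TwoStep.differentiableAt_firstPassageGF hk1 hk hx hτ₀ hκ θ _, hc0,
    TwoStep.radius_ofScalars_of_tendsto hκ0
      (div_pos hc0 (Real.sqrt_pos.2 Real.pi_pos)) hcoef,
    TwoStep.isEquivalent_tsum_of_scaled hκ0 hsing,
    TwoStep.isEquivalent_of_tendsto_sqrt_mul hκ0 hc0 hcoef⟩
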